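/- **Setting.** CBPV$^{-}$ is call-by-push-value with finite products, thunks and returners but without sum types. Fix a signature $\mathcal S$: a set of value base types $\beta$, a set of computation base types $\underline\beta$, and a set of typed operations, each being a value operation $x:A\vdash^{\mathsf v} o(x):A'$, a computation operation $x:A\vdash^{\mathsf c} o(x):\underline B$ or a stack operation $x:A\mid\underline B\vdash^{\mathsf k} o(x):\underline C$, whose types are first-order types over the base types. The *first-order types* over $\mathcal S$ are $$A ::= \beta \mid 1 \mid A\times A \mid U\underline B,\qquad \underline B ::= \underline\beta \mid FA \mid \top \mid \underline B\mathbin{\&}\underline B,$$ and the full types add the function types $A\to\underline B$ to the computation types. In both languages there are values $\Gamma\vdash^{\mathsf v}V:A$ (complex values included), computations $\Gamma\vdash^{\mathsf c}M:\underline B$ and stacks $\Gamma\mid\underline B\vdash^{\mathsf k}K:\underline C$, each considered up to the congruence generated by the $\beta$- and $\eta$-laws of the type formers of that language. For each of the two languages the syntax forms a model. Its category of values has the value types as objects and provable-equality classes of values $x:A\vdash^{\mathsf v}V:B$ as maps $A\to B$. Its locally indexed category of stacks has the computation types as objects and provable-equality classes of stacks $x:A\mid\underline B\vdash^{\mathsf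 k}K:\underline C$ as maps from $\underline B$ to $\underline C$ over $A$, with reindexing given by substitution. Together with the locally indexed adjunction $F\dashv U$ and the finite products, these form the first-order CBPV$^{-}$ model $\mathbf{FOSyn}_{\mathcal S}$ for the first-order language and the CBPV$^{-}$ model $\mathbf{Syn}_{\mathcal S}$ for the full language; in $\mathbf{Syn}_{\mathcal S}$ function types moreover provide powers. Reading each first-order type and term as a type and term of the full language gives a strict map of first-order CBPV$^{-}$ models (one that preserves finite products, $F$, $U$, the unit and the counit on the nose) $$(i,I):\mathbf{FOSyn}_{\mathcal S}\to\mathbf{Syn}_{\mathcal S}.$$ **Theorem (relative full completeness).** For every signature $\mathcal S$, the locally indexed functor $(i,I)$ is fully faithful: the functor $i$ between the categories of values is full and faithful and, for every value type $A$ of the first-order language, so is the functor $I_A$ from the category of stacks over $A$ in $\mathbf{FOSyn}_{\mathcal S}$ to the category of stacks over $iA$ in $\mathbf{Syn}_{\mathcal S}$. Hence function types are conservative over the first-order fragment: two first-order values, computations or stacks in the same first-order context and of the same first-order type are provably equal in the full language if and only if they are provably equal in the first-order language. -/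

import Mathlib

universe u

namespace CBPV

/-! ### Types -/

mutual
/-- Value types over value base types `VB` and computation base types `CB`. Function types are
available exactly when the flag `h` is `true`. -/
inductive VTy (VB CB : Type u) (h : Bool) : Type u
  | base : VB → VTy VB CB h
  | unit : VTy VB CB h
  | prod : VTy VB CB h → VTy VB CB h → VTy VB CB h
  | U : CTy VB CB h → VTy VB CB h

/-- Computation types; `arr` is the type of functions from a value type to a computation type. -/
inductive CTy (VB CB : Type u) (h : Bool) : Type u
  | base : CB → CTy VB CB h
  | F : VTy VB CB h → CTy VB CB h
  | top : CTy VB CB h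
  | prod : CTy VB CB h → CTy VB CB h → CTy VB CB h
  | arr : h = true → VTy VB CB h → CTy VB CB h → CTy VB CB h
end

mutual
/-- Reading a type of a smaller language as a type of a larger one. -/
def VTy.map {VB CB : Type u} {h h' : Bool} (e : h = true → h' = true) :
    VTy VB CB h → VTy VB CB h'
  | .base b => .base b
  | .unit => .unit
  | .prod A B => .prod (A.map e) (B.map e)
  | .U B => .U (B.map e)

/-- Reading a type of a smaller language as a type of a larger one. -/
def CTy.map {VB CB : Type u} {h h' : Bool} (e : h = true → h' = true) :
    CTy VB CB h → CTy VB CB h'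
  | .base b => .base b
  | .F A => .F (A.map e)
  | .top => .top
  | .prod A B => .prod (A.map e) (B.map e)
  | .arr hh A B => .arr (e hh) (A.map e) (B.map e)
end

/-- A first-order type as a type of the language with flag `h`. -/
abbrev VTy.ofFO {VB CB : Type u} (h : Bool) (A : VTy VB CB false) : VTy VB CB h :=
  A.map (fun e => Bool.noConfusion e)

/-- A first-order type as a type of the language with flag `h`. -/
abbrev CTy.ofFO {VB CB : Type u} (h : Bool) (B : CTy VB CB false) : CTy VB CB h :=
  B.map (fun e => Bool.noConfusion e)

mutual
theorem VTy.map_map {VB CB : Type u} {h h' h'' : Bool} (e : h = true → h' = true)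
    (e' : h' = true → h'' = true) :
    ∀ A : VTy VB CB h, (A.map e).map e' = A.map (fun x => e' (e x))
  | .base b => rfl
  | .unit => rfl
  | .prod A B => by simp only [VTy.map, VTy.map_map e e' A, VTy.map_map e e' B]
  | .U B => by simp only [VTy.map, CTy.map_map e e' B]

theorem CTy.map_map {VB CB : Type u} {h h' h'' : Bool} (e : h = true → h' = true)
    (e' : h' = true → h'' = true) :
    ∀ A : CTy VB CB h, (A.map e).map e' = A.map (fun x => e' (e x))
  | .base b => rfl
  | .F A => by simp only [CTy.map, VTy.map_map e e' A]
  | .top => rfl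
  | .prod A B => by simp only [CTy.map, CTy.map_map e e' A, CTy.map_map e e' B]
  | .arr hh A B => by simp only [CTy.map, VTy.map_map e e' A, CTy.map_map e e' B]
end

/-- A signature: base types of both sorts, and typed operations of the three sorts of judgement.
The types of the operations are first-order types over the base types. -/
structure Signature where
  /-- value base types -/
  VBase : Type u
  /-- computation base types -/
  CBase : Type u
  /-- operations `x : vdom o ⊢ o(x) : vcod o` that are values -/
  VOp : Type u
  vdom : VOp → VTy VBase CBase false
  vcod : VOp → VTy VBase CBase false
  /-- operations `x : cdom o ⊢ o(x) : ccod o` that are computations -/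
  COp : Type u
  cdom : COp → VTy VBase CBase false
  ccod : COp → CTy VBase CBase false
  /-- operations `x : kdom o | khole o ⊢ o(x) : kcod o` that are stacks -/
  KOp : Type u
  kdom : KOp → VTy VBase CBase false
  khole : KOp → CTy VBase CBase false
  kcod : KOp → CTy VBase CBase false

/-- The value types over `S`. -/
abbrev Signature.VT (S : Signature.{u}) (h : Bool) : Type u := VTy S.VBase S.CBase h

/-- The computation types over `S`. -/
abbrev Signature.CT (S : Signature.{u}) (h : Bool) : Type u := CTy S.VBase S.CBase h

/-! ### Terms -/

/-- Typed de Bruijn variables. -/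
inductive Var {T : Type u} : List T → T → Type u
  | zero {Γ : List T} {A : T} : Var (A :: Γ) A
  | succ {Γ : List T} {A B : T} : Var Γ A → Var (B :: Γ) A

mutual
/-- Values `Γ ⊢ V : A` (complex values included). -/
inductive Val (S : Signature.{u}) (h : Bool) : List (S.VT h) → S.VT h → Type u
  | var {Γ : List (S.VT h)} {A : S.VT h} : Var Γ A → Val S h Γ A
  | unit {Γ : List (S.VT h)} : Val S h Γ .unit
  | pair {Γ : List (S.VT h)} {A B : S.VT h} :
      Val S h Γ A → Val S h Γ B → Val S h Γ (.prod A B)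
  | fst {Γ : List (S.VT h)} {A B : S.VT h} : Val S h Γ (.prod A B) → Val S h Γ A
  | snd {Γ : List (S.VT h)} {A B : S.VT h} : Val S h Γ (.prod A B) → Val S h Γ B
  | thunk {Γ : List (S.VT h)} {B : S.CT h} : Cmp S h Γ none B → Val S h Γ (.U B)
  | op {Γ : List (S.VT h)} (o : S.VOp) {A B : S.VT h} (hA : A = (S.vdom o).ofFO h)
      (hB : B = (S.vcod o).ofFO h) : Val S h Γ A → Val S h Γ B

/-- `Cmp S h Γ none C` are the computations `Γ ⊢ M : C`, and `Cmp S h Γ (some B) C` are the stacks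
`Γ | B ⊢ K : C`. A stack is written as a computation with one hole of type `B` in evaluation
position, `hole` being the empty stack. -/
inductive Cmp (S : Signature.{u}) (h : Bool) :
    List (S.VT h) → Option (S.CT h) → S.CT h → Type u
  | hole {Γ : List (S.VT h)} {B : S.CT h} : Cmp S h Γ (some B) B
  | force {Γ : List (S.VT h)} {B : S.CT h} : Val S h Γ (.U B) → Cmp S h Γ none B
  | ret {Γ : List (S.VT h)} {A : S.VT h} : Val S h Γ A → Cmp S h Γ none (.F A)
  | to {Γ : List (S.VT h)} {Δ : Option (S.CT h)} {A : S.VT h} {B : S.CT h} :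
      Cmp S h Γ Δ (.F A) → Cmp S h (A :: Γ) none B → Cmp S h Γ Δ B
  | top {Γ : List (S.VT h)} {Δ : Option (S.CT h)} : Cmp S h Γ Δ .top
  | pair {Γ : List (S.VT h)} {Δ : Option (S.CT h)} {B C : S.CT h} :
      Cmp S h Γ Δ B → Cmp S h Γ Δ C → Cmp S h Γ Δ (.prod B C)
  | fst {Γ : List (S.VT h)} {Δ : Option (S.CT h)} {B C : S.CT h} :
      Cmp S h Γ Δ (.prod B C) → Cmp S h Γ Δ B
  | snd {Γ : List (S.VT h)} {Δ : Option (S.CT h)} {B C : S.CT h} :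
      Cmp S h Γ Δ (.prod B C) → Cmp S h Γ Δ C
  | lam {Γ : List (S.VT h)} {Δ : Option (S.CT h)} (hh : h = true) {A : S.VT h} {B : S.CT h} :
      Cmp S h (A :: Γ) Δ B → Cmp S h Γ Δ (.arr hh A B)
  | app {Γ : List (S.VT h)} {Δ : Option (S.CT h)} (hh : h = true) {A : S.VT h} {B : S.CT h} :
      Cmp S h Γ Δ (.arr hh A B) → Val S h Γ A → Cmp S h Γ Δ B
  | cop {Γ : List (S.VT h)} (o : S.COp) {A : S.VT h} {B : S.CT h} (hA : A = (S.cdom o).ofFO h)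
      (hB : B = (S.ccod o).ofFO h) : Val S h Γ A → Cmp S h Γ none B
  | kop {Γ : List (S.VT h)} {Δ : Option (S.CT h)} (o : S.KOp) {A : S.VT h} {B C : S.CT h}
      (hA : A = (S.kdom o).ofFO h) (hB : B = (S.khole o).ofFO h) (hC : C = (S.kcod o).ofFO h) :
      Val S h Γ A → Cmp S h Γ Δ B → Cmp S h Γ Δ C
end

section Substitution

variable {S : Signature.{u}} {h : Bool}

/-- Renamings. -/
abbrev Ren {T : Type u} (Γ Γ' : List T) : Type u := ∀ ⦃A : T⦄, Var Γ A → Var Γ' A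

/-- A renaming extended under a binder. -/
def Ren.lift {T : Type u} {Γ Γ' : List T} {B : T} (ρ : Ren Γ Γ') : Ren (B :: Γ) (B :: Γ')
  | _, .zero => .zero
  | _, .succ x => .succ (ρ x)

/-- The weakening renaming. -/
def Ren.wk {T : Type u} {Γ : List T} {B : T} : Ren Γ (B :: Γ) := fun _ x => .succ x

mutual
/-- Renaming in values. -/
def Val.ren : {Γ Γ' : List (S.VT h)} → {A : S.VT h} → Val S h Γ A → Ren Γ Γ' → Val S h Γ' A
  | _, _, _, .var x, ρ => .var (ρ x)
  | _, _, _, .unit, _ => .unit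
  | _, _, _, .pair V W, ρ => .pair (V.ren ρ) (W.ren ρ)
  | _, _, _, .fst V, ρ => .fst (V.ren ρ)
  | _, _, _, .snd V, ρ => .snd (V.ren ρ)
  | _, _, _, .thunk M, ρ => .thunk (M.ren ρ)
  | _, _, _, .op o hA hB V, ρ => .op o hA hB (V.ren ρ)

/-- Renaming in computations and stacks. -/
def Cmp.ren : {Γ Γ' : List (S.VT h)} → {Δ : Option (S.CT h)} → {C : S.CT h} →
    Cmp S h Γ Δ C → Ren Γ Γ' → Cmp S h Γ' Δ C
  | _, _, _, _, .hole, _ => .hole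
  | _, _, _, _, .force V, ρ => .force (V.ren ρ)
  | _, _, _, _, .ret V, ρ => .ret (V.ren ρ)
  | _, _, _, _, .to M N, ρ => .to (M.ren ρ) (N.ren ρ.lift)
  | _, _, _, _, .top, _ => .top
  | _, _, _, _, .pair M N, ρ => .pair (M.ren ρ) (N.ren ρ)
  | _, _, _, _, .fst M, ρ => .fst (M.ren ρ)
  | _, _, _, _, .snd M, ρ => .snd (M.ren ρ)
  | _, _, _, _, .lam hh M, ρ => .lam hh (M.ren ρ.lift)
  | _, _, _, _, .app hh M V, ρ => .app hh (M.ren ρ) (V.ren ρ)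
  | _, _, _, _, .cop o hA hB V, ρ => .cop o hA hB (V.ren ρ)
  | _, _, _, _, .kop o hA hB hC V M, ρ => .kop o hA hB hC (V.ren ρ) (M.ren ρ)
end

/-- Substitutions. -/
abbrev Subst (S : Signature.{u}) (h : Bool) (Γ Γ' : List (S.VT h)) : Type u :=
  ∀ ⦃A : S.VT h⦄, Var Γ A → Val S h Γ' A

/-- A substitution extended under a binder. -/
def Subst.lift {Γ Γ' : List (S.VT h)} {B : S.VT h} (σ : Subst S h Γ Γ') :
    Subst S h (B :: Γ) (B :: Γ')
  | _, .zero => .var .zero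
  | _, .succ x => (σ x).ren Ren.wk

/-- The empty substitution. -/
def Subst.nil {Γ : List (S.VT h)} : Subst S h [] Γ := fun _ x => nomatch x

/-- A substitution extended by a value for one more variable. -/
def Subst.cons {Γ Γ' : List (S.VT h)} {B : S.VT h} (V : Val S h Γ' B) (σ : Subst S h Γ Γ') :
    Subst S h (B :: Γ) Γ'
  | _, .zero => V
  | _, .succ x => σ x

/-- The identity substitution. -/
def Subst.id {Γ : List (S.VT h)} : Subst S h Γ Γ := fun _ x => .var x

mutual
/-- Substitution in values. -/
def Val.sub : {Γ Γ' : List (S.VT h)} → {A : S.VT h} → Val S h Γ A → Subst S h Γ Γ' → Val S h Γ' A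
  | _, _, _, .var x, σ => σ x
  | _, _, _, .unit, _ => .unit
  | _, _, _, .pair V W, σ => .pair (V.sub σ) (W.sub σ)
  | _, _, _, .fst V, σ => .fst (V.sub σ)
  | _, _, _, .snd V, σ => .snd (V.sub σ)
  | _, _, _, .thunk M, σ => .thunk (M.sub σ)
  | _, _, _, .op o hA hB V, σ => .op o hA hB (V.sub σ)

/-- Substitution of values in computations and stacks. -/
def Cmp.sub : {Γ Γ' : List (S.VT h)} → {Δ : Option (S.CT h)} → {C : S.CT h} →
    Cmp S h Γ Δ C → Subst S h Γ Γ' → Cmp S h Γ' Δ C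
  | _, _, _, _, .hole, _ => .hole
  | _, _, _, _, .force V, σ => .force (V.sub σ)
  | _, _, _, _, .ret V, σ => .ret (V.sub σ)
  | _, _, _, _, .to M N, σ => .to (M.sub σ) (N.sub (Subst.lift σ))
  | _, _, _, _, .top, _ => .top
  | _, _, _, _, .pair M N, σ => .pair (M.sub σ) (N.sub σ)
  | _, _, _, _, .fst M, σ => .fst (M.sub σ)
  | _, _, _, _, .snd M, σ => .snd (M.sub σ)
  | _, _, _, _, .lam hh M, σ => .lam hh (M.sub (Subst.lift σ))
  | _, _, _, _, .app hh M V, σ => .app hh (M.sub σ) (V.sub σ)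
  | _, _, _, _, .cop o hA hB V, σ => .cop o hA hB (V.sub σ)
  | _, _, _, _, .kop o hA hB hC V M, σ => .kop o hA hB hC (V.sub σ) (M.sub σ)
end

/-- What may be put in the hole of a term of `Cmp S h Γ Θ C`: nothing if it is a computation, and a
computation or stack of type `B` if it is a stack from `B`. -/
inductive Fill (S : Signature.{u}) (h : Bool) (Γ : List (S.VT h)) :
    Option (S.CT h) → Option (S.CT h) → Type u
  | nil : Fill S h Γ none none
  | put {Δ : Option (S.CT h)} {B : S.CT h} : Cmp S h Γ Δ B → Fill S h Γ (some B) Δ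

/-- Substitution in the filling. -/
def Fill.sub {Γ Γ' : List (S.VT h)} {Θ Δ : Option (S.CT h)} :
    Fill S h Γ Θ Δ → Subst S h Γ Γ' → Fill S h Γ' Θ Δ
  | .nil, _ => .nil
  | .put M, σ => .put (M.sub σ)

/-- Renaming in the filling. -/
def Fill.ren {Γ Γ' : List (S.VT h)} {Θ Δ : Option (S.CT h)} :
    Fill S h Γ Θ Δ → Ren Γ Γ' → Fill S h Γ' Θ Δ
  | .nil, _ => .nil
  | .put M, ρ => .put (M.ren ρ)

/-- Filling the hole. -/
def Cmp.fill : {Γ : List (S.VT h)} → {Θ Δ : Option (S.CT h)} → {C : S.CT h} →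
    Cmp S h Γ Θ C → Fill S h Γ Θ Δ → Cmp S h Γ Δ C
  | _, _, _, _, .hole, .put M => M
  | _, _, _, _, .force V, .nil => .force V
  | _, _, _, _, .ret V, .nil => .ret V
  | _, _, _, _, .to M N, f => .to (M.fill f) N
  | _, _, _, _, .top, _ => .top
  | _, _, _, _, .pair M N, f => .pair (M.fill f) (N.fill f)
  | _, _, _, _, .fst M, f => .fst (M.fill f)
  | _, _, _, _, .snd M, f => .snd (M.fill f)
  | _, _, _, _, .lam hh M, f => .lam hh (M.fill (f.ren Ren.wk))
  | _, _, _, _, .app hh M V, f => .app hh (M.fill f) V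
  | _, _, _, _, .cop o hA hB V, .nil => .cop o hA hB V
  | _, _, _, _, .kop o hA hB hC V M, f => .kop o hA hB hC V (M.fill f)

/-- `K.plug M` is the stack `K` applied to the computation or stack `M`. -/
abbrev Cmp.plug {Γ : List (S.VT h)} {Δ : Option (S.CT h)} {B C : S.CT h}
    (K : Cmp S h Γ (some B) C) (M : Cmp S h Γ Δ B) : Cmp S h Γ Δ C :=
  K.fill (.put M)

end Substitution

/-! ### The equational theory -/

mutual
/-- Provable equality of values: the congruence generated by the β- and η-laws. -/
inductive VEq {S : Signature.{u}} {h : Bool} :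
    {Γ : List (S.VT h)} → {A : S.VT h} → Val S h Γ A → Val S h Γ A → Prop
  | refl {Γ : List (S.VT h)} {A : S.VT h} (V : Val S h Γ A) : VEq V V
  | symm {Γ : List (S.VT h)} {A : S.VT h} {V W : Val S h Γ A} : VEq V W → VEq W V
  | trans {Γ : List (S.VT h)} {A : S.VT h} {V W X : Val S h Γ A} : VEq V W → VEq W X → VEq V X
  | pair {Γ : List (S.VT h)} {A B : S.VT h} {V V' : Val S h Γ A} {W W' : Val S h Γ B} :
      VEq V V' → VEq W W' → VEq (.pair V W) (.pair V' W')
  | fst {Γ : List (S.VT h)} {A B : S.VT h} {V V' : Val S h Γ (.prod A B)} :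
      VEq V V' → VEq (.fst V) (.fst V')
  | snd {Γ : List (S.VT h)} {A B : S.VT h} {V V' : Val S h Γ (.prod A B)} :
      VEq V V' → VEq (.snd V) (.snd V')
  | thunk {Γ : List (S.VT h)} {B : S.CT h} {M M' : Cmp S h Γ none B} :
      CEq M M' → VEq (.thunk M) (.thunk M')
  | op {Γ : List (S.VT h)} (o : S.VOp) {A B : S.VT h} (hA : A = (S.vdom o).ofFO h)
      (hB : B = (S.vcod o).ofFO h) {V V' : Val S h Γ A} :
      VEq V V' → VEq (.op o hA hB V) (.op o hA hB V')
  | unit_eta {Γ : List (S.VT h)} (V : Val S h Γ .unit) : VEq V .unit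
  | fst_beta {Γ : List (S.VT h)} {A B : S.VT h} (V : Val S h Γ A) (W : Val S h Γ B) :
      VEq (.fst (.pair V W)) V
  | snd_beta {Γ : List (S.VT h)} {A B : S.VT h} (V : Val S h Γ A) (W : Val S h Γ B) :
      VEq (.snd (.pair V W)) W
  | pair_eta {Γ : List (S.VT h)} {A B : S.VT h} (V : Val S h Γ (.prod A B)) :
      VEq V (.pair (.fst V) (.snd V))
  | thunk_eta {Γ : List (S.VT h)} {B : S.CT h} (V : Val S h Γ (.U B)) :
      VEq V (.thunk (.force V))

/-- Provable equality of computations and of stacks. -/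
inductive CEq {S : Signature.{u}} {h : Bool} :
    {Γ : List (S.VT h)} → {Δ : Option (S.CT h)} → {C : S.CT h} →
    Cmp S h Γ Δ C → Cmp S h Γ Δ C → Prop
  | refl {Γ : List (S.VT h)} {Δ : Option (S.CT h)} {C : S.CT h} (M : Cmp S h Γ Δ C) : CEq M M
  | symm {Γ : List (S.VT h)} {Δ : Option (S.CT h)} {C : S.CT h} {M N : Cmp S h Γ Δ C} :
      CEq M N → CEq N M
  | trans {Γ : List (S.VT h)} {Δ : Option (S.CT h)} {C : S.CT h} {M N P : Cmp S h Γ Δ C} :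
      CEq M N → CEq N P → CEq M P
  | force {Γ : List (S.VT h)} {B : S.CT h} {V V' : Val S h Γ (.U B)} :
      VEq V V' → CEq (.force V) (.force V')
  | ret {Γ : List (S.VT h)} {A : S.VT h} {V V' : Val S h Γ A} :
      VEq V V' → CEq (.ret V) (.ret V')
  | to {Γ : List (S.VT h)} {Δ : Option (S.CT h)} {A : S.VT h} {B : S.CT h}
      {M M' : Cmp S h Γ Δ (.F A)} {N N' : Cmp S h (A :: Γ) none B} :
      CEq M M' → CEq N N' → CEq (.to M N) (.to M' N')
  | pair {Γ : List (S.VT h)} {Δ : Option (S.CT h)} {B C : S.CT h} {M M' : Cmp S h Γ Δ B}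
      {N N' : Cmp S h Γ Δ C} : CEq M M' → CEq N N' → CEq (.pair M N) (.pair M' N')
  | fst {Γ : List (S.VT h)} {Δ : Option (S.CT h)} {B C : S.CT h}
      {M M' : Cmp S h Γ Δ (.prod B C)} : CEq M M' → CEq (.fst M) (.fst M')
  | snd {Γ : List (S.VT h)} {Δ : Option (S.CT h)} {B C : S.CT h}
      {M M' : Cmp S h Γ Δ (.prod B C)} : CEq M M' → CEq (.snd M) (.snd M')
  | lam {Γ : List (S.VT h)} {Δ : Option (S.CT h)} (hh : h = true) {A : S.VT h} {B : S.CT h}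
      {M M' : Cmp S h (A :: Γ) Δ B} : CEq M M' → CEq (.lam hh M) (.lam hh M')
  | app {Γ : List (S.VT h)} {Δ : Option (S.CT h)} (hh : h = true) {A : S.VT h} {B : S.CT h}
      {M M' : Cmp S h Γ Δ (.arr hh A B)} {V V' : Val S h Γ A} :
      CEq M M' → VEq V V' → CEq (.app hh M V) (.app hh M' V')
  | cop {Γ : List (S.VT h)} (o : S.COp) {A : S.VT h} {B : S.CT h} (hA : A = (S.cdom o).ofFO h)
      (hB : B = (S.ccod o).ofFO h) {V V' : Val S h Γ A} :
      VEq V V' → CEq (.cop o hA hB V) (.cop o hA hB V')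
  | kop {Γ : List (S.VT h)} {Δ : Option (S.CT h)} (o : S.KOp) {A : S.VT h} {B C : S.CT h}
      (hA : A = (S.kdom o).ofFO h) (hB : B = (S.khole o).ofFO h) (hC : C = (S.kcod o).ofFO h)
      {V V' : Val S h Γ A} {M M' : Cmp S h Γ Δ B} :
      VEq V V' → CEq M M' → CEq (.kop o hA hB hC V M) (.kop o hA hB hC V' M')
  | force_beta {Γ : List (S.VT h)} {B : S.CT h} (M : Cmp S h Γ none B) :
      CEq (.force (.thunk M)) M
  | to_beta {Γ : List (S.VT h)} {A : S.VT h} {B : S.CT h} (V : Val S h Γ A)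
      (N : Cmp S h (A :: Γ) none B) : CEq (.to (.ret V) N) (N.sub (Subst.cons V Subst.id))
  | to_eta {Γ : List (S.VT h)} {Δ : Option (S.CT h)} {A : S.VT h} {B : S.CT h}
      (K : Cmp S h Γ (some (.F A)) B) (M : Cmp S h Γ Δ (.F A)) :
      CEq (K.plug M) (.to M ((K.ren Ren.wk).plug (.ret (.var .zero))))
  | top_eta {Γ : List (S.VT h)} {Δ : Option (S.CT h)} (M : Cmp S h Γ Δ .top) : CEq M .top
  | fst_beta {Γ : List (S.VT h)} {Δ : Option (S.CT h)} {B C : S.CT h} (M : Cmp S h Γ Δ B)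
      (N : Cmp S h Γ Δ C) : CEq (.fst (.pair M N)) M
  | snd_beta {Γ : List (S.VT h)} {Δ : Option (S.CT h)} {B C : S.CT h} (M : Cmp S h Γ Δ B)
      (N : Cmp S h Γ Δ C) : CEq (.snd (.pair M N)) N
  | pair_eta {Γ : List (S.VT h)} {Δ : Option (S.CT h)} {B C : S.CT h}
      (M : Cmp S h Γ Δ (.prod B C)) : CEq M (.pair (.fst M) (.snd M))
  | app_beta {Γ : List (S.VT h)} {Δ : Option (S.CT h)} (hh : h = true) {A : S.VT h} {B : S.CT h}
      (M : Cmp S h (A :: Γ) Δ B) (V : Val S h Γ A) :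
      CEq (.app hh (.lam hh M) V) (M.sub (Subst.cons V Subst.id))
  | lam_eta {Γ : List (S.VT h)} {Δ : Option (S.CT h)} (hh : h = true) {A : S.VT h} {B : S.CT h}
      (M : Cmp S h Γ Δ (.arr hh A B)) :
      CEq M (.lam hh (.app hh (M.ren Ren.wk) (.var .zero)))
end

/-! ### Substitution lemmas -/

section SubstitutionLemmas

variable {S : Signature.{u}} {h : Bool}

theorem Ren.lift_comp {T : Type u} {Γ Γ' Γ'' : List T} {B : T} (ρ : Ren Γ Γ') (τ : Ren Γ' Γ'') :
    (fun _ x => (Ren.lift (B := B) τ) (ρ.lift x) : Ren (B :: Γ) (B :: Γ'')) =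
      Ren.lift (fun _ x => τ (ρ x)) := by
  funext A x; cases x <;> rfl

theorem Subst.lift_ren {Γ Γ' Γ'' : List (S.VT h)} {B : S.VT h} (ρ : Ren Γ Γ')
    (σ : Subst S h Γ' Γ'') :
    (fun _ x => (Subst.lift (B := B) σ) (ρ.lift x) : Subst S h (B :: Γ) (B :: Γ'')) =
      Subst.lift (fun _ x => σ (ρ x)) := by
  funext A x; cases x <;> rfl

theorem Subst.lift_id {Γ : List (S.VT h)} {B : S.VT h} :
    Subst.lift (B := B) (Subst.id (S := S) (h := h) (Γ := Γ)) = Subst.id := by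
  funext A x; cases x <;> rfl

mutual
theorem Val.ren_ren : ∀ {Γ Γ' Γ'' : List (S.VT h)} {A : S.VT h} (V : Val S h Γ A) (ρ : Ren Γ Γ')
    (τ : Ren Γ' Γ''), (V.ren ρ).ren τ = V.ren (fun _ x => τ (ρ x))
  | _, _, _, _, .var x, ρ, τ => rfl
  | _, _, _, _, .unit, ρ, τ => rfl
  | _, _, _, _, .pair V W, ρ, τ => by simp only [Val.ren, Val.ren_ren V, Val.ren_ren W]
  | _, _, _, _, .fst V, ρ, τ => by simp only [Val.ren, Val.ren_ren V]
  | _, _, _, _, .snd V, ρ, τ => by simp only [Val.ren, Val.ren_ren V]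
  | _, _, _, _, .thunk M, ρ, τ => by simp only [Val.ren, Cmp.ren_ren M]
  | _, _, _, _, .op o hA hB V, ρ, τ => by simp only [Val.ren, Val.ren_ren V]

theorem Cmp.ren_ren : ∀ {Γ Γ' Γ'' : List (S.VT h)} {Δ : Option (S.CT h)} {C : S.CT h}
    (M : Cmp S h Γ Δ C) (ρ : Ren Γ Γ') (τ : Ren Γ' Γ''),
    (M.ren ρ).ren τ = M.ren (fun _ x => τ (ρ x))
  | _, _, _, _, _, .hole, ρ, τ => rfl
  | _, _, _, _, _, .force V, ρ, τ => by simp only [Cmp.ren, Val.ren_ren V]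
  | _, _, _, _, _, .ret V, ρ, τ => by simp only [Cmp.ren, Val.ren_ren V]
  | _, _, _, _, _, .to M N, ρ, τ => by
      simp only [Cmp.ren, Cmp.ren_ren M, Cmp.ren_ren N, Ren.lift_comp]
  | _, _, _, _, _, .top, ρ, τ => rfl
  | _, _, _, _, _, .pair M N, ρ, τ => by simp only [Cmp.ren, Cmp.ren_ren M, Cmp.ren_ren N]
  | _, _, _, _, _, .fst M, ρ, τ => by simp only [Cmp.ren, Cmp.ren_ren M]
  | _, _, _, _, _, .snd M, ρ, τ => by simp only [Cmp.ren, Cmp.ren_ren M]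
  | _, _, _, _, _, .lam hh M, ρ, τ => by simp only [Cmp.ren, Cmp.ren_ren M, Ren.lift_comp]
  | _, _, _, _, _, .app hh M V, ρ, τ => by simp only [Cmp.ren, Cmp.ren_ren M, Val.ren_ren V]
  | _, _, _, _, _, .cop o hA hB V, ρ, τ => by simp only [Cmp.ren, Val.ren_ren V]
  | _, _, _, _, _, .kop o hA hB hC V M, ρ, τ => by
      simp only [Cmp.ren, Val.ren_ren V, Cmp.ren_ren M]
end

mutual
theorem Val.ren_sub : ∀ {Γ Γ' Γ'' : List (S.VT h)} {A : S.VT h} (V : Val S h Γ A) (ρ : Ren Γ Γ')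
    (σ : Subst S h Γ' Γ''), (V.ren ρ).sub σ = V.sub (fun _ x => σ (ρ x))
  | _, _, _, _, .var x, ρ, τ => rfl
  | _, _, _, _, .unit, ρ, τ => rfl
  | _, _, _, _, .pair V W, ρ, τ => by simp only [Val.ren, Val.sub, Val.ren_sub V, Val.ren_sub W]
  | _, _, _, _, .fst V, ρ, τ => by simp only [Val.ren, Val.sub, Val.ren_sub V]
  | _, _, _, _, .snd V, ρ, τ => by simp only [Val.ren, Val.sub, Val.ren_sub V]
  | _, _, _, _, .thunk M, ρ, τ => by simp only [Val.ren, Val.sub, Cmp.ren_sub M]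
  | _, _, _, _, .op o hA hB V, ρ, τ => by simp only [Val.ren, Val.sub, Val.ren_sub V]

theorem Cmp.ren_sub : ∀ {Γ Γ' Γ'' : List (S.VT h)} {Δ : Option (S.CT h)} {C : S.CT h}
    (M : Cmp S h Γ Δ C) (ρ : Ren Γ Γ') (σ : Subst S h Γ' Γ''),
    (M.ren ρ).sub σ = M.sub (fun _ x => σ (ρ x))
  | _, _, _, _, _, .hole, ρ, τ => rfl
  | _, _, _, _, _, .force V, ρ, τ => by simp only [Cmp.ren, Cmp.sub, Val.ren_sub V]
  | _, _, _, _, _, .ret V, ρ, τ => by simp only [Cmp.ren, Cmp.sub, Val.ren_sub V]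
  | _, _, _, _, _, .to M N, ρ, τ => by
      simp only [Cmp.ren, Cmp.sub, Cmp.ren_sub M, Cmp.ren_sub N, Subst.lift_ren]
  | _, _, _, _, _, .top, ρ, τ => rfl
  | _, _, _, _, _, .pair M N, ρ, τ => by
      simp only [Cmp.ren, Cmp.sub, Cmp.ren_sub M, Cmp.ren_sub N]
  | _, _, _, _, _, .fst M, ρ, τ => by simp only [Cmp.ren, Cmp.sub, Cmp.ren_sub M]
  | _, _, _, _, _, .snd M, ρ, τ => by simp only [Cmp.ren, Cmp.sub, Cmp.ren_sub M]
  | _, _, _, _, _, .lam hh M, ρ, τ => by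
      simp only [Cmp.ren, Cmp.sub, Cmp.ren_sub M, Subst.lift_ren]
  | _, _, _, _, _, .app hh M V, ρ, τ => by
      simp only [Cmp.ren, Cmp.sub, Cmp.ren_sub M, Val.ren_sub V]
  | _, _, _, _, _, .cop o hA hB V, ρ, τ => by simp only [Cmp.ren, Cmp.sub, Val.ren_sub V]
  | _, _, _, _, _, .kop o hA hB hC V M, ρ, τ => by
      simp only [Cmp.ren, Cmp.sub, Val.ren_sub V, Cmp.ren_sub M]
end

theorem Subst.ren_lift {Γ Γ' Γ'' : List (S.VT h)} {B : S.VT h} (σ : Subst S h Γ Γ')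
    (ρ : Ren Γ' Γ'') :
    (fun _ x => ((Subst.lift (B := B) σ) x).ren ρ.lift : Subst S h (B :: Γ) (B :: Γ'')) =
      Subst.lift (fun _ x => (σ x).ren ρ) := by
  funext A x
  cases x with
  | zero => rfl
  | succ x =>
    change ((σ x).ren _).ren _ = ((σ x).ren ρ).ren Ren.wk
    rw [Val.ren_ren, Val.ren_ren]; rfl

mutual
theorem Val.sub_ren : ∀ {Γ Γ' Γ'' : List (S.VT h)} {A : S.VT h} (V : Val S h Γ A)
    (σ : Subst S h Γ Γ') (ρ : Ren Γ' Γ''), (V.sub σ).ren ρ = V.sub (fun _ x => (σ x).ren ρ)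
  | _, _, _, _, .var x, ρ, τ => rfl
  | _, _, _, _, .unit, ρ, τ => rfl
  | _, _, _, _, .pair V W, ρ, τ => by simp only [Val.ren, Val.sub, Val.sub_ren V, Val.sub_ren W]
  | _, _, _, _, .fst V, ρ, τ => by simp only [Val.ren, Val.sub, Val.sub_ren V]
  | _, _, _, _, .snd V, ρ, τ => by simp only [Val.ren, Val.sub, Val.sub_ren V]
  | _, _, _, _, .thunk M, ρ, τ => by simp only [Val.ren, Val.sub, Cmp.sub_ren M]
  | _, _, _, _, .op o hA hB V, ρ, τ => by simp only [Val.ren, Val.sub, Val.sub_ren V]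

theorem Cmp.sub_ren : ∀ {Γ Γ' Γ'' : List (S.VT h)} {Δ : Option (S.CT h)} {C : S.CT h}
    (M : Cmp S h Γ Δ C) (σ : Subst S h Γ Γ') (ρ : Ren Γ' Γ''),
    (M.sub σ).ren ρ = M.sub (fun _ x => (σ x).ren ρ)
  | _, _, _, _, _, .hole, ρ, τ => rfl
  | _, _, _, _, _, .force V, ρ, τ => by simp only [Cmp.ren, Cmp.sub, Val.sub_ren V]
  | _, _, _, _, _, .ret V, ρ, τ => by simp only [Cmp.ren, Cmp.sub, Val.sub_ren V]
  | _, _, _, _, _, .to M N, ρ, τ => by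
      simp only [Cmp.ren, Cmp.sub, Cmp.sub_ren M, Cmp.sub_ren N, Subst.ren_lift]
  | _, _, _, _, _, .top, ρ, τ => rfl
  | _, _, _, _, _, .pair M N, ρ, τ => by
      simp only [Cmp.ren, Cmp.sub, Cmp.sub_ren M, Cmp.sub_ren N]
  | _, _, _, _, _, .fst M, ρ, τ => by simp only [Cmp.ren, Cmp.sub, Cmp.sub_ren M]
  | _, _, _, _, _, .snd M, ρ, τ => by simp only [Cmp.ren, Cmp.sub, Cmp.sub_ren M]
  | _, _, _, _, _, .lam hh M, ρ, τ => by
      simp only [Cmp.ren, Cmp.sub, Cmp.sub_ren M, Subst.ren_lift]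
  | _, _, _, _, _, .app hh M V, ρ, τ => by
      simp only [Cmp.ren, Cmp.sub, Cmp.sub_ren M, Val.sub_ren V]
  | _, _, _, _, _, .cop o hA hB V, ρ, τ => by simp only [Cmp.ren, Cmp.sub, Val.sub_ren V]
  | _, _, _, _, _, .kop o hA hB hC V M, ρ, τ => by
      simp only [Cmp.ren, Cmp.sub, Val.sub_ren V, Cmp.sub_ren M]
end

theorem Subst.sub_lift {Γ Γ' Γ'' : List (S.VT h)} {B : S.VT h} (σ : Subst S h Γ Γ')
    (τ : Subst S h Γ' Γ'') :
    (fun _ x => ((Subst.lift (B := B) σ) x).sub (Subst.lift τ) : Subst S h (B :: Γ) (B :: Γ'')) =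
      Subst.lift (fun _ x => (σ x).sub τ) := by
  funext A x
  cases x with
  | zero => rfl
  | succ x => exact (Val.ren_sub _ _ _).trans (Val.sub_ren _ _ _).symm

mutual
theorem Val.sub_sub : ∀ {Γ Γ' Γ'' : List (S.VT h)} {A : S.VT h} (V : Val S h Γ A)
    (σ : Subst S h Γ Γ') (τ : Subst S h Γ' Γ''),
    (V.sub σ).sub τ = V.sub (fun _ x => (σ x).sub τ)
  | _, _, _, _, .var x, ρ, τ => rfl
  | _, _, _, _, .unit, ρ, τ => rfl
  | _, _, _, _, .pair V W, ρ, τ => by simp only [Val.sub, Val.sub_sub V, Val.sub_sub W]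
  | _, _, _, _, .fst V, ρ, τ => by simp only [Val.sub, Val.sub_sub V]
  | _, _, _, _, .snd V, ρ, τ => by simp only [Val.sub, Val.sub_sub V]
  | _, _, _, _, .thunk M, ρ, τ => by simp only [Val.sub, Cmp.sub_sub M]
  | _, _, _, _, .op o hA hB V, ρ, τ => by simp only [Val.sub, Val.sub_sub V]

theorem Cmp.sub_sub : ∀ {Γ Γ' Γ'' : List (S.VT h)} {Δ : Option (S.CT h)} {C : S.CT h}
    (M : Cmp S h Γ Δ C) (σ : Subst S h Γ Γ') (τ : Subst S h Γ' Γ''),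
    (M.sub σ).sub τ = M.sub (fun _ x => (σ x).sub τ)
  | _, _, _, _, _, .hole, ρ, τ => rfl
  | _, _, _, _, _, .force V, ρ, τ => by simp only [Cmp.sub, Val.sub_sub V]
  | _, _, _, _, _, .ret V, ρ, τ => by simp only [Cmp.sub, Val.sub_sub V]
  | _, _, _, _, _, .to M N, ρ, τ => by
      simp only [Cmp.sub, Cmp.sub_sub M, Cmp.sub_sub N, Subst.sub_lift]
  | _, _, _, _, _, .top, ρ, τ => rfl
  | _, _, _, _, _, .pair M N, ρ, τ => by simp only [Cmp.sub, Cmp.sub_sub M, Cmp.sub_sub N]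
  | _, _, _, _, _, .fst M, ρ, τ => by simp only [Cmp.sub, Cmp.sub_sub M]
  | _, _, _, _, _, .snd M, ρ, τ => by simp only [Cmp.sub, Cmp.sub_sub M]
  | _, _, _, _, _, .lam hh M, ρ, τ => by simp only [Cmp.sub, Cmp.sub_sub M, Subst.sub_lift]
  | _, _, _, _, _, .app hh M V, ρ, τ => by simp only [Cmp.sub, Cmp.sub_sub M, Val.sub_sub V]
  | _, _, _, _, _, .cop o hA hB V, ρ, τ => by simp only [Cmp.sub, Val.sub_sub V]
  | _, _, _, _, _, .kop o hA hB hC V M, ρ, τ => by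
      simp only [Cmp.sub, Val.sub_sub V, Cmp.sub_sub M]
end

mutual
theorem Val.sub_id : ∀ {Γ : List (S.VT h)} {A : S.VT h} (V : Val S h Γ A), V.sub Subst.id = V
  | _, _, .var x => rfl
  | _, _, .unit => rfl
  | _, _, .pair V W => by simp only [Val.sub, Val.sub_id V, Val.sub_id W]
  | _, _, .fst V => by simp only [Val.sub, Val.sub_id V]
  | _, _, .snd V => by simp only [Val.sub, Val.sub_id V]
  | _, _, .thunk M => by simp only [Val.sub, Cmp.sub_id M]
  | _, _, .op o hA hB V => by simp only [Val.sub, Val.sub_id V]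

theorem Cmp.sub_id : ∀ {Γ : List (S.VT h)} {Δ : Option (S.CT h)} {C : S.CT h}
    (M : Cmp S h Γ Δ C), M.sub Subst.id = M
  | _, _, _, .hole => rfl
  | _, _, _, .force V => by simp only [Cmp.sub, Val.sub_id V]
  | _, _, _, .ret V => by simp only [Cmp.sub, Val.sub_id V]
  | _, _, _, .to M N => by simp only [Cmp.sub, Cmp.sub_id M, Cmp.sub_id N, Subst.lift_id]
  | _, _, _, .top => rfl
  | _, _, _, .pair M N => by simp only [Cmp.sub, Cmp.sub_id M, Cmp.sub_id N]
  | _, _, _, .fst M => by simp only [Cmp.sub, Cmp.sub_id M]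
  | _, _, _, .snd M => by simp only [Cmp.sub, Cmp.sub_id M]
  | _, _, _, .lam hh M => by simp only [Cmp.sub, Cmp.sub_id M, Subst.lift_id]
  | _, _, _, .app hh M V => by simp only [Cmp.sub, Cmp.sub_id M, Val.sub_id V]
  | _, _, _, .cop o hA hB V => by simp only [Cmp.sub, Val.sub_id V]
  | _, _, _, .kop o hA hB hC V M => by simp only [Cmp.sub, Val.sub_id V, Cmp.sub_id M]
end

theorem Val.ren_eq_sub {Γ Γ' : List (S.VT h)} {A : S.VT h} (V : Val S h Γ A) (ρ : Ren Γ Γ') :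
    V.ren ρ = V.sub (fun _ x => .var (ρ x)) := by
  rw [← Val.sub_id (V.ren ρ), Val.ren_sub]; rfl

theorem Cmp.ren_eq_sub {Γ Γ' : List (S.VT h)} {Δ : Option (S.CT h)} {C : S.CT h}
    (M : Cmp S h Γ Δ C) (ρ : Ren Γ Γ') : M.ren ρ = M.sub (fun _ x => .var (ρ x)) := by
  rw [← Cmp.sub_id (M.ren ρ), Cmp.ren_sub]; rfl

theorem Fill.ren_eq_sub {Γ Γ' : List (S.VT h)} {Θ Δ : Option (S.CT h)}
    (f : Fill S h Γ Θ Δ) (ρ : Ren Γ Γ') : f.ren ρ = f.sub (fun _ x => .var (ρ x)) := by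
  cases f with
  | nil => rfl
  | put M => exact congrArg Fill.put (M.ren_eq_sub ρ)

theorem Fill.ren_wk_sub {Γ Γ' : List (S.VT h)} {Θ Δ : Option (S.CT h)} {B : S.VT h}
    (f : Fill S h Γ Θ Δ) (σ : Subst S h Γ Γ') :
    (f.ren (Ren.wk (B := B))).sub (Subst.lift σ) = (f.sub σ).ren Ren.wk := by
  cases f with
  | nil => rfl
  | put M => exact congrArg Fill.put ((M.ren_sub _ _).trans (M.sub_ren _ _).symm)

theorem Cmp.fill_sub : ∀ {Γ Γ' : List (S.VT h)} {Θ Δ : Option (S.CT h)} {C : S.CT h}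
    (K : Cmp S h Γ Θ C) (f : Fill S h Γ Θ Δ) (σ : Subst S h Γ Γ'),
    (K.fill f).sub σ = (K.sub σ).fill (f.sub σ)
  | _, _, _, _, _, .hole, .put M, σ => rfl
  | _, _, _, _, _, .force V, .nil, σ => rfl
  | _, _, _, _, _, .ret V, .nil, σ => rfl
  | _, _, _, _, _, .to M N, f, σ => by simp only [Cmp.fill, Cmp.sub, Cmp.fill_sub M]
  | _, _, _, _, _, .top, f, σ => by simp only [Cmp.fill, Cmp.sub]
  | _, _, _, _, _, .pair M N, f, σ => by
      simp only [Cmp.fill, Cmp.sub, Cmp.fill_sub M, Cmp.fill_sub N]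
  | _, _, _, _, _, .fst M, f, σ => by simp only [Cmp.fill, Cmp.sub, Cmp.fill_sub M]
  | _, _, _, _, _, .snd M, f, σ => by simp only [Cmp.fill, Cmp.sub, Cmp.fill_sub M]
  | _, _, _, _, _, .lam hh M, f, σ => by
      simp only [Cmp.fill, Cmp.sub, Cmp.fill_sub M, Fill.ren_wk_sub]
  | _, _, _, _, _, .app hh M V, f, σ => by simp only [Cmp.fill, Cmp.sub, Cmp.fill_sub M]
  | _, _, _, _, _, .cop o hA hB V, .nil, σ => rfl
  | _, _, _, _, _, .kop o hA hB hC V M, f, σ => by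
      simp only [Cmp.fill, Cmp.sub, Cmp.fill_sub M]

/-- Composition of fillings. -/
def Fill.comp {Γ : List (S.VT h)} {Θ Δ Ξ : Option (S.CT h)} :
    Fill S h Γ Θ Δ → Fill S h Γ Δ Ξ → Fill S h Γ Θ Ξ
  | .nil, g => g
  | .put M, g => .put (M.fill g)

theorem Fill.comp_ren {Γ Γ' : List (S.VT h)} {Θ Δ Ξ : Option (S.CT h)} (f : Fill S h Γ Θ Δ)
    (g : Fill S h Γ Δ Ξ) (ρ : Ren Γ Γ') : (f.comp g).ren ρ = (f.ren ρ).comp (g.ren ρ) := by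
  cases f with
  | nil => rfl
  | put M =>
    refine congrArg Fill.put ?_
    rw [Cmp.ren_eq_sub, Cmp.ren_eq_sub, Fill.ren_eq_sub, Cmp.fill_sub]

theorem Cmp.fill_fill : ∀ {Γ : List (S.VT h)} {Θ Δ Ξ : Option (S.CT h)} {C : S.CT h}
    (K : Cmp S h Γ Θ C) (f : Fill S h Γ Θ Δ) (g : Fill S h Γ Δ Ξ),
    (K.fill f).fill g = K.fill (f.comp g)
  | _, _, _, _, _, .hole, .put M, g => rfl
  | _, _, _, _, _, .force V, .nil, .nil => rfl
  | _, _, _, _, _, .ret V, .nil, .nil => rfl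
  | _, _, _, _, _, .to M N, f, g => by simp only [Cmp.fill, Cmp.fill_fill M]
  | _, _, _, _, _, .top, f, g => by simp only [Cmp.fill]
  | _, _, _, _, _, .pair M N, f, g => by simp only [Cmp.fill, Cmp.fill_fill M, Cmp.fill_fill N]
  | _, _, _, _, _, .fst M, f, g => by simp only [Cmp.fill, Cmp.fill_fill M]
  | _, _, _, _, _, .snd M, f, g => by simp only [Cmp.fill, Cmp.fill_fill M]
  | _, _, _, _, _, .lam hh M, f, g => by simp only [Cmp.fill, Cmp.fill_fill M, Fill.comp_ren]
  | _, _, _, _, _, .app hh M V, f, g => by simp only [Cmp.fill, Cmp.fill_fill M]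
  | _, _, _, _, _, .cop o hA hB V, .nil, .nil => rfl
  | _, _, _, _, _, .kop o hA hB hC V M, f, g => by simp only [Cmp.fill, Cmp.fill_fill M]

/-- The filling that changes nothing. -/
def Fill.id {Γ : List (S.VT h)} : (Θ : Option (S.CT h)) → Fill S h Γ Θ Θ
  | none => .nil
  | some _ => .put .hole

theorem Fill.id_ren {Γ Γ' : List (S.VT h)} (Θ : Option (S.CT h)) (ρ : Ren Γ Γ') :
    (Fill.id (S := S) (h := h) Θ).ren ρ = Fill.id Θ := by
  cases Θ <;> rfl

theorem Cmp.fill_id : ∀ {Γ : List (S.VT h)} {Θ : Option (S.CT h)} {C : S.CT h}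
    (K : Cmp S h Γ Θ C), K.fill (Fill.id Θ) = K
  | _, _, _, .hole => rfl
  | _, _, _, .force V => rfl
  | _, _, _, .ret V => rfl
  | _, _, _, .to M N => by simp only [Cmp.fill, Cmp.fill_id M]
  | _, _, _, .top => by simp only [Cmp.fill]
  | _, _, _, .pair M N => by simp only [Cmp.fill, Cmp.fill_id M, Cmp.fill_id N]
  | _, _, _, .fst M => by simp only [Cmp.fill, Cmp.fill_id M]
  | _, _, _, .snd M => by simp only [Cmp.fill, Cmp.fill_id M]
  | _, _, _, .lam hh M => by simp only [Cmp.fill, Cmp.fill_id M, Fill.id_ren]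
  | _, _, _, .app hh M V => by simp only [Cmp.fill, Cmp.fill_id M]
  | _, _, _, .cop o hA hB V => rfl
  | _, _, _, .kop o hA hB hC V M => by simp only [Cmp.fill, Cmp.fill_id M]

theorem Subst.cons_lift {Γ Γ' : List (S.VT h)} {A : S.VT h} (V : Val S h Γ A)
    (σ : Subst S h Γ Γ') :
    (fun _ x => ((Subst.lift (B := A) σ) x).sub (Subst.cons (V.sub σ) Subst.id) :
        Subst S h (A :: Γ) Γ') =
      fun _ x => ((Subst.cons V Subst.id) x).sub σ := by
  funext B x
  cases x with
  | zero => rfl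
  | succ x => exact (Val.ren_sub _ _ _).trans (Val.sub_id _)

theorem Cmp.wk_sub {Γ Γ' : List (S.VT h)} {Δ : Option (S.CT h)} {C : S.CT h} {A : S.VT h}
    (M : Cmp S h Γ Δ C) (σ : Subst S h Γ Γ') :
    (M.ren (Ren.wk (B := A))).sub (Subst.lift σ) = (M.sub σ).ren Ren.wk :=
  (M.ren_sub _ _).trans (M.sub_ren _ _).symm

mutual
theorem VEq.sub : ∀ {Γ Γ' : List (S.VT h)} {A : S.VT h} {V W : Val S h Γ A}, VEq V W →
    ∀ σ : Subst S h Γ Γ', VEq (V.sub σ) (W.sub σ)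
  | _, _, _, _, _, .refl V, σ => .refl _
  | _, _, _, _, _, .symm e, σ => .symm (e.sub σ)
  | _, _, _, _, _, .trans e e', σ => .trans (e.sub σ) (e'.sub σ)
  | _, _, _, _, _, .pair e e', σ => .pair (e.sub σ) (e'.sub σ)
  | _, _, _, _, _, .fst e, σ => .fst (e.sub σ)
  | _, _, _, _, _, .snd e, σ => .snd (e.sub σ)
  | _, _, _, _, _, .thunk e, σ => .thunk (e.sub σ)
  | _, _, _, _, _, .op o hA hB e, σ => .op o hA hB (e.sub σ)
  | _, _, _, _, _, .unit_eta V, σ => .unit_eta _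
  | _, _, _, _, _, .fst_beta V W, σ => .fst_beta _ _
  | _, _, _, _, _, .snd_beta V W, σ => .snd_beta _ _
  | _, _, _, _, _, .pair_eta V, σ => .pair_eta _
  | _, _, _, _, _, .thunk_eta V, σ => .thunk_eta _

theorem CEq.sub : ∀ {Γ Γ' : List (S.VT h)} {Δ : Option (S.CT h)} {C : S.CT h}
    {M N : Cmp S h Γ Δ C}, CEq M N → ∀ σ : Subst S h Γ Γ', CEq (M.sub σ) (N.sub σ)
  | _, _, _, _, _, _, .refl V, σ => .refl _
  | _, _, _, _, _, _, .symm e, σ => .symm (e.sub σ)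
  | _, _, _, _, _, _, .trans e e', σ => .trans (e.sub σ) (e'.sub σ)
  | _, _, _, _, _, _, .force e, σ => .force (e.sub σ)
  | _, _, _, _, _, _, .ret e, σ => .ret (e.sub σ)
  | _, _, _, _, _, _, .to e e', σ => .to (e.sub σ) (e'.sub _)
  | _, _, _, _, _, _, .pair e e', σ => .pair (e.sub σ) (e'.sub σ)
  | _, _, _, _, _, _, .fst e, σ => .fst (e.sub σ)
  | _, _, _, _, _, _, .snd e, σ => .snd (e.sub σ)
  | _, _, _, _, _, _, .lam hh e, σ => .lam hh (e.sub _)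
  | _, _, _, _, _, _, .app hh e e', σ => .app hh (e.sub σ) (e'.sub σ)
  | _, _, _, _, _, _, .cop o hA hB e, σ => .cop o hA hB (e.sub σ)
  | _, _, _, _, _, _, .kop o hA hB hC e e', σ => .kop o hA hB hC (e.sub σ) (e'.sub σ)
  | _, _, _, _, _, _, .force_beta M, σ => .force_beta _
  | _, _, _, _, _, _, .to_beta V N, σ => by
      have e := CEq.to_beta (V.sub σ) (N.sub (Subst.lift σ))
      rw [Cmp.sub_sub, Subst.cons_lift, ← Cmp.sub_sub] at e
      exact e
  | _, _, _, _, _, _, .to_eta K M, σ => by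
      have e := CEq.to_eta (K.sub σ) (M.sub σ)
      simp only [Cmp.fill_sub, Cmp.sub, Fill.sub, Cmp.wk_sub]
      exact e
  | _, _, _, _, _, _, .top_eta M, σ => .top_eta _
  | _, _, _, _, _, _, .fst_beta M N, σ => .fst_beta _ _
  | _, _, _, _, _, _, .snd_beta M N, σ => .snd_beta _ _
  | _, _, _, _, _, _, .pair_eta M, σ => .pair_eta _
  | _, _, _, _, _, _, .app_beta hh M V, σ => by
      have e := CEq.app_beta hh (M.sub (Subst.lift σ)) (V.sub σ)
      rw [Cmp.sub_sub, Subst.cons_lift, ← Cmp.sub_sub] at e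
      exact e
  | _, _, _, _, _, _, .lam_eta hh M, σ => by
      have e := CEq.lam_eta hh (M.sub σ)
      simp only [Cmp.sub, Cmp.wk_sub]
      exact e
end

/-- Pointwise provable equality of substitutions. -/
def SEq {Γ Γ' : List (S.VT h)} (σ τ : Subst S h Γ Γ') : Prop :=
  ∀ ⦃A : S.VT h⦄ (x : Var Γ A), VEq (σ x) (τ x)

theorem SEq.lift {Γ Γ' : List (S.VT h)} {B : S.VT h} {σ τ : Subst S h Γ Γ'} (e : SEq σ τ) :
    SEq (Subst.lift (B := B) σ) (Subst.lift τ) := by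
  intro A x
  cases x with
  | zero => exact .refl _
  | succ x =>
    change VEq ((σ x).ren _) ((τ x).ren _)
    rw [Val.ren_eq_sub, Val.ren_eq_sub]
    exact (e x).sub _

mutual
theorem Val.sub_congr : ∀ {Γ Γ' : List (S.VT h)} {A : S.VT h} (V : Val S h Γ A)
    {σ τ : Subst S h Γ Γ'}, SEq σ τ → VEq (V.sub σ) (V.sub τ)
  | _, _, _, .var x, _, _, e => e x
  | _, _, _, .unit, _, _, e => .refl _
  | _, _, _, .pair V W, _, _, e => .pair (V.sub_congr e) (W.sub_congr e)
  | _, _, _, .fst V, _, _, e => .fst (V.sub_congr e)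
  | _, _, _, .snd V, _, _, e => .snd (V.sub_congr e)
  | _, _, _, .thunk M, _, _, e => .thunk (M.sub_congr e)
  | _, _, _, .op o hA hB V, _, _, e => .op o hA hB (V.sub_congr e)

theorem Cmp.sub_congr : ∀ {Γ Γ' : List (S.VT h)} {Δ : Option (S.CT h)} {C : S.CT h}
    (M : Cmp S h Γ Δ C) {σ τ : Subst S h Γ Γ'}, SEq σ τ → CEq (M.sub σ) (M.sub τ)
  | _, _, _, _, .hole, _, _, e => .refl _
  | _, _, _, _, .force V, _, _, e => .force (V.sub_congr e)
  | _, _, _, _, .ret V, _, _, e => .ret (V.sub_congr e)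
  | _, _, _, _, .to M N, _, _, e => .to (M.sub_congr e) (N.sub_congr e.lift)
  | _, _, _, _, .top, _, _, e => .refl _
  | _, _, _, _, .pair M N, _, _, e => .pair (M.sub_congr e) (N.sub_congr e)
  | _, _, _, _, .fst M, _, _, e => .fst (M.sub_congr e)
  | _, _, _, _, .snd M, _, _, e => .snd (M.sub_congr e)
  | _, _, _, _, .lam hh M, _, _, e => .lam hh (M.sub_congr e.lift)
  | _, _, _, _, .app hh M V, _, _, e => .app hh (M.sub_congr e) (V.sub_congr e)
  | _, _, _, _, .cop o hA hB V, _, _, e => .cop o hA hB (V.sub_congr e)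
  | _, _, _, _, .kop o hA hB hC V M, _, _, e => .kop o hA hB hC (V.sub_congr e) (M.sub_congr e)
end

theorem Fill.ren_wk_cons {Γ : List (S.VT h)} {Θ Δ : Option (S.CT h)} {A : S.VT h}
    (f : Fill S h Γ Θ Δ) (V : Val S h Γ A) : (f.ren Ren.wk).sub (Subst.cons V Subst.id) = f := by
  cases f with
  | nil => rfl
  | put M => exact congrArg Fill.put ((M.ren_sub _ _).trans (Cmp.sub_id _))

theorem CEq.fill : ∀ {Γ : List (S.VT h)} {Θ Δ : Option (S.CT h)} {C : S.CT h}
    {M N : Cmp S h Γ Θ C}, CEq M N → ∀ f : Fill S h Γ Θ Δ, CEq (M.fill f) (N.fill f)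
  | _, _, _, _, _, _, .refl V, f => .refl _
  | _, _, _, _, _, _, .symm e, f => .symm (e.fill f)
  | _, _, _, _, _, _, .trans e e', f => .trans (e.fill f) (e'.fill f)
  | _, _, _, _, _, _, .force e, .nil => .force e
  | _, _, _, _, _, _, .ret e, .nil => .ret e
  | _, _, _, _, _, _, .to e e', f => by simp only [Cmp.fill]; exact .to (e.fill f) e'
  | _, _, _, _, _, _, .pair e e', f => by simp only [Cmp.fill]; exact .pair (e.fill f) (e'.fill f)
  | _, _, _, _, _, _, .fst e, f => by simp only [Cmp.fill]; exact .fst (e.fill f)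
  | _, _, _, _, _, _, .snd e, f => by simp only [Cmp.fill]; exact .snd (e.fill f)
  | _, _, _, _, _, _, .lam hh e, f => by simp only [Cmp.fill]; exact .lam hh (e.fill _)
  | _, _, _, _, _, _, .app hh e e', f => by simp only [Cmp.fill]; exact .app hh (e.fill f) e'
  | _, _, _, _, _, _, .cop o hA hB e, .nil => .cop o hA hB e
  | _, _, _, _, _, _, .kop o hA hB hC e e', f => by
      simp only [Cmp.fill]; exact .kop o hA hB hC e (e'.fill f)
  | _, _, _, _, _, _, .force_beta M, .nil => by
      have e := Cmp.fill_id M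
      simp only [Fill.id] at e
      rw [e]; exact .force_beta M
  | _, _, _, _, _, _, .to_beta V N, .nil => by
      have e := Cmp.fill_id (N.sub (Subst.cons V Subst.id))
      simp only [Fill.id] at e
      rw [e]; exact .to_beta V N
  | _, _, _, _, _, _, .to_eta K M, f => by
      simp only [Cmp.fill, Cmp.fill_fill, Fill.comp]
      exact .to_eta K (M.fill f)
  | _, _, _, _, _, _, .top_eta M, f => by simp only [Cmp.fill]; exact .top_eta _
  | _, _, _, _, _, _, .fst_beta M N, f => by simp only [Cmp.fill]; exact .fst_beta _ _
  | _, _, _, _, _, _, .snd_beta M N, f => by simp only [Cmp.fill]; exact .snd_beta _ _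
  | _, _, _, _, _, _, .pair_eta M, f => by simp only [Cmp.fill]; exact .pair_eta _
  | _, _, _, _, _, _, .app_beta hh M V, f => by
      have e := CEq.app_beta hh (M.fill (f.ren Ren.wk)) V
      rw [Cmp.fill_sub, Fill.ren_wk_cons] at e
      simp only [Cmp.fill]; exact e
  | _, _, _, _, _, _, .lam_eta hh M, f => by
      have e := CEq.lam_eta hh (M.fill f)
      rw [Cmp.ren_eq_sub, Cmp.fill_sub, ← Cmp.ren_eq_sub, ← Fill.ren_eq_sub] at e
      simp only [Cmp.fill]; exact e

theorem CEq.ren {Γ Γ' : List (S.VT h)} {Δ : Option (S.CT h)} {C : S.CT h}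
    {M N : Cmp S h Γ Δ C} (e : CEq M N) (ρ : Ren Γ Γ') : CEq (M.ren ρ) (N.ren ρ) := by
  rw [Cmp.ren_eq_sub, Cmp.ren_eq_sub]; exact e.sub _

/-- Provable equality of fillings. -/
inductive FEq {Γ : List (S.VT h)} : {Θ Δ : Option (S.CT h)} →
    Fill S h Γ Θ Δ → Fill S h Γ Θ Δ → Prop
  | nil : FEq .nil .nil
  | put {Δ : Option (S.CT h)} {B : S.CT h} {M N : Cmp S h Γ Δ B} :
      CEq M N → FEq (.put M) (.put N)

theorem FEq.ren {Γ Γ' : List (S.VT h)} {Θ Δ : Option (S.CT h)} {f g : Fill S h Γ Θ Δ}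
    (e : FEq f g) (ρ : Ren Γ Γ') : FEq (f.ren ρ) (g.ren ρ) := by
  cases e with
  | nil => exact .nil
  | put e => exact .put (e.ren ρ)

theorem Cmp.fill_congr : ∀ {Γ : List (S.VT h)} {Θ Δ : Option (S.CT h)} {C : S.CT h}
    (K : Cmp S h Γ Θ C) {f g : Fill S h Γ Θ Δ}, FEq f g → CEq (K.fill f) (K.fill g)
  | _, _, _, _, .hole, _, _, .put e => e
  | _, _, _, _, .force V, _, _, .nil => .refl _
  | _, _, _, _, .ret V, _, _, .nil => .refl _
  | _, _, _, _, .to M N, _, _, e => by simp only [Cmp.fill]; exact .to (M.fill_congr e) (.refl _)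
  | _, _, _, _, .top, _, _, e => .top_eta _
  | _, _, _, _, .pair M N, _, _, e => by
      simp only [Cmp.fill]; exact .pair (M.fill_congr e) (N.fill_congr e)
  | _, _, _, _, .fst M, _, _, e => by simp only [Cmp.fill]; exact .fst (M.fill_congr e)
  | _, _, _, _, .snd M, _, _, e => by simp only [Cmp.fill]; exact .snd (M.fill_congr e)
  | _, _, _, _, .lam hh M, _, _, e => by
      simp only [Cmp.fill]; exact .lam hh (M.fill_congr (e.ren _))
  | _, _, _, _, .app hh M V, _, _, e => by
      simp only [Cmp.fill]; exact .app hh (M.fill_congr e) (.refl _)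
  | _, _, _, _, .cop o hA hB V, _, _, .nil => .refl _
  | _, _, _, _, .kop o hA hB hC V M, _, _, e => by
      simp only [Cmp.fill]; exact .kop o hA hB hC (.refl _) (M.fill_congr e)

theorem CEq.plug {Γ : List (S.VT h)} {Δ : Option (S.CT h)} {B C : S.CT h}
    {K K' : Cmp S h Γ (some B) C} {M M' : Cmp S h Γ Δ B} (e : CEq K K') (e' : CEq M M') :
    CEq (K.plug M) (K'.plug M') :=
  (e.fill _).trans (K'.fill_congr (.put e'))

end SubstitutionLemmas

/-! ### Locally indexed categories -/

section LocallyIndexed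

open CategoryTheory MonoidalCategory CartesianMonoidalCategory

universe v₁ v₂ v₃ u₁ u₂ u₃

/-- A locally `C`-indexed category: objects, for each `c` in `C` a category of maps over `c` on
these objects, and identity-on-objects reindexing functors. -/
structure LICat (C : Type u₁) [Category.{v₁} C] where
  Obj : Type u₂
  Hom : C → Obj → Obj → Type v₂
  id : ∀ (c : C) (A : Obj), Hom c A A
  comp : ∀ {c : C} {A B D : Obj}, Hom c A B → Hom c B D → Hom c A D
  reind : ∀ {c d : C} {A B : Obj}, (d ⟶ c) → Hom c A B → Hom d A B
  id_comp : ∀ {c : C} {A B : Obj} (f : Hom c A B), comp (id c A) f = f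
  comp_id : ∀ {c : C} {A B : Obj} (f : Hom c A B), comp f (id c B) = f
  assoc : ∀ {c : C} {A B D E : Obj} (f : Hom c A B) (g : Hom c B D) (k : Hom c D E),
    comp (comp f g) k = comp f (comp g k)
  reind_id : ∀ {c d : C} (ρ : d ⟶ c) (A : Obj), reind ρ (id c A) = id d A
  reind_comp : ∀ {c d : C} {A B D : Obj} (ρ : d ⟶ c) (f : Hom c A B) (g : Hom c B D),
    reind ρ (comp f g) = comp (reind ρ f) (reind ρ g)
  id_reind : ∀ {c : C} {A B : Obj} (f : Hom c A B), reind (𝟙 c) f = f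
  comp_reind : ∀ {c d e : C} {A B : Obj} (ρ' : e ⟶ d) (ρ : d ⟶ c) (f : Hom c A B),
    reind (ρ' ≫ ρ) f = reind ρ' (reind ρ f)

/-- The category of maps over `c`. -/
def LICat.Fibre {C : Type u₁} [Category.{v₁} C] (L : LICat.{v₁, v₂, u₁, u₂} C) (_ : C) : Type u₂ :=
  L.Obj

instance LICat.fibreCategory {C : Type u₁} [Category.{v₁} C] (L : LICat.{v₁, v₂, u₁, u₂} C) (c : C) :
    Category.{v₂} (L.Fibre c) where
  Hom A B := L.Hom c A B
  id A := L.id c A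
  comp f g := L.comp f g
  id_comp := L.id_comp
  comp_id := L.comp_id
  assoc := L.assoc

/-- Change of base along a functor. -/
def LICat.baseChange {C : Type u₁} [Category.{v₁} C] {D : Type u₂} [Category.{v₂} D] (f : C ⥤ D)
    (L : LICat.{v₂, v₃, u₂, u₃} D) : LICat.{v₁, v₃, u₁, u₃} C where
  Obj := L.Obj
  Hom c := L.Hom (f.obj c)
  id c := L.id (f.obj c)
  comp := L.comp
  reind ρ := L.reind (f.map ρ)
  id_comp := L.id_comp
  comp_id := L.comp_id
  assoc := L.assoc
  reind_id ρ := L.reind_id (f.map ρ)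
  reind_comp ρ := L.reind_comp (f.map ρ)
  id_reind k := by rw [f.map_id, L.id_reind]
  comp_reind ρ' ρ k := by rw [f.map_comp, L.comp_reind]

/-- The locally indexed category `self C` of a cartesian category `C`; a map from `a` to `b` over
`c` is a map `c × a ⟶ b`. -/
def LICat.self (C : Type u₁) [Category.{v₁} C] [CartesianMonoidalCategory C] :
    LICat.{v₁, v₁, u₁, u₁} C where
  Obj := C
  Hom c a b := c ⊗ a ⟶ b
  id c a := snd c a
  comp {c a _ _} f g := lift (fst c a) f ≫ g
  reind {_ _ a _} ρ f := ρ ▷ a ≫ f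
  id_comp f := by simp
  comp_id f := by simp
  assoc f g k := by simp [← Category.assoc, comp_lift]
  reind_id ρ a := by simp
  reind_comp ρ f g := by
    simp only [← Category.assoc]; congr 1; ext <;> simp
  id_reind f := by simp
  comp_reind ρ' ρ f := by simp

/-- Locally `C`-indexed functors. -/
structure LIFunctor {C : Type u₁} [Category.{v₁} C] (L : LICat.{v₁, v₂, u₁, u₂} C)
    (M : LICat.{v₁, v₃, u₁, u₃} C) where
  obj : L.Obj → M.Obj
  map : ∀ {c : C} {A B : L.Obj}, L.Hom c A B → M.Hom c (obj A) (obj B)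
  map_id : ∀ (c : C) (A : L.Obj), map (L.id c A) = M.id c (obj A)
  map_comp : ∀ {c : C} {A B D : L.Obj} (f : L.Hom c A B) (g : L.Hom c B D),
    map (L.comp f g) = M.comp (map f) (map g)
  map_reind : ∀ {c d : C} {A B : L.Obj} (ρ : d ⟶ c) (f : L.Hom c A B),
    map (L.reind ρ f) = M.reind ρ (map f)

/-- The functor between the categories of maps over `c`. -/
def LIFunctor.fibre {C : Type u₁} [Category.{v₁} C] {L : LICat.{v₁, v₂, u₁, u₂} C}
    {M : LICat.{v₁, v₃, u₁, u₃} C} (F : LIFunctor L M) (c : C) : L.Fibre c ⥤ M.Fibre c where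
  obj := F.obj
  map f := F.map f
  map_id := F.map_id c
  map_comp := F.map_comp

/-- The identity locally indexed functor. -/
def LIFunctor.id {C : Type u₁} [Category.{v₁} C] (L : LICat.{v₁, v₂, u₁, u₂} C) :
    LIFunctor L L where
  obj A := A
  map f := f
  map_id _ _ := rfl
  map_comp _ _ := rfl
  map_reind _ _ := rfl

/-- Composition of locally indexed functors. -/
def LIFunctor.comp {C : Type u₁} [Category.{v₁} C] {L : LICat.{v₁, v₂, u₁, u₂} C}
    {M N : LICat.{v₁, v₃, u₁, u₃} C} (F : LIFunctor L M) (G : LIFunctor M N) :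
    LIFunctor L N where
  obj A := G.obj (F.obj A)
  map f := G.map (F.map f)
  map_id _ _ := by rw [F.map_id, G.map_id]
  map_comp _ _ := by rw [F.map_comp, G.map_comp]
  map_reind _ _ := by rw [F.map_reind, G.map_reind]

/-- Locally indexed transformations, with components over the terminal object. -/
structure LITrans {C : Type u₁} [Category.{v₁} C] [CartesianMonoidalCategory C]
    {L : LICat.{v₁, v₂, u₁, u₂} C} {M : LICat.{v₁, v₃, u₁, u₃} C} (F G : LIFunctor L M) where
  app : ∀ A : L.Obj, M.Hom (𝟙_ C) (F.obj A) (G.obj A)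
  naturality : ∀ {c : C} {A B : L.Obj} (f : L.Hom c A B),
    M.comp (F.map f) (M.reind (toUnit c) (app B)) = M.comp (M.reind (toUnit c) (app A)) (G.map f)

/-- Chosen finite products in a locally indexed category. -/
structure LICat.Products {C : Type u₁} [Category.{v₁} C] [CartesianMonoidalCategory C]
    (L : LICat.{v₁, v₂, u₁, u₂} C) where
  top : L.Obj
  toTop : ∀ (c : C) (A : L.Obj), L.Hom c A top
  toTop_uniq : ∀ {c : C} {A : L.Obj} (f : L.Hom c A top), f = toTop c A
  prod : L.Obj → L.Obj → L.Obj
  fst : ∀ A B : L.Obj, L.Hom (𝟙_ C) (prod A B) A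
  snd : ∀ A B : L.Obj, L.Hom (𝟙_ C) (prod A B) B
  pair : ∀ {c : C} {X A B : L.Obj}, L.Hom c X A → L.Hom c X B → L.Hom c X (prod A B)
  pair_fst : ∀ {c : C} {X A B : L.Obj} (f : L.Hom c X A) (g : L.Hom c X B),
    L.comp (pair f g) (L.reind (toUnit c) (fst A B)) = f
  pair_snd : ∀ {c : C} {X A B : L.Obj} (f : L.Hom c X A) (g : L.Hom c X B),
    L.comp (pair f g) (L.reind (toUnit c) (snd A B)) = g
  pair_eta : ∀ {c : C} {X A B : L.Obj} (k : L.Hom c X (prod A B)),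
    pair (L.comp k (L.reind (toUnit c) (fst A B))) (L.comp k (L.reind (toUnit c) (snd A B))) = k

/-- Chosen powers in a locally indexed category. -/
structure LICat.Powers {C : Type u₁} [Category.{v₁} C] [CartesianMonoidalCategory C]
    (L : LICat.{v₁, v₂, u₁, u₂} C) where
  pow : C → L.Obj → L.Obj
  eval : ∀ (c : C) (B : L.Obj), L.Hom c (pow c B) B
  curry : ∀ {b c : C} {A B : L.Obj}, L.Hom (b ⊗ c) A B → L.Hom b A (pow c B)
  curry_eval : ∀ {b c : C} {A B : L.Obj} (f : L.Hom (b ⊗ c) A B),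
    L.comp (L.reind (CartesianMonoidalCategory.fst b c) (curry f))
      (L.reind (CartesianMonoidalCategory.snd b c) (eval c B)) = f
  curry_eta : ∀ {b c : C} {A B : L.Obj} (g : L.Hom b A (pow c B)),
    curry (L.comp (L.reind (CartesianMonoidalCategory.fst b c) g)
      (L.reind (CartesianMonoidalCategory.snd b c) (eval c B))) = g

/-- A first-order CBPV⁻ model: a cartesian category of values, a locally indexed category of
stacks with finite products, and a locally indexed adjunction between them. -/
structure FOModel where
  Val : Type u₁
  [cat : Category.{v₁} Val]
  [cart : CartesianMonoidalCategory Val]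
  Stk : LICat.{v₁, v₁, u₁, u₁} Val
  F : LIFunctor (LICat.self Val) Stk
  U : LIFunctor Stk (LICat.self Val)
  unit : LITrans (LIFunctor.id (LICat.self Val)) (F.comp U)
  counit : LITrans (U.comp F) (LIFunctor.id Stk)
  left_triangle : ∀ a : Val,
    Stk.comp (F.map (unit.app a)) (counit.app (F.obj a)) = Stk.id (𝟙_ Val) (F.obj a)
  right_triangle : ∀ B : Stk.Obj,
    (LICat.self Val).comp (unit.app (U.obj B)) (U.map (counit.app B)) =
      (LICat.self Val).id (𝟙_ Val) (U.obj B)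
  products : Stk.Products

attribute [instance] FOModel.cat FOModel.cart

/-- A CBPV⁻ model: a first-order model with powers. -/
structure Model extends FOModel.{v₁, u₁} where
  powers : Stk.Powers

/-- A locally indexed functor over a functor of the bases. -/
structure LIMap {C : Type u₁} [Category.{v₁} C] {D : Type u₂} [Category.{v₁} D]
    (L : LICat.{v₁, v₂, u₁, u₂} C) (M : LICat.{v₁, v₃, u₂, u₃} D) where
  base : C ⥤ D
  functor : LIFunctor L (M.baseChange base)

/-- A locally indexed functor is fully faithful if the functor of the bases and the functor over
each object of the base are. -/
structure LIMap.FullyFaithful {C : Type u₁} [Category.{v₁} C] {D : Type u₂} [Category.{v₁} D]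
    {L : LICat.{v₁, v₂, u₁, u₂} C} {M : LICat.{v₁, v₃, u₂, u₃} D} (f : LIMap L M) : Prop where
  base_full : f.base.Full
  base_faithful : f.base.Faithful
  fibre_full : ∀ c : C, (f.functor.fibre c).Full
  fibre_faithful : ∀ c : C, (f.functor.fibre c).Faithful

/-- A strict map of first-order CBPV⁻ models: it preserves the chosen finite products of values and
of stacks and the adjunction on the nose. (Tuples are then preserved as well.) -/
structure FOModel.StrictMap (M N : FOModel.{v₁, u₁}) extends LIMap M.Stk N.Stk where
  obj_unit : base.obj (𝟙_ M.Val) = 𝟙_ N.Val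
  obj_tensor : ∀ a b : M.Val, base.obj (a ⊗ b) = base.obj a ⊗ base.obj b
  map_fst : ∀ a b : M.Val, base.map (fst a b) = eqToHom (obj_tensor a b) ≫ fst _ _
  map_snd : ∀ a b : M.Val, base.map (snd a b) = eqToHom (obj_tensor a b) ≫ snd _ _
  obj_top : functor.obj M.products.top = N.products.top
  obj_prod : ∀ A B : M.Stk.Obj,
    functor.obj (M.products.prod A B) = N.products.prod (functor.obj A) (functor.obj B)
  map_prod_fst : ∀ A B : M.Stk.Obj, HEq (functor.map (M.products.fst A B))
    (N.products.fst (functor.obj A) (functor.obj B))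
  map_prod_snd : ∀ A B : M.Stk.Obj, HEq (functor.map (M.products.snd A B))
    (N.products.snd (functor.obj A) (functor.obj B))
  obj_F : ∀ a : M.Val, functor.obj (M.F.obj a) = N.F.obj (base.obj a)
  map_F : ∀ {c a b : M.Val} (g : c ⊗ a ⟶ b), HEq (functor.map (M.F.map g))
    (N.F.map (c := base.obj c) (A := base.obj a) (B := base.obj b)
      (eqToHom (obj_tensor c a).symm ≫ base.map g))
  obj_U : ∀ B : M.Stk.Obj, base.obj (M.U.obj B) = N.U.obj (functor.obj B)
  map_U : ∀ {c : M.Val} {A B : M.Stk.Obj} (k : M.Stk.Hom c A B),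
    HEq (base.map (M.U.map k)) (N.U.map (functor.map k))
  map_unit : ∀ a : M.Val, HEq (base.map (M.unit.app a)) (N.unit.app (base.obj a))
  map_counit : ∀ B : M.Stk.Obj,
    HEq (functor.map (M.counit.app B)) (N.counit.app (functor.obj B))

end LocallyIndexed

/-! ### The syntactic models -/

section Syntactic

open CategoryTheory MonoidalCategory CartesianMonoidalCategory

instance valSetoid (S : Signature.{u}) (h : Bool) (Γ : List (S.VT h)) (A : S.VT h) :
    Setoid (Val S h Γ A) where
  r := VEq
  iseqv := ⟨VEq.refl, VEq.symm, VEq.trans⟩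

instance cmpSetoid (S : Signature.{u}) (h : Bool) (Γ : List (S.VT h)) (Δ : Option (S.CT h))
    (C : S.CT h) : Setoid (Cmp S h Γ Δ C) where
  r := CEq
  iseqv := ⟨CEq.refl, CEq.symm, CEq.trans⟩

/-- The objects of the syntactic category of values: the value types. -/
structure SynObj (S : Signature.{u}) (h : Bool) : Type u where
  ty : S.VT h

variable {S : Signature.{u}} {h : Bool}

/-- The substitution for a context with one variable. -/
abbrev Subst.single {Γ : List (S.VT h)} {A : S.VT h} (V : Val S h Γ A) : Subst S h [A] Γ :=
  Subst.cons V Subst.nil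

theorem Subst.ext_single {Γ : List (S.VT h)} {A : S.VT h} {σ τ : Subst S h [A] Γ}
    (e : σ Var.zero = τ Var.zero) : σ = τ := by
  funext B x
  cases x with
  | zero => exact e
  | succ x => cases x

theorem SEq.single {Γ : List (S.VT h)} {A : S.VT h} {σ τ : Subst S h [A] Γ}
    (e : VEq (σ Var.zero) (τ Var.zero)) : SEq σ τ := by
  intro B x
  cases x with
  | zero => exact e
  | succ x => cases x

theorem Val.sub_single_zero {A B : S.VT h} (V : Val S h [A] B) :
    V.sub (Subst.single (.var .zero)) = V := by
  rw [show Subst.single (.var .zero) = (Subst.id : Subst S h [A] [A]) from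
    Subst.ext_single rfl, Val.sub_id]

theorem Cmp.sub_single_zero {A : S.VT h} {Δ : Option (S.CT h)} {C : S.CT h}
    (M : Cmp S h [A] Δ C) : M.sub (Subst.single (.var .zero)) = M := by
  rw [show Subst.single (.var .zero) = (Subst.id : Subst S h [A] [A]) from
    Subst.ext_single rfl, Cmp.sub_id]

theorem Val.sub_single_sub {A B : S.VT h} {Γ Γ' : List (S.VT h)} (V : Val S h [A] B)
    (W : Val S h Γ A) (σ : Subst S h Γ Γ') :
    (V.sub (Subst.single W)).sub σ = V.sub (Subst.single (W.sub σ)) := by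
  rw [Val.sub_sub]; congr 1; exact Subst.ext_single rfl

theorem Cmp.sub_single_sub {A : S.VT h} {Δ : Option (S.CT h)} {C : S.CT h}
    {Γ Γ' : List (S.VT h)} (M : Cmp S h [A] Δ C) (W : Val S h Γ A) (σ : Subst S h Γ Γ') :
    (M.sub (Subst.single W)).sub σ = M.sub (Subst.single (W.sub σ)) := by
  rw [Cmp.sub_sub]; congr 1; exact Subst.ext_single rfl

theorem Val.sub_single_congr {A B : S.VT h} {Γ : List (S.VT h)} {V V' : Val S h [A] B}
    {W W' : Val S h Γ A} (e : VEq V V') (e' : VEq W W') :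
    VEq (V.sub (Subst.single W)) (V'.sub (Subst.single W')) :=
  (e.sub _).trans (V'.sub_congr (SEq.single e'))

theorem Cmp.sub_single_congr {A : S.VT h} {Δ : Option (S.CT h)} {C : S.CT h} {Γ : List (S.VT h)}
    {M M' : Cmp S h [A] Δ C} {W W' : Val S h Γ A} (e : CEq M M') (e' : VEq W W') :
    CEq (M.sub (Subst.single W)) (M'.sub (Subst.single W')) :=
  (e.sub _).trans (M'.sub_congr (SEq.single e'))

/-- Maps from `A` to `B` are values `x : A ⊢ V : B` up to provable equality; composition is
substitution. -/
instance SynObj.category : SmallCategory (SynObj S h) where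
  Hom A B := Quotient (valSetoid S h [A.ty] B.ty)
  id A := Quotient.mk _ (.var .zero)
  comp f g := Quotient.map₂ (fun V W => W.sub (Subst.single V))
    (fun _ _ e _ _ e' => Val.sub_single_congr e' e) f g
  id_comp f := by
    induction f using Quotient.ind
    exact congrArg _ (Val.sub_single_zero _)
  comp_id f := by
    induction f using Quotient.ind
    rfl
  assoc f g k := by
    induction f using Quotient.ind
    induction g using Quotient.ind
    induction k using Quotient.ind
    exact congrArg _ (Val.sub_single_sub _ _ _).symm

/-- The map given by a value in a context with one variable. -/
def Val.hom {A B : SynObj S h} (V : Val S h [A.ty] B.ty) : A ⟶ B := Quotient.mk _ V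

theorem Val.hom_comp {A B C : SynObj S h} (V : Val S h [A.ty] B.ty) (W : Val S h [B.ty] C.ty) :
    V.hom ≫ W.hom = Val.hom (W.sub (Subst.single V)) := rfl

theorem Val.hom_eq {A B : SynObj S h} {V W : Val S h [A.ty] B.ty} (e : VEq V W) :
    (V.hom : A ⟶ B) = W.hom := Quotient.sound e

theorem Val.hom_ind {A B : SynObj S h} {P : (A ⟶ B) → Prop}
    (e : ∀ V : Val S h [A.ty] B.ty, P V.hom) (f : A ⟶ B) : P f := Quotient.ind e f

open Limits in
/-- The unit type is terminal. -/
def SynObj.terminal (S : Signature.{u}) (h : Bool) :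
    LimitCone (Functor.empty.{0} (SynObj S h)) :=
  ⟨asEmptyCone ⟨VTy.unit⟩,
    IsTerminal.ofUniqueHom (fun _ => Val.hom .unit)
      (fun _ f => by
        induction f using Val.hom_ind
        exact Val.hom_eq (.unit_eta _))⟩

open Limits in
/-- Product types are binary products. -/
def SynObj.binary (A B : SynObj S h) : LimitCone (pair A B) :=
  ⟨BinaryFan.mk (P := ⟨VTy.prod A.ty B.ty⟩) (Val.hom (.fst (.var .zero)))
      (Val.hom (.snd (.var .zero))),
    BinaryFan.IsLimit.mk _
      (fun f g => Quotient.map₂ Val.pair (fun _ _ e _ _ e' => VEq.pair e e') f g)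
      (fun f g => by
        induction f using Val.hom_ind
        induction g using Val.hom_ind
        exact Val.hom_eq (.fst_beta _ _))
      (fun f g => by
        induction f using Val.hom_ind
        induction g using Val.hom_ind
        exact Val.hom_eq (.snd_beta _ _))
      (fun f g m e e' => by
        induction m using Val.hom_ind
        subst e
        subst e'
        exact Val.hom_eq (.pair_eta _))⟩

instance SynObj.cartesian : CartesianMonoidalCategory (SynObj S h) :=
  .ofChosenFiniteProducts (SynObj.terminal S h) SynObj.binary

theorem SynObj.toUnit_eq (A : SynObj S h) :
    toUnit A = Val.hom (B := 𝟙_ (SynObj S h)) .unit := toUnit_unique _ _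

theorem SynObj.fst_eq (A B : SynObj S h) :
    fst A B = Val.hom (A := A ⊗ B) (.fst (.var .zero)) := rfl

theorem SynObj.snd_eq (A B : SynObj S h) :
    snd A B = Val.hom (A := A ⊗ B) (.snd (.var .zero)) := rfl

theorem SynObj.lift_eq {A B C : SynObj S h} (V : Val S h [A.ty] B.ty) (W : Val S h [A.ty] C.ty) :
    lift (V.hom : A ⟶ B) (W.hom : A ⟶ C) = Val.hom (B := B ⊗ C) (Val.pair V W) := by
  apply CartesianMonoidalCategory.hom_ext
  · rw [lift_fst]; exact (Val.hom_eq (.fst_beta _ _)).symm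
  · rw [lift_snd]; exact (Val.hom_eq (.snd_beta _ _)).symm

theorem SynObj.whiskerRight_eq {A B : SynObj S h} (V : Val S h [A.ty] B.ty) (C : SynObj S h) :
    (V.hom : A ⟶ B) ▷ C = Val.hom (A := A ⊗ C) (B := B ⊗ C)
      (Val.pair (V.sub (Subst.single (.fst (.var .zero)))) (.snd (.var .zero))) := by
  apply CartesianMonoidalCategory.hom_ext
  · rw [whiskerRight_fst]; exact (Val.hom_eq (.fst_beta _ _)).symm
  · rw [whiskerRight_snd]; exact (Val.hom_eq (.snd_beta _ _)).symm

theorem Cmp.plug_plug {Γ : List (S.VT h)} {A B C : S.CT h} {Δ : Option (S.CT h)}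
    (K : Cmp S h Γ (some B) C) (K' : Cmp S h Γ (some A) B) (M : Cmp S h Γ Δ A) :
    (K.plug K').plug M = K.plug (K'.plug M) := Cmp.fill_fill _ _ _

/-- The locally indexed category of computation types; maps from `B` to `C` over `A` are stacks
`x : A | B ⊢ K : C` up to provable equality. -/
def SynStk (S : Signature.{u}) (h : Bool) : LICat.{u, u, u, u} (SynObj S h) where
  Obj := S.CT h
  Hom A B C := Quotient (cmpSetoid S h [A.ty] (some B) C)
  id A B := Quotient.mk _ .hole
  comp f g := Quotient.map₂ (fun K L => L.plug K) (fun _ _ e _ _ e' => CEq.plug e' e) f g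
  reind ρ f := Quotient.map₂ (fun V K => K.sub (Subst.single V))
    (fun _ _ e _ _ e' => Cmp.sub_single_congr e' e) ρ f
  id_comp f := by
    induction f using Quotient.ind
    exact congrArg _ (Cmp.fill_id _)
  comp_id f := by
    induction f using Quotient.ind
    rfl
  assoc f g k := by
    induction f using Quotient.ind
    induction g using Quotient.ind
    induction k using Quotient.ind
    exact congrArg _ (Cmp.plug_plug _ _ _).symm
  reind_id ρ A := by
    induction ρ using Quotient.ind
    rfl
  reind_comp ρ f g := by
    induction ρ using Quotient.ind
    induction f using Quotient.ind
    induction g using Quotient.ind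
    exact congrArg _ (Cmp.fill_sub _ _ _)
  id_reind f := by
    induction f using Quotient.ind
    exact congrArg _ (Cmp.sub_single_zero _)
  comp_reind ρ' ρ f := by
    induction ρ' using Quotient.ind
    induction ρ using Quotient.ind
    induction f using Quotient.ind
    exact congrArg _ (Cmp.sub_single_sub _ _ _).symm

/-- The map given by a stack in a context with one variable. -/
def Cmp.hom {A : SynObj S h} {B C : S.CT h} (K : Cmp S h [A.ty] (some B) C) :
    (SynStk S h).Hom A B C := Quotient.mk _ K

theorem Cmp.hom_eq {A : SynObj S h} {B C : S.CT h} {K L : Cmp S h [A.ty] (some B) C}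
    (e : CEq K L) : K.hom = L.hom := Quotient.sound e

theorem Cmp.hom_ind {A : SynObj S h} {B C : S.CT h} {P : (SynStk S h).Hom A B C → Prop}
    (e : ∀ K : Cmp S h [A.ty] (some B) C, P K.hom) (f : (SynStk S h).Hom A B C) : P f :=
  Quotient.ind e f

theorem Cmp.hom_comp {A : SynObj S h} {B C D : S.CT h} (K : Cmp S h [A.ty] (some B) C)
    (L : Cmp S h [A.ty] (some C) D) : (SynStk S h).comp K.hom L.hom = (L.plug K).hom := rfl

theorem Cmp.hom_reind {A A' : SynObj S h} {B C : S.CT h} (V : Val S h [A'.ty] A.ty)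
    (K : Cmp S h [A.ty] (some B) C) :
    (SynStk S h).reind V.hom K.hom = (K.sub (Subst.single V)).hom := rfl

/-- Stacks from `F A` are determined by their values on returners. -/
theorem CEq.ext_F {Γ : List (S.VT h)} {A : S.VT h} {B : S.CT h}
    {K L : Cmp S h Γ (some (.F A)) B}
    (e : CEq ((K.ren Ren.wk).plug (.ret (.var .zero)))
      ((L.ren Ren.wk).plug (.ret (.var .zero)))) : CEq K L := by
  have h1 := CEq.to_eta K .hole
  have h2 := CEq.to_eta L .hole
  have e1 : K.plug .hole = K := Cmp.fill_id K
  have e2 : L.plug .hole = L := Cmp.fill_id L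
  rw [e1] at h1
  rw [e2] at h2
  exact h1.trans ((CEq.to (.refl _) e).trans h2.symm)

end Syntactic

section SyntacticModels

open CategoryTheory MonoidalCategory CartesianMonoidalCategory

variable {S : Signature.{u}} {h : Bool}

theorem SynObj.self_comp {c a b d : SynObj S h} (V : Val S h [(c ⊗ a).ty] b.ty)
    (W : Val S h [(c ⊗ b).ty] d.ty) :
    (LICat.self (SynObj S h)).comp (c := c) (A := a) (B := b) (D := d) V.hom W.hom =
      Val.hom (A := c ⊗ a) (W.sub (Subst.single (.pair (.fst (.var .zero)) V))) := by
  change lift (fst c a) (V.hom : c ⊗ a ⟶ b) ≫ (W.hom : c ⊗ b ⟶ d) = _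
  rw [SynObj.fst_eq, SynObj.lift_eq]; rfl

theorem SynObj.self_reind {c d a b : SynObj S h} (R : Val S h [d.ty] c.ty)
    (V : Val S h [(c ⊗ a).ty] b.ty) :
    (LICat.self (SynObj S h)).reind (c := c) (d := d) (A := a) (B := b) R.hom V.hom =
      Val.hom (A := d ⊗ a) (V.sub (Subst.single
        (.pair (R.sub (Subst.single (.fst (.var .zero)))) (.snd (.var .zero))))) := by
  change (R.hom : d ⟶ c) ▷ a ≫ (V.hom : c ⊗ a ⟶ b) = _
  rw [SynObj.whiskerRight_eq]; rfl

/-- The functor `F` on maps. -/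
def Val.mapF {c a b : S.VT h} (V : Val S h [.prod c a] b) : Cmp S h [c] (some (.F a)) (.F b) :=
  .to .hole (.ret (V.sub (Subst.single (.pair (.var (.succ .zero)) (.var .zero)))))

/-- The functor `U` on maps. -/
def Cmp.mapU {c : S.VT h} {A B : S.CT h} (K : Cmp S h [c] (some A) B) :
    Val S h [.prod c (.U A)] (.U B) :=
  .thunk ((K.sub (Subst.single (.fst (.var .zero)))).plug (.force (.snd (.var .zero))))

theorem CEq.of_eq {Γ : List (S.VT h)} {Δ : Option (S.CT h)} {C : S.CT h} {M N : Cmp S h Γ Δ C}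
    (e : M = N) : CEq M N := e ▸ .refl _

theorem Val.mapF_congr {c a b : S.VT h} {V W : Val S h [.prod c a] b} (e : VEq V W) :
    CEq V.mapF W.mapF := .to (.refl _) (.ret (e.sub _))

theorem Cmp.mapU_congr {c : S.VT h} {A B : S.CT h} {K L : Cmp S h [c] (some A) B} (e : CEq K L) :
    VEq K.mapU L.mapU := .thunk ((e.sub _).plug (.refl _))

theorem Cmp.plug_sub {Γ Γ' : List (S.VT h)} {Δ : Option (S.CT h)} {B C : S.CT h}
    (K : Cmp S h Γ (some B) C) (M : Cmp S h Γ Δ B) (σ : Subst S h Γ Γ') :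
    (K.plug M).sub σ = (K.sub σ).plug (M.sub σ) := Cmp.fill_sub _ _ _

theorem Cmp.plug_ren {Γ Γ' : List (S.VT h)} {Δ : Option (S.CT h)} {B C : S.CT h}
    (K : Cmp S h Γ (some B) C) (M : Cmp S h Γ Δ B) (ρ : Ren Γ Γ') :
    (K.plug M).ren ρ = (K.ren ρ).plug (M.ren ρ) := by
  simp only [Cmp.ren_eq_sub, Cmp.plug_sub]

/-- Sequencing after `F V`. -/
theorem Val.mapF_to {Γ : List (S.VT h)} {c a b : S.VT h} (V : Val S h [.prod c a] b)
    (W : Val S h Γ c) (X : Val S h Γ a) :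
    CEq ((V.mapF.sub (Subst.single W)).plug (.ret X)) (.ret (V.sub (Subst.single (.pair W X)))) := by
  refine (CEq.to_beta _ _).trans (.of_eq ?_)
  simp only [Cmp.sub, Val.sub_single_sub]
  congr 3
  change Val.pair ((W.ren _).sub _) X = _
  rw [Val.ren_sub]
  exact congrArg (fun Y => Val.pair Y X) (Val.sub_id W)

theorem Cmp.ren_wk_eq {c a : S.VT h} {Δ : Option (S.CT h)} {C : S.CT h} (K : Cmp S h [c] Δ C) :
    K.ren (Ren.wk (B := a)) = K.sub (Subst.single (.var (.succ .zero))) := by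
  rw [Cmp.ren_eq_sub]; congr 1; exact Subst.ext_single rfl

theorem Val.sub_fst_snd {c a b : S.VT h} (V : Val S h [.prod c a] b) :
    VEq (V.sub (Subst.single (.pair (.fst (.var .zero)) (.snd (.var .zero))))) V := by
  have e := Val.sub_single_congr (Γ := [.prod c a]) (.refl V) (VEq.pair_eta (.var .zero)).symm
  rwa [Val.sub_single_zero] at e

theorem Cmp.sub_fst_snd {c a : S.VT h} {Δ : Option (S.CT h)} {C : S.CT h}
    (K : Cmp S h [.prod c a] Δ C) :
    CEq (K.sub (Subst.single (.pair (.fst (.var .zero)) (.snd (.var .zero))))) K := by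
  have e := Cmp.sub_single_congr (Γ := [.prod c a]) (.refl K) (VEq.pair_eta (.var .zero)).symm
  rwa [Cmp.sub_single_zero] at e

theorem Val.mapF_wk {c a b : S.VT h} (V : Val S h [.prod c a] b) :
    CEq ((V.mapF.ren Ren.wk).plug (.ret (.var .zero)))
      (.ret (V.sub (Subst.single (.pair (.var (.succ .zero)) (.var .zero))))) := by
  rw [Cmp.ren_wk_eq]; exact V.mapF_to _ _

theorem Val.mapF_comp {c a b d : S.VT h} (V : Val S h [.prod c a] b)
    (W : Val S h [.prod c b] d) :
    CEq (Val.mapF (W.sub (Subst.single (.pair (.fst (.var .zero)) V)))) (W.mapF.plug V.mapF) := by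
  refine CEq.ext_F ((Val.mapF_wk _).trans (CEq.trans (N := .ret (W.sub (Subst.single
    (.pair (.var (.succ .zero)) (V.sub (Subst.single
      (.pair (.var (.succ .zero)) (.var .zero)))))))) ?_ (.symm ?_)))
  · rw [Val.sub_single_sub]
    exact .ret (Val.sub_single_congr (.refl W) (.pair (.fst_beta _ _) (.refl _)))
  · rw [Cmp.plug_ren, Cmp.plug_plug]
    refine (CEq.plug (.refl _) V.mapF_wk).trans ?_
    rw [Cmp.ren_wk_eq]
    exact W.mapF_to _ _

theorem Val.mapF_reind {c d a b : S.VT h} (R : Val S h [d] c) (V : Val S h [.prod c a] b) :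
    CEq (Val.mapF (V.sub (Subst.single
        (.pair (R.sub (Subst.single (.fst (.var .zero)))) (.snd (.var .zero))))))
      (V.mapF.sub (Subst.single R)) := by
  refine CEq.ext_F ((Val.mapF_wk _).trans (.symm ?_))
  rw [Cmp.ren_wk_eq, Cmp.sub_single_sub]
  refine (V.mapF_to _ _).trans (.ret ?_)
  rw [Val.sub_single_sub]
  refine Val.sub_single_congr (.refl V) (.pair ?_ (VEq.snd_beta _ _).symm)
  rw [Val.sub_single_sub]
  exact Val.sub_single_congr (.refl R) (VEq.fst_beta _ _).symm

/-- The left adjoint `F` of the syntactic model. -/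
def SynF (S : Signature.{u}) (h : Bool) : LIFunctor (LICat.self (SynObj S h)) (SynStk S h) where
  obj a := CTy.F a.ty
  map f := Quotient.map Val.mapF (fun _ _ e => Val.mapF_congr e) f
  map_id c a := Cmp.hom_eq (CEq.ext_F ((Val.mapF_wk _).trans (.ret (.snd_beta _ _))))
  map_comp f g := by
    induction f using Val.hom_ind with | e V
    induction g using Val.hom_ind with | e W
    exact (congrArg _ (SynObj.self_comp V W)).trans (Cmp.hom_eq (Val.mapF_comp V W))
  map_reind ρ f := by
    induction ρ using Val.hom_ind with | e R
    induction f using Val.hom_ind with | e V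
    exact (congrArg _ (SynObj.self_reind R V)).trans (Cmp.hom_eq (Val.mapF_reind R V))

theorem Cmp.mapU_sub {Γ : List (S.VT h)} {c : S.VT h} {A B : S.CT h}
    (K : Cmp S h [c] (some A) B) (V : Val S h Γ c) (W : Val S h Γ (.U A)) :
    VEq (K.mapU.sub (Subst.single (.pair V W)))
      (.thunk ((K.sub (Subst.single V)).plug (.force W))) := by
  refine .thunk ?_
  rw [Cmp.plug_sub, Cmp.sub_single_sub]
  exact CEq.plug (Cmp.sub_single_congr (.refl _) (.fst_beta _ _)) (.force (.snd_beta _ _))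

theorem Cmp.mapU_comp {c : S.VT h} {A B D : S.CT h} (K : Cmp S h [c] (some A) B)
    (L : Cmp S h [c] (some B) D) :
    VEq (Cmp.mapU (L.plug K)) (L.mapU.sub (Subst.single (.pair (.fst (.var .zero)) K.mapU))) := by
  refine .trans ?_ (L.mapU_sub _ _).symm
  refine .thunk ?_
  rw [Cmp.plug_sub, Cmp.plug_plug]
  exact CEq.plug (.refl _) (CEq.force_beta _).symm

theorem Cmp.mapU_reind {c d : S.VT h} {A B : S.CT h} (R : Val S h [d] c)
    (K : Cmp S h [c] (some A) B) :
    VEq (Cmp.mapU (K.sub (Subst.single R))) (K.mapU.sub (Subst.single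
        (.pair (R.sub (Subst.single (.fst (.var .zero)))) (.snd (.var .zero))))) := by
  refine .trans ?_ (K.mapU_sub _ _).symm
  refine .thunk ?_
  rw [Cmp.sub_single_sub]
  exact .refl _

/-- The right adjoint `U` of the syntactic model. -/
def SynU (S : Signature.{u}) (h : Bool) : LIFunctor (SynStk S h) (LICat.self (SynObj S h)) where
  obj B := ⟨VTy.U B⟩
  map {c A B} f := Quotient.map (Cmp.mapU (c := c.ty) (A := A) (B := B))
    (fun _ _ e => Cmp.mapU_congr e) f
  map_id c A := Val.hom_eq (A := c ⊗ ⟨VTy.U A⟩) (VEq.thunk_eta _).symm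
  map_comp {c A B D} f g := by
    induction f using Cmp.hom_ind with | e K
    induction g using Cmp.hom_ind with | e L
    refine Eq.trans ?_ (SynObj.self_comp (a := ⟨VTy.U A⟩) (b := ⟨VTy.U B⟩) (d := ⟨VTy.U D⟩)
      K.mapU L.mapU).symm
    exact Val.hom_eq (A := c ⊗ ⟨VTy.U A⟩) (B := ⟨VTy.U D⟩) (Cmp.mapU_comp K L)
  map_reind {c d A B} ρ f := by
    induction ρ using Val.hom_ind with | e R
    induction f using Cmp.hom_ind with | e K
    refine Eq.trans ?_ (SynObj.self_reind (a := ⟨VTy.U A⟩) (b := ⟨VTy.U B⟩) R K.mapU).symm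
    exact Val.hom_eq (A := d ⊗ ⟨VTy.U A⟩) (B := ⟨VTy.U B⟩) (Cmp.mapU_reind R K)

/-- The unit of the adjunction, `thunk (return x)`. -/
def Val.eta (c a : S.VT h) : Val S h [.prod c a] (.U (.F a)) := .thunk (.ret (.snd (.var .zero)))

/-- The counit of the adjunction, the stack `[·] to x. force x`. -/
def Cmp.eps (c : S.VT h) (B : S.CT h) : Cmp S h [c] (some (.F (.U B))) B :=
  .to .hole (.force (.var .zero))

theorem SynObj.reind_eta (c a : SynObj S h) :
    (LICat.self (SynObj S h)).reind (c := 𝟙_ (SynObj S h)) (d := c) (A := a)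
        (B := ⟨.U (.F a.ty)⟩) (toUnit c) (Val.eta .unit a.ty).hom =
      Val.hom (A := c ⊗ a) (Val.eta c.ty a.ty) := by
  rw [SynObj.toUnit_eq]
  refine (SynObj.self_reind (a := a) (b := ⟨.U (.F a.ty)⟩) _ _).trans ?_
  exact Val.hom_eq (A := c ⊗ a) (B := ⟨.U (.F a.ty)⟩) (.thunk (.ret (.snd_beta _ _)))

theorem Val.eta_natural {c a b : S.VT h} (V : Val S h [.prod c a] b) :
    VEq ((Val.eta c b).sub (Subst.single (.pair (.fst (.var .zero)) V)))
      (V.mapF.mapU.sub (Subst.single (.pair (.fst (.var .zero)) (Val.eta c a)))) := by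
  refine .trans (.thunk (.ret (.snd_beta _ _))) (.symm ((Cmp.mapU_sub _ _ _).trans (.thunk ?_)))
  refine (CEq.plug (.refl _) (.force_beta _)).trans ((V.mapF_to _ _).trans (.ret V.sub_fst_snd))

theorem Cmp.eps_ret {Γ : List (S.VT h)} {c : S.VT h} {B : S.CT h} (V : Val S h Γ c)
    (W : Val S h Γ (.U B)) :
    CEq (((Cmp.eps c B).sub (Subst.single V)).plug (.ret W)) (.force W) := .to_beta _ _

theorem Cmp.eps_natural {c : S.VT h} {A B : S.CT h} (K : Cmp S h [c] (some A) B) :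
    CEq ((Cmp.eps c B).plug K.mapU.mapF) (K.plug (Cmp.eps c A)) := by
  refine CEq.ext_F ?_
  rw [Cmp.plug_ren, Cmp.plug_plug, Cmp.plug_ren, Cmp.plug_plug]
  refine (CEq.plug (.refl _) (Val.mapF_wk _)).trans ?_
  rw [Cmp.ren_wk_eq, Cmp.ren_wk_eq, Cmp.ren_wk_eq]
  refine (Cmp.eps_ret _ _).trans ((CEq.force (Cmp.mapU_sub _ _ _)).trans ((CEq.force_beta _).trans ?_))
  exact CEq.plug (.refl _) (Cmp.eps_ret _ _).symm

theorem Cmp.left_triangle (c a : S.VT h) :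
    CEq ((Cmp.eps c (.F a)).plug (Val.eta c a).mapF) .hole := by
  refine CEq.ext_F ?_
  rw [Cmp.plug_ren, Cmp.plug_plug]
  refine (CEq.plug (.refl _) (Val.mapF_wk _)).trans ?_
  rw [Cmp.ren_wk_eq]
  exact (Cmp.eps_ret _ _).trans ((CEq.force_beta _).trans (.ret (.snd_beta _ _)))

theorem Val.right_triangle (c : S.VT h) (B : S.CT h) :
    VEq ((Cmp.eps c B).mapU.sub (Subst.single (.pair (.fst (.var .zero)) (Val.eta c (.U B)))))
      (.snd (.var .zero)) := by
  refine (Cmp.mapU_sub _ _ _).trans (.trans (.thunk ?_) (VEq.thunk_eta _).symm)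
  exact (CEq.plug (.refl _) (.force_beta _)).trans (Cmp.eps_ret _ _)

/-- The finite products of computation types. -/
def SynProducts (S : Signature.{u}) (h : Bool) : (SynStk S h).Products where
  top := CTy.top
  toTop c A := Cmp.hom .top
  toTop_uniq f := by
    induction f using Cmp.hom_ind with | e K
    exact Cmp.hom_eq (.top_eta K)
  prod := CTy.prod
  fst A B := Cmp.hom (.fst .hole)
  snd A B := Cmp.hom (.snd .hole)
  pair f g := Quotient.map₂ Cmp.pair (fun _ _ e _ _ e' => CEq.pair e e') f g
  pair_fst f g := by
    induction f using Cmp.hom_ind with | e K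
    induction g using Cmp.hom_ind with | e L
    exact Cmp.hom_eq (.fst_beta K L)
  pair_snd f g := by
    induction f using Cmp.hom_ind with | e K
    induction g using Cmp.hom_ind with | e L
    exact Cmp.hom_eq (.snd_beta K L)
  pair_eta k := by
    induction k using Cmp.hom_ind with | e K
    exact Cmp.hom_eq (CEq.pair_eta K).symm

/-- The first-order CBPV⁻ model given by the syntax. -/
def SynModel (S : Signature.{u}) (h : Bool) : FOModel.{u, u} where
  Val := SynObj S h
  Stk := SynStk S h
  F := SynF S h
  U := SynU S h
  unit :=
    { app := fun a => Val.hom (A := 𝟙_ (SynObj S h) ⊗ a) (B := ⟨.U (.F a.ty)⟩) (Val.eta .unit a.ty)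
      naturality := fun {c a b} f => by
        induction f using Val.hom_ind with | e V
        refine (congrArg _ (SynObj.reind_eta c b)).trans ?_
        refine Eq.trans ?_ (congrArg (fun x => (LICat.self (SynObj S h)).comp x _)
          (SynObj.reind_eta c a)).symm
        refine (SynObj.self_comp (a := a) (b := b) (d := ⟨.U (.F b.ty)⟩) V
          (Val.eta c.ty b.ty)).trans ?_
        refine Eq.trans ?_ (SynObj.self_comp (a := a) (b := ⟨.U (.F a.ty)⟩) (d := ⟨.U (.F b.ty)⟩)
          (Val.eta c.ty a.ty) V.mapF.mapU).symm
        exact Val.hom_eq (A := c ⊗ a) (B := ⟨.U (.F b.ty)⟩) (Val.eta_natural V) }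
  counit :=
    { app := fun B => Cmp.hom (A := 𝟙_ (SynObj S h)) (Cmp.eps .unit B)
      naturality := fun {c A B} f => by
        induction f using Cmp.hom_ind with | e K
        exact Cmp.hom_eq (A := c) (Cmp.eps_natural K) }
  left_triangle a := Cmp.hom_eq (A := 𝟙_ (SynObj S h)) (Cmp.left_triangle _ _)
  right_triangle B := by
    refine (SynObj.self_comp (c := 𝟙_ (SynObj S h)) (a := ⟨.U B⟩) (b := ⟨.U (.F (.U B))⟩)
      (d := ⟨.U B⟩) (Val.eta .unit (.U B)) (Cmp.eps .unit B).mapU).trans ?_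
    exact Val.hom_eq (A := 𝟙_ (SynObj S h) ⊗ ⟨.U B⟩) (B := ⟨.U B⟩) (Val.right_triangle _ _)
  products := SynProducts S h

/-- Currying of stacks. -/
def Cmp.curry {b c : S.VT true} {A B : S.CT true} (K : Cmp S true [.prod b c] (some A) B) :
    Cmp S true [b] (some A) (.arr rfl c B) :=
  .lam rfl (K.sub (Subst.single (.pair (.var (.succ .zero)) (.var .zero))))

/-- The evaluation stack, application of the hole to a variable. -/
def Cmp.eval (c : S.VT true) (B : S.CT true) : Cmp S true [c] (some (.arr rfl c B)) B :=
  .app rfl .hole (.var .zero)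

theorem Cmp.curry_eval {b c : S.VT true} {A B : S.CT true}
    (K : Cmp S true [.prod b c] (some A) B) :
    CEq (((Cmp.eval c B).sub (Subst.single (.snd (.var .zero)))).plug
      (K.curry.sub (Subst.single (.fst (.var .zero))))) K := by
  refine (CEq.app_beta rfl _ _).trans ?_
  rw [Cmp.sub_single_sub, Cmp.sub_single_sub]
  exact Cmp.sub_fst_snd K

theorem Cmp.curry_eta {b c : S.VT true} {A B : S.CT true}
    (K : Cmp S true [b] (some A) (.arr rfl c B)) :
    CEq (Cmp.curry (((Cmp.eval c B).sub (Subst.single (.snd (.var .zero)))).plug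
      (K.sub (Subst.single (.fst (.var .zero)))))) K := by
  refine .trans (.lam rfl (.app rfl ?_ (.snd_beta _ _))) (CEq.lam_eta rfl K).symm
  change CEq ((K.sub (Subst.single (.fst (.var .zero)))).sub _) _
  rw [Cmp.sub_single_sub, Cmp.ren_wk_eq]
  exact Cmp.sub_single_congr (.refl _) (.fst_beta _ _)

/-- Function types are powers. -/
def SynPowers (S : Signature.{u}) : (SynStk S true).Powers where
  pow c B := CTy.arr rfl c.ty B
  eval c B := Cmp.hom (Cmp.eval c.ty B)
  curry {b c A B} f := Quotient.map (Cmp.curry (b := b.ty) (c := c.ty) (A := A) (B := B))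
    (fun _ _ e => CEq.lam rfl (CEq.sub e _)) f
  curry_eval {b c A B} f := by
    induction f using Cmp.hom_ind with | e K
    exact Cmp.hom_eq (A := b ⊗ c) (Cmp.curry_eval K)
  curry_eta {b c A B} g := by
    induction g using Cmp.hom_ind with | e K
    exact Cmp.hom_eq (A := b) (Cmp.curry_eta K)

/-- The first-order syntactic CBPV⁻ model of a signature. -/
def FOSyn (S : Signature.{u}) : FOModel.{u, u} := SynModel S false

/-- The syntactic CBPV⁻ model of a signature. -/
def Syn (S : Signature.{u}) : Model.{u, u} where
  toFOModel := SynModel S true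
  powers := SynPowers S

end SyntacticModels

/-! ### The inclusion of the first-order syntax -/

section Inclusion

open CategoryTheory MonoidalCategory CartesianMonoidalCategory

variable {S : Signature.{u}} {h h' : Bool}

/-- Variables under a map of types. -/
def Var.map {T T' : Type u} (f : T → T') : {Γ : List T} → {A : T} → Var Γ A → Var (Γ.map f) (f A)
  | _, _, .zero => .zero
  | _, _, .succ x => .succ (x.map f)

theorem VTy.map_ofFO {VB CB : Type u} (e : h = true → h' = true) {A : VTy VB CB h}
    {B : VTy VB CB false} (hA : A = B.ofFO h) : A.map e = B.ofFO h' := by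
  subst hA; exact VTy.map_map _ _ _

theorem CTy.map_ofFO {VB CB : Type u} (e : h = true → h' = true) {A : CTy VB CB h}
    {B : CTy VB CB false} (hA : A = B.ofFO h) : A.map e = B.ofFO h' := by
  subst hA; exact CTy.map_map _ _ _

mutual
/-- Reading a value of a smaller language as a value of a larger one. -/
def Val.map (e : h = true → h' = true) : {Γ : List (S.VT h)} → {A : S.VT h} →
    Val S h Γ A → Val S h' (Γ.map (VTy.map e)) (A.map e)
  | _, _, .var x => .var (x.map _)
  | _, _, .unit => .unit
  | _, _, .pair V W => .pair (V.map e) (W.map e)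
  | _, _, .fst V => .fst (V.map e)
  | _, _, .snd V => .snd (V.map e)
  | _, _, .thunk M => .thunk (M.map e)
  | _, _, .op o hA hB V => .op o (VTy.map_ofFO e hA) (VTy.map_ofFO e hB) (V.map e)

/-- Reading a computation or stack of a smaller language as one of a larger one. -/
def Cmp.map (e : h = true → h' = true) : {Γ : List (S.VT h)} → {Δ : Option (S.CT h)} →
    {C : S.CT h} → Cmp S h Γ Δ C →
    Cmp S h' (Γ.map (VTy.map e)) (Δ.map (CTy.map e)) (C.map e)
  | _, _, _, .hole => .hole
  | _, _, _, .force V => .force (V.map e)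
  | _, _, _, .ret V => .ret (V.map e)
  | _, _, _, .to M N => .to (M.map e) (N.map e)
  | _, _, _, .top => .top
  | _, _, _, .pair M N => .pair (M.map e) (N.map e)
  | _, _, _, .fst M => .fst (M.map e)
  | _, _, _, .snd M => .snd (M.map e)
  | _, _, _, .lam hh M => .lam (e hh) (M.map e)
  | _, _, _, .app hh M V => .app (e hh) (M.map e) (V.map e)
  | _, _, _, .cop o hA hB V => .cop o (VTy.map_ofFO e hA) (CTy.map_ofFO e hB) (V.map e)
  | _, _, _, .kop o hA hB hC V M =>
      .kop o (VTy.map_ofFO e hA) (CTy.map_ofFO e hB) (CTy.map_ofFO e hC) (V.map e) (M.map e)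
end

/-- The filling of a smaller language as a filling of a larger one. -/
def Fill.map (e : h = true → h' = true) {Γ : List (S.VT h)} {Θ Δ : Option (S.CT h)} :
    Fill S h Γ Θ Δ → Fill S h' (Γ.map (VTy.map e)) (Θ.map (CTy.map e)) (Δ.map (CTy.map e))
  | .nil => .nil
  | .put M => .put (M.map e)

/-- The renaming `ρ'` is the image of `ρ`. -/
def Ren.Maps (e : h = true → h' = true) {Γ Γ' : List (S.VT h)} (ρ : Ren Γ Γ')
    (ρ' : Ren (Γ.map (VTy.map e)) (Γ'.map (VTy.map e))) : Prop :=
  ∀ ⦃A : S.VT h⦄ (x : Var Γ A), ρ' (x.map (VTy.map e)) = (ρ x).map (VTy.map e)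

theorem Ren.Maps.lift {e : h = true → h' = true} {Γ Γ' : List (S.VT h)} {B : S.VT h}
    {ρ : Ren Γ Γ'} {ρ' : Ren (Γ.map (VTy.map e)) (Γ'.map (VTy.map e))} (m : Ren.Maps e ρ ρ') :
    Ren.Maps e (ρ.lift (B := B)) ρ'.lift := by
  intro A x
  cases x with
  | zero => rfl
  | succ x => exact congrArg Var.succ (m x)

mutual
theorem Val.map_ren (e : h = true → h' = true) : ∀ {Γ Γ' : List (S.VT h)} {A : S.VT h}
    (V : Val S h Γ A) {ρ : Ren Γ Γ'} {ρ' : Ren (Γ.map (VTy.map e)) (Γ'.map (VTy.map e))},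
    Ren.Maps e ρ ρ' → (V.ren ρ).map e = (V.map e).ren ρ'
  | _, _, _, .var x, _, _, m => congrArg Val.var (m x).symm
  | _, _, _, .unit, _, _, _ => rfl
  | _, _, _, .pair V W, _, _, m => congrArg₂ Val.pair (V.map_ren e m) (W.map_ren e m)
  | _, _, _, .fst V, _, _, m => congrArg Val.fst (V.map_ren e m)
  | _, _, _, .snd V, _, _, m => congrArg Val.snd (V.map_ren e m)
  | _, _, _, .thunk M, _, _, m => congrArg Val.thunk (M.map_ren e m)
  | _, _, _, .op o _ _ V, _, _, m => congrArg (Val.op o _ _) (V.map_ren e m)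

theorem Cmp.map_ren (e : h = true → h' = true) : ∀ {Γ Γ' : List (S.VT h)}
    {Δ : Option (S.CT h)} {C : S.CT h} (M : Cmp S h Γ Δ C) {ρ : Ren Γ Γ'}
    {ρ' : Ren (Γ.map (VTy.map e)) (Γ'.map (VTy.map e))},
    Ren.Maps e ρ ρ' → (M.ren ρ).map e = (M.map e).ren ρ'
  | _, _, _, _, .hole, _, _, _ => rfl
  | _, _, _, _, .force V, _, _, m => congrArg Cmp.force (V.map_ren e m)
  | _, _, _, _, .ret V, _, _, m => congrArg Cmp.ret (V.map_ren e m)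
  | _, _, _, _, .to M N, _, _, m => congrArg₂ Cmp.to (M.map_ren e m) (N.map_ren e m.lift)
  | _, _, _, _, .top, _, _, _ => rfl
  | _, _, _, _, .pair M N, _, _, m => congrArg₂ Cmp.pair (M.map_ren e m) (N.map_ren e m)
  | _, _, _, _, .fst M, _, _, m => congrArg Cmp.fst (M.map_ren e m)
  | _, _, _, _, .snd M, _, _, m => congrArg Cmp.snd (M.map_ren e m)
  | _, _, _, _, .lam hh M, _, _, m => congrArg (Cmp.lam (e hh)) (M.map_ren e m.lift)
  | _, _, _, _, .app hh M V, _, _, m => congrArg₂ (Cmp.app (e hh)) (M.map_ren e m) (V.map_ren e m)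
  | _, _, _, _, .cop o _ _ V, _, _, m => congrArg (Cmp.cop o _ _) (V.map_ren e m)
  | _, _, _, _, .kop o _ _ _ V M, _, _, m =>
      congrArg₂ (Cmp.kop o _ _ _) (V.map_ren e m) (M.map_ren e m)
end

theorem Ren.Maps.wk (e : h = true → h' = true) {Γ : List (S.VT h)} {B : S.VT h} :
    Ren.Maps e (Ren.wk (Γ := Γ) (B := B)) Ren.wk := fun _ _ => rfl

/-- The substitution `σ'` is the image of `σ`. -/
def Subst.Maps (e : h = true → h' = true) {Γ Γ' : List (S.VT h)} (σ : Subst S h Γ Γ')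
    (σ' : Subst S h' (Γ.map (VTy.map e)) (Γ'.map (VTy.map e))) : Prop :=
  ∀ ⦃A : S.VT h⦄ (x : Var Γ A), σ' (x.map (VTy.map e)) = (σ x).map e

theorem Subst.Maps.lift {e : h = true → h' = true} {Γ Γ' : List (S.VT h)} {B : S.VT h}
    {σ : Subst S h Γ Γ'} {σ' : Subst S h' (Γ.map (VTy.map e)) (Γ'.map (VTy.map e))}
    (m : Subst.Maps e σ σ') : Subst.Maps e (Subst.lift (B := B) σ) (Subst.lift σ') := by
  intro A x
  cases x with
  | zero => rfl
  | succ x =>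
    exact (congrArg (fun V => Val.ren V Ren.wk) (m x)).trans ((σ x).map_ren e (Ren.Maps.wk e)).symm

mutual
theorem Val.map_sub (e : h = true → h' = true) : ∀ {Γ Γ' : List (S.VT h)} {A : S.VT h}
    (V : Val S h Γ A) {σ : Subst S h Γ Γ'}
    {σ' : Subst S h' (Γ.map (VTy.map e)) (Γ'.map (VTy.map e))},
    Subst.Maps e σ σ' → (V.sub σ).map e = (V.map e).sub σ'
  | _, _, _, .var x, _, _, m => (m x).symm
  | _, _, _, .unit, _, _, _ => rfl
  | _, _, _, .pair V W, _, _, m => congrArg₂ Val.pair (V.map_sub e m) (W.map_sub e m)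
  | _, _, _, .fst V, _, _, m => congrArg Val.fst (V.map_sub e m)
  | _, _, _, .snd V, _, _, m => congrArg Val.snd (V.map_sub e m)
  | _, _, _, .thunk M, _, _, m => congrArg Val.thunk (M.map_sub e m)
  | _, _, _, .op o _ _ V, _, _, m => congrArg (Val.op o _ _) (V.map_sub e m)

theorem Cmp.map_sub (e : h = true → h' = true) : ∀ {Γ Γ' : List (S.VT h)}
    {Δ : Option (S.CT h)} {C : S.CT h} (M : Cmp S h Γ Δ C) {σ : Subst S h Γ Γ'}
    {σ' : Subst S h' (Γ.map (VTy.map e)) (Γ'.map (VTy.map e))},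
    Subst.Maps e σ σ' → (M.sub σ).map e = (M.map e).sub σ'
  | _, _, _, _, .hole, _, _, _ => rfl
  | _, _, _, _, .force V, _, _, m => congrArg Cmp.force (V.map_sub e m)
  | _, _, _, _, .ret V, _, _, m => congrArg Cmp.ret (V.map_sub e m)
  | _, _, _, _, .to M N, _, _, m => congrArg₂ Cmp.to (M.map_sub e m) (N.map_sub e m.lift)
  | _, _, _, _, .top, _, _, _ => rfl
  | _, _, _, _, .pair M N, _, _, m => congrArg₂ Cmp.pair (M.map_sub e m) (N.map_sub e m)
  | _, _, _, _, .fst M, _, _, m => congrArg Cmp.fst (M.map_sub e m)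
  | _, _, _, _, .snd M, _, _, m => congrArg Cmp.snd (M.map_sub e m)
  | _, _, _, _, .lam hh M, _, _, m => congrArg (Cmp.lam (e hh)) (M.map_sub e m.lift)
  | _, _, _, _, .app hh M V, _, _, m => congrArg₂ (Cmp.app (e hh)) (M.map_sub e m) (V.map_sub e m)
  | _, _, _, _, .cop o _ _ V, _, _, m => congrArg (Cmp.cop o _ _) (V.map_sub e m)
  | _, _, _, _, .kop o _ _ _ V M, _, _, m =>
      congrArg₂ (Cmp.kop o _ _ _) (V.map_sub e m) (M.map_sub e m)
end

theorem Subst.Maps.cons_id (e : h = true → h' = true) {Γ : List (S.VT h)} {A : S.VT h}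
    (V : Val S h Γ A) :
    Subst.Maps e (Subst.cons V Subst.id) (Subst.cons (V.map e) Subst.id) := by
  intro B x
  cases x <;> rfl

theorem Subst.Maps.single (e : h = true → h' = true) {Γ : List (S.VT h)} {A : S.VT h}
    (V : Val S h Γ A) :
    Subst.Maps e (Subst.single V) (Subst.single (V.map e)) := by
  intro B x
  cases x with
  | zero => rfl
  | succ x => cases x

theorem Fill.map_ren_wk (e : h = true → h' = true) {Γ : List (S.VT h)} {B : S.VT h}
    {Θ Δ : Option (S.CT h)} (f : Fill S h Γ Θ Δ) :
    (f.ren (Ren.wk (B := B))).map e = (f.map e).ren Ren.wk := by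
  cases f with
  | nil => rfl
  | put M => exact congrArg Fill.put (M.map_ren e (Ren.Maps.wk e))

theorem Cmp.map_fill (e : h = true → h' = true) : ∀ {Γ : List (S.VT h)} {Θ Δ : Option (S.CT h)}
    {C : S.CT h} (K : Cmp S h Γ Θ C) (f : Fill S h Γ Θ Δ),
    (K.fill f).map e = (K.map e).fill (f.map e)
  | _, _, _, _, .hole, .put M => rfl
  | _, _, _, _, .force V, .nil => rfl
  | _, _, _, _, .ret V, .nil => rfl
  | _, _, _, _, .to M N, f => by
      simp only [Cmp.fill, Cmp.map]; exact congrArg₂ Cmp.to (M.map_fill e f) rfl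
  | _, _, _, _, .top, f => by simp only [Cmp.fill, Cmp.map]; rfl
  | _, _, _, _, .pair M N, f => by
      simp only [Cmp.fill, Cmp.map]; exact congrArg₂ Cmp.pair (M.map_fill e f) (N.map_fill e f)
  | _, _, _, _, .fst M, f => by
      simp only [Cmp.fill, Cmp.map]; exact congrArg Cmp.fst (M.map_fill e f)
  | _, _, _, _, .snd M, f => by
      simp only [Cmp.fill, Cmp.map]; exact congrArg Cmp.snd (M.map_fill e f)
  | _, _, _, _, .lam hh M, f => by
      simp only [Cmp.fill, Cmp.map]
      exact congrArg (Cmp.lam (e hh)) ((M.map_fill e _).trans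
        (congrArg (Cmp.fill (M.map e)) (f.map_ren_wk e)))
  | _, _, _, _, .app hh M V, f => by
      simp only [Cmp.fill, Cmp.map]; exact congrArg₂ (Cmp.app (e hh)) (M.map_fill e f) rfl
  | _, _, _, _, .cop o hA hB V, .nil => rfl
  | _, _, _, _, .kop o hA hB hC V M, f => by
      simp only [Cmp.fill, Cmp.map]
      exact congrArg (Cmp.kop o _ _ _ (V.map e)) (M.map_fill e f)

mutual
theorem VEq.map (e : h = true → h' = true) : ∀ {Γ : List (S.VT h)} {A : S.VT h}
    {V W : Val S h Γ A}, VEq V W → VEq (V.map e) (W.map e)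
  | _, _, _, _, .refl V => .refl _
  | _, _, _, _, .symm p => .symm (p.map e)
  | _, _, _, _, .trans p q => .trans (p.map e) (q.map e)
  | _, _, _, _, .pair p q => .pair (p.map e) (q.map e)
  | _, _, _, _, .fst p => .fst (p.map e)
  | _, _, _, _, .snd p => .snd (p.map e)
  | _, _, _, _, .thunk p => .thunk (p.map e)
  | _, _, _, _, .op o hA hB p => .op o _ _ (p.map e)
  | _, _, _, _, .unit_eta V => .unit_eta _
  | _, _, _, _, .fst_beta V W => .fst_beta _ _
  | _, _, _, _, .snd_beta V W => .snd_beta _ _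
  | _, _, _, _, .pair_eta V => .pair_eta _
  | _, _, _, _, .thunk_eta V => .thunk_eta _

theorem CEq.map (e : h = true → h' = true) : ∀ {Γ : List (S.VT h)} {Δ : Option (S.CT h)}
    {C : S.CT h} {M N : Cmp S h Γ Δ C}, CEq M N → CEq (M.map e) (N.map e)
  | _, _, _, _, _, .refl V => .refl _
  | _, _, _, _, _, .symm p => .symm (p.map e)
  | _, _, _, _, _, .trans p q => .trans (p.map e) (q.map e)
  | _, _, _, _, _, .force p => .force (p.map e)
  | _, _, _, _, _, .ret p => .ret (p.map e)
  | _, _, _, _, _, .to p q => .to (p.map e) (q.map e)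
  | _, _, _, _, _, .pair p q => .pair (p.map e) (q.map e)
  | _, _, _, _, _, .fst p => .fst (p.map e)
  | _, _, _, _, _, .snd p => .snd (p.map e)
  | _, _, _, _, _, .lam hh p => .lam _ (p.map e)
  | _, _, _, _, _, .app hh p q => .app _ (p.map e) (q.map e)
  | _, _, _, _, _, .cop o hA hB p => .cop o _ _ (p.map e)
  | _, _, _, _, _, .kop o hA hB hC p q => .kop o _ _ _ (p.map e) (q.map e)
  | _, _, _, _, _, .force_beta M => .force_beta _
  | _, _, _, _, _, .to_beta V N =>
      .trans (.to_beta _ _) (.of_eq (N.map_sub e (Subst.Maps.cons_id e V)).symm)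
  | _, _, _, _, _, .to_eta K M => by
      refine .trans (.of_eq (K.map_fill e _)) (.trans (.to_eta (K.map e) (M.map e)) ?_)
      refine .to (.refl _) (.of_eq ?_)
      refine .trans ?_ ((K.ren Ren.wk).map_fill e (.put (.ret (.var .zero)))).symm
      exact congrArg (fun L => Cmp.fill L _) (K.map_ren e (Ren.Maps.wk e)).symm
  | _, _, _, _, _, .top_eta M => .top_eta _
  | _, _, _, _, _, .fst_beta M N => .fst_beta _ _
  | _, _, _, _, _, .snd_beta M N => .snd_beta _ _
  | _, _, _, _, _, .pair_eta M => .pair_eta _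
  | _, _, _, _, _, .app_beta hh M V =>
      .trans (.app_beta _ _ _) (.of_eq (M.map_sub e (Subst.Maps.cons_id e V)).symm)
  | _, _, _, _, _, .lam_eta hh M =>
      .trans (.lam_eta (e hh) (M.map e)) (.lam _ (.app _
        (.of_eq (M.map_ren e (Ren.Maps.wk e)).symm) (.refl _)))
end

/-- The inclusion on values, as a functor. -/
def SynObj.incl (S : Signature.{u}) {h h' : Bool} (e : h = true → h' = true) :
    SynObj S h ⥤ SynObj S h' where
  obj A := ⟨A.ty.map e⟩
  map f := Quotient.map (Val.map e) (fun _ _ p => VEq.map e p) f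
  map_id A := rfl
  map_comp f g := by
    induction f using Val.hom_ind with | e V
    induction g using Val.hom_ind with | e W
    exact congrArg (Quotient.mk _) (W.map_sub e (Subst.Maps.single e V))

/-- The inclusion on values and stacks, as a locally indexed functor. -/
def SynStk.incl (S : Signature.{u}) {h h' : Bool} (e : h = true → h' = true) :
    LIMap (SynStk S h) (SynStk S h') where
  base := SynObj.incl S e
  functor :=
    { obj := CTy.map e
      map := fun f => Quotient.map (Cmp.map e) (fun _ _ p => CEq.map e p) f
      map_id := fun _ _ => rfl
      map_comp := fun f g => by
        induction f using Cmp.hom_ind with | e K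
        induction g using Cmp.hom_ind with | e L
        exact congrArg (Quotient.mk _) (L.map_fill e (.put K))
      map_reind := fun ρ f => by
        induction ρ using Val.hom_ind with | e R
        induction f using Cmp.hom_ind with | e K
        exact congrArg (Quotient.mk _) (K.map_sub e (Subst.Maps.single e R)) }

theorem Val.map_mapF (e : h = true → h' = true) {c a b : S.VT h} (V : Val S h [.prod c a] b) :
    V.mapF.map e = Val.mapF (V.map e) :=
  congrArg (fun W => Cmp.to Cmp.hole (Cmp.ret W)) (V.map_sub e (Subst.Maps.single e _))

theorem Cmp.map_mapU (e : h = true → h' = true) {c : S.VT h} {A B : S.CT h}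
    (K : Cmp S h [c] (some A) B) : K.mapU.map e = Cmp.mapU (K.map e) :=
  congrArg Val.thunk ((Cmp.map_fill e _ _).trans
    (congrArg (fun L => Cmp.fill L _) (K.map_sub e (Subst.Maps.single e _))))

/-- The inclusion of a smaller language in a larger one, as a strict map of models. -/
def SynModel.incl (S : Signature.{u}) {h h' : Bool} (e : h = true → h' = true) :
    (SynModel S h).StrictMap (SynModel S h') where
  toLIMap := SynStk.incl S e
  obj_unit := rfl
  obj_tensor _ _ := rfl
  map_fst _ _ := (Category.id_comp _).symm
  map_snd _ _ := (Category.id_comp _).symm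
  obj_top := rfl
  obj_prod _ _ := rfl
  map_prod_fst _ _ := HEq.rfl
  map_prod_snd _ _ := HEq.rfl
  obj_F _ := rfl
  map_F {c a b} g := by
    induction g using Val.hom_ind with | e V
    refine heq_of_eq (Eq.trans ?_ (congrArg (SynF S h').map (Category.id_comp _)).symm)
    exact congrArg (Quotient.mk _) (V.map_mapF e)
  obj_U _ := rfl
  map_U {c A B} k := by
    induction k using Cmp.hom_ind with | e K
    exact heq_of_eq (congrArg (Quotient.mk _) (K.map_mapU e))
  map_unit _ := HEq.rfl
  map_counit _ := HEq.rfl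

/-- The canonical strict map from the first-order syntactic model to the syntactic model: every
first-order term is a term. -/
def inclusion (S : Signature.{u}) : (FOSyn S).StrictMap (Syn S).toFOModel :=
  SynModel.incl S (fun _ => rfl)

end Inclusion

end CBPV

namespace CBPV

/-! ### Presheaves on first-order contexts -/

section Presheaves

variable {S : Signature.{u}}

-- Faithfulness and fullness are proved independently. Both work over first-order contexts: the
-- first with a presheaf model, the second with a logical predicate.
--
-- Faithfulness. The full language is interpreted in presheaves on first-order contexts and
-- substitutions (`Psh`), where exponentials exist whether or not the first-order syntax has
-- function types. A value type becomes a presheaf. A computation type becomes a `CPsh`: a presheaf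
-- of computations, a presheaf of stacks out of `D` for each first-order `D`, and an operation that
-- sequences returners into it. Base types are interpreted by their terms up to provable equality,
-- function types by exponentials taken componentwise, and `U` by the component of computations.
--
-- The delicate case is `F`. The argument presheaf `X` may involve exponentials and need not consist
-- of terms, so there are no syntactic returners of `X` to use. `Returner X Δ` is instead defined in
-- continuation-passing style: an element turns every continuation from `X` to computations of a
-- first-order type `E` into a computation or stack of type `E`, naturally in the context and in `E`
-- along stacks. When `X` is isomorphic to the values of a first-order type `A`, a Yoneda argument
-- identifies a continuation with a term in one more variable, hence with a stack from `F A` to `E`.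
-- A second Yoneda argument, along stacks, identifies a returner with a term of type `F A`
-- (`CRep.F`). By induction every first-order type is isomorphic to its own interpretation
-- (`VTy.rep`, `CTy.rep`).
--
-- All β- and η-laws hold in this model (`VEq.sem`, `CEq.sem`). The η-law of `F` is the one that
-- needs work: it rests on stacks commuting with sequencing (`Cmp.sem_bind`). Along the
-- isomorphisms, the interpretation of an embedded first-order term in the generic environment is
-- that term again (`Val.reify_sem`, `Cmp.reify_sem`). So if two first-order terms are equal in the
-- full language, they have equal interpretations and are provably equal in the first-order
-- language.
--
-- Fullness. A term of the full language is definable if it is provably equal to an embedded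
-- first-order term. A Kripke predicate `Red`, indexed by first-order contexts and their renamings,
-- is definability at base types, is given by projections, forcing and application at the negative
-- types, and is given at `F A` by testing against continuations whose results are definable. At
-- first-order types it coincides with definability (`VTy.red_iff`, `CTy.red_iff`). Every term
-- satisfies it under every substitution that does (`Val.red`, `Cmp.red`). Applied to the identity
-- substitution of a first-order context, this shows that every term of first-order type is
-- definable.

/-- Composition of substitutions. -/
def Subst.comp {h : Bool} {Γ Γ' Γ'' : List (S.VT h)} (σ : Subst S h Γ Γ') (τ : Subst S h Γ' Γ'') :
    Subst S h Γ Γ'' := fun _ x => (σ x).sub τ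

theorem Subst.comp_id {h : Bool} {Γ Γ' : List (S.VT h)} (σ : Subst S h Γ Γ') :
    Subst.comp σ Subst.id = σ := by
  funext A x; exact Val.sub_id _

theorem Subst.comp_assoc {h : Bool} {Γ Γ' Γ'' Γ₃ : List (S.VT h)} (σ : Subst S h Γ Γ')
    (τ : Subst S h Γ' Γ'') (υ : Subst S h Γ'' Γ₃) :
    Subst.comp (Subst.comp σ τ) υ = Subst.comp σ (Subst.comp τ υ) := by
  funext A x; exact Val.sub_sub _ _ _

/-- Sets indexed by first-order contexts, with an action of first-order substitutions. -/
structure Psh (S : Signature.{u}) : Type (u + 1) where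
  obj : List (S.VT false) → Type u
  act : ∀ {Γ Γ' : List (S.VT false)}, Subst S false Γ Γ' → obj Γ → obj Γ'
  act_id : ∀ {Γ : List (S.VT false)} (x : obj Γ), act Subst.id x = x
  act_act : ∀ {Γ Γ' Γ'' : List (S.VT false)} (σ : Subst S false Γ Γ') (τ : Subst S false Γ' Γ'')
    (x : obj Γ), act τ (act σ x) = act (Subst.comp σ τ) x

/-- First-order values up to provable equality. -/
@[reducible]
def Psh.val (A : S.VT false) : Psh S where
  obj Γ := Quotient (valSetoid S false Γ A)
  act σ := Quotient.map (fun V => V.sub σ) (fun _ _ e => VEq.sub e σ)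
  act_id x := by
    induction x using Quotient.ind
    exact congrArg _ (Val.sub_id _)
  act_act σ τ x := by
    induction x using Quotient.ind
    exact congrArg _ (Val.sub_sub _ _ _)

/-- First-order computations and stacks up to provable equality. -/
@[reducible]
def Psh.cmp (Δ : Option (S.CT false)) (C : S.CT false) : Psh S where
  obj Γ := Quotient (cmpSetoid S false Γ Δ C)
  act σ := Quotient.map (fun M => M.sub σ) (fun _ _ e => CEq.sub e σ)
  act_id x := by
    induction x using Quotient.ind
    exact congrArg _ (Cmp.sub_id _)
  act_act σ τ x := by
    induction x using Quotient.ind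
    exact congrArg _ (Cmp.sub_sub _ _ _)

/-- The class of a first-order value. -/
def Val.cls {Γ : List (S.VT false)} {A : S.VT false} (V : Val S false Γ A) : (Psh.val A).obj Γ :=
  Quotient.mk _ V

/-- The class of a first-order computation or stack. -/
def Cmp.cls {Γ : List (S.VT false)} {Δ : Option (S.CT false)} {C : S.CT false}
    (M : Cmp S false Γ Δ C) : (Psh.cmp Δ C).obj Γ := Quotient.mk _ M

theorem Val.cls_ind {Γ : List (S.VT false)} {A : S.VT false} {P : (Psh.val A).obj Γ → Prop}
    (e : ∀ V : Val S false Γ A, P V.cls) (x : (Psh.val A).obj Γ) : P x := Quotient.ind e x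

theorem Cmp.cls_ind {Γ : List (S.VT false)} {Δ : Option (S.CT false)} {C : S.CT false}
    {P : (Psh.cmp Δ C).obj Γ → Prop} (e : ∀ M : Cmp S false Γ Δ C, P M.cls)
    (x : (Psh.cmp Δ C).obj Γ) : P x := Quotient.ind e x

theorem Val.cls_eq {Γ : List (S.VT false)} {A : S.VT false} {V W : Val S false Γ A}
    (e : VEq V W) : V.cls = W.cls := Quotient.sound e

theorem Cmp.cls_eq {Γ : List (S.VT false)} {Δ : Option (S.CT false)} {C : S.CT false}
    {M N : Cmp S false Γ Δ C} (e : CEq M N) : M.cls = N.cls := Quotient.sound e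

/-- A stack applied to a computation or stack, on equivalence classes. -/
def Psh.plug {Γ : List (S.VT false)} {Δ : Option (S.CT false)} {B C : S.CT false}
    (K : (Psh.cmp (some B) C).obj Γ) (M : (Psh.cmp Δ B).obj Γ) : (Psh.cmp Δ C).obj Γ :=
  Quotient.map₂ (fun K M => K.plug M) (fun _ _ e _ _ e' => CEq.plug e e') K M

theorem Psh.act_plug {Γ Γ' : List (S.VT false)} {Δ : Option (S.CT false)} {B C : S.CT false}
    (σ : Subst S false Γ Γ') (K : (Psh.cmp (some B) C).obj Γ) (M : (Psh.cmp Δ B).obj Γ) :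
    (Psh.cmp Δ C).act σ (Psh.plug K M) =
      Psh.plug ((Psh.cmp (some B) C).act σ K) ((Psh.cmp Δ B).act σ M) := by
  induction K using Cmp.cls_ind
  induction M using Cmp.cls_ind
  exact congrArg Cmp.cls (Cmp.plug_sub _ _ _)

/-- Terminal presheaf. -/
@[reducible]
def Psh.unit : Psh S where
  obj _ := PUnit
  act _ x := x
  act_id _ := rfl
  act_act _ _ _ := rfl

/-- Initial presheaf. -/
@[reducible]
def Psh.empty : Psh S where
  obj _ := PEmpty
  act _ x := x
  act_id _ := rfl
  act_act _ _ _ := rfl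

/-- Product presheaf. -/
@[reducible]
def Psh.prod (X Y : Psh S) : Psh S where
  obj Γ := X.obj Γ × Y.obj Γ
  act σ x := (X.act σ x.1, Y.act σ x.2)
  act_id x := Prod.ext (X.act_id _) (Y.act_id _)
  act_act σ τ x := Prod.ext (X.act_act _ _ _) (Y.act_act _ _ _)

/-- The elements over `Γ` of the exponential of presheaves. -/
@[ext]
structure Exp (X Y : Psh S) (Γ : List (S.VT false)) : Type u where
  app : ∀ {Γ' : List (S.VT false)}, Subst S false Γ Γ' → X.obj Γ' → Y.obj Γ'
  nat : ∀ {Γ' Γ'' : List (S.VT false)} (σ : Subst S false Γ Γ') (τ : Subst S false Γ' Γ'')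
    (x : X.obj Γ'), Y.act τ (app σ x) = app (Subst.comp σ τ) (X.act τ x)

/-- Exponential of presheaves. -/
@[reducible]
def Psh.exp (X Y : Psh S) : Psh S where
  obj Γ := Exp X Y Γ
  act σ f := ⟨fun τ x => f.app (Subst.comp σ τ) x, fun τ υ x => by
    rw [f.nat, Subst.comp_assoc]⟩
  act_id _ := rfl
  act_act σ τ f := by
    apply Exp.ext
    funext Γ' υ x
    exact congrArg (fun ξ => f.app ξ x) (Subst.comp_assoc _ _ _).symm

theorem Exp.ext_app {X Y : Psh S} {Γ : List (S.VT false)} {f g : Exp X Y Γ}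
    (e : ∀ {Γ' : List (S.VT false)} (σ : Subst S false Γ Γ') (x : X.obj Γ'),
      f.app σ x = g.app σ x) : f = g := by
  apply Exp.ext
  funext Γ' σ x
  exact e σ x

/-- An element of an exponential is determined by the values of its restrictions at the identity.
This is how evaluation at a later context is traded for evaluation in place. -/
theorem Exp.act_app_id {X Y : Psh S} {Γ Γ' : List (S.VT false)} (σ : Subst S false Γ Γ')
    (f : Exp X Y Γ) (x : X.obj Γ') : Exp.app ((X.exp Y).act σ f) Subst.id x = f.app σ x :=
  congrArg (fun ξ => f.app ξ x) (Subst.comp_id σ)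

/-- A stack applied after a family of computations. -/
def Exp.plug {X : Psh S} {Γ : List (S.VT false)} {B C : S.CT false}
    (K : (Psh.cmp (some B) C).obj Γ) (k : Exp X (Psh.cmp none B) Γ) :
    Exp X (Psh.cmp none C) Γ where
  app σ x := Psh.plug ((Psh.cmp (some B) C).act σ K) (k.app σ x)
  nat σ τ x := by rw [Psh.act_plug, k.nat, Psh.act_act]

-- Returners in continuation-passing style

/-- The elements over `Γ` of the presheaf of computations or stacks that return elements of `X`:
families sending each continuation to a result, natural in the context and in the result type. -/
@[ext]
structure Returner (X : Psh S) (Δ : Option (S.CT false)) (Γ : List (S.VT false)) : Type u where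
  app : ∀ {Γ' : List (S.VT false)} (E : S.CT false), Subst S false Γ Γ' →
    Exp X (Psh.cmp none E) Γ' → (Psh.cmp Δ E).obj Γ'
  nat : ∀ {Γ' Γ'' : List (S.VT false)} (E : S.CT false) (σ : Subst S false Γ Γ')
    (τ : Subst S false Γ' Γ'') (k : Exp X (Psh.cmp none E) Γ'),
    (Psh.cmp Δ E).act τ (app E σ k) =
      app E (Subst.comp σ τ) ((Psh.exp X (Psh.cmp none E)).act τ k)
  -- Naturality in the result type. It lets a stack that follows a returner be moved into the
  -- continuation, and it cuts the families down to those given by terms.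
  plug : ∀ {Γ' : List (S.VT false)} {E E' : S.CT false} (σ : Subst S false Γ Γ')
    (K : (Psh.cmp (some E) E').obj Γ') (k : Exp X (Psh.cmp none E) Γ'),
    Psh.plug K (app E σ k) = app E' σ (k.plug K)

theorem Returner.ext_app {X : Psh S} {Δ : Option (S.CT false)} {Γ : List (S.VT false)}
    {m n : Returner X Δ Γ}
    (e : ∀ {Γ' : List (S.VT false)} (E : S.CT false) (σ : Subst S false Γ Γ')
      (k : Exp X (Psh.cmp none E) Γ'), m.app E σ k = n.app E σ k) : m = n := by
  apply Returner.ext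
  funext Γ' E σ k
  exact e E σ k

/-- The presheaf of returners. -/
@[reducible]
def Psh.returner (X : Psh S) (Δ : Option (S.CT false)) : Psh S where
  obj Γ := Returner X Δ Γ
  act σ m := ⟨fun E τ k => m.app E (Subst.comp σ τ) k,
    fun E τ υ k => by rw [m.nat, Subst.comp_assoc],
    fun τ K k => m.plug _ K k⟩
  act_id _ := rfl
  act_act σ τ m := by
    apply Returner.ext_app
    intro Γ' E υ k
    exact congrArg (fun ξ => m.app E ξ k) (Subst.comp_assoc _ _ _).symm

theorem Returner.act_app_id {X : Psh S} {Δ : Option (S.CT false)} {Γ Γ' : List (S.VT false)}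
    (σ : Subst S false Γ Γ') (m : Returner X Δ Γ) (E : S.CT false)
    (k : Exp X (Psh.cmp none E) Γ') :
    Returner.app ((X.returner Δ).act σ m) E Subst.id k = m.app E σ k :=
  congrArg (fun ξ => m.app E ξ k) (Subst.comp_id σ)

/-- The returner of an element. -/
def Returner.pure {X : Psh S} {Γ : List (S.VT false)} (x : X.obj Γ) : Returner X none Γ where
  app _ σ k := k.app Subst.id (X.act σ x)
  nat E σ τ k := by
    rw [k.nat, X.act_act, Exp.act_app_id]; rfl
  plug σ K k := by
    change _ = Psh.plug ((Psh.cmp (some _) _).act Subst.id K) _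
    rw [Psh.act_id]

theorem Returner.act_pure {X : Psh S} {Γ Γ' : List (S.VT false)} (σ : Subst S false Γ Γ')
    (x : X.obj Γ) : (X.returner none).act σ (Returner.pure x) = Returner.pure (X.act σ x) := by
  apply Returner.ext_app
  intro Γ' E υ k
  change k.app _ (X.act _ x) = k.app _ (X.act _ (X.act _ x))
  rw [X.act_act]

/-- A continuation after a family of returners. -/
def Exp.andThen {X Y : Psh S} {Γ : List (S.VT false)} {E : S.CT false}
    (k : Exp X (Y.returner none) Γ) (l : Exp Y (Psh.cmp none E) Γ) :
    Exp X (Psh.cmp none E) Γ where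
  app σ x := (k.app σ x).app E Subst.id ((Y.exp (Psh.cmp none E)).act σ l)
  nat σ τ x := by
    rw [Returner.nat, Psh.act_act, ← k.nat, Returner.act_app_id]
    rfl

/-- Sequencing of returners. -/
def Returner.bind {X Y : Psh S} {Δ : Option (S.CT false)} {Γ : List (S.VT false)}
    (m : Returner X Δ Γ) (k : Exp X (Y.returner none) Γ) : Returner Y Δ Γ where
  app E σ l := m.app E σ (Exp.andThen ((X.exp (Y.returner none)).act σ k) l)
  nat E σ τ l := by
    rw [m.nat]
    refine congrArg (m.app E _) (Exp.ext_app fun υ x => ?_)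
    change (k.app _ x).app E _ _ = (k.app _ x).app E _ _
    rw [Subst.comp_assoc, Psh.act_act]
  plug σ K l := by
    rw [m.plug]
    refine congrArg (m.app _ _) (Exp.ext_app fun υ x => ?_)
    change Psh.plug _ ((k.app _ x).app _ _ _) = (k.app _ x).app _ _ _
    rw [Returner.plug]
    refine congrArg ((k.app _ x).app _ _) (Exp.ext_app fun ξ y => ?_)
    change Psh.plug (Psh.act _ _ (Psh.act _ _ _)) _ = Psh.plug _ _
    rw [Psh.act_act]

theorem Returner.act_bind {X Y : Psh S} {Δ : Option (S.CT false)} {Γ Γ' : List (S.VT false)}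
    (σ : Subst S false Γ Γ') (m : Returner X Δ Γ) (k : Exp X (Y.returner none) Γ) :
    (Y.returner Δ).act σ (m.bind k) =
      Returner.bind ((X.returner Δ).act σ m) ((X.exp (Y.returner none)).act σ k) := by
  refine Returner.ext_app fun E τ l => ?_
  refine congrArg (m.app E _) ?_
  exact congrArg (fun a => Exp.andThen a l) (Psh.act_act (X.exp (Y.returner none)) _ _ _).symm

-- Computation objects as algebras for returners

/-- Presheaves for computations (`none`) and stacks (`some B`) of some computation type, with an
action of returners. -/
structure CPsh (S : Signature.{u}) : Type (u + 1) where
  fam : Option (S.CT false) → Psh S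
  bind : ∀ {X : Psh S} {Δ : Option (S.CT false)} {Γ : List (S.VT false)},
    Returner X Δ Γ → Exp X (fam none) Γ → (fam Δ).obj Γ
  act_bind : ∀ {X : Psh S} {Δ : Option (S.CT false)} {Γ Γ' : List (S.VT false)}
    (σ : Subst S false Γ Γ') (m : Returner X Δ Γ) (k : Exp X (fam none) Γ),
    (fam Δ).act σ (bind m k) = bind ((X.returner Δ).act σ m) ((X.exp (fam none)).act σ k)
  pure_bind : ∀ {X : Psh S} {Γ : List (S.VT false)} (x : X.obj Γ) (k : Exp X (fam none) Γ),
    bind (Returner.pure x) k = k.app Subst.id x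
  -- Associativity. The composite continuation enters as any `n` with the right values, so no
  -- naturality proof of the composite is built into the law.
  bind_bind : ∀ {X Y : Psh S} {Δ : Option (S.CT false)} {Γ : List (S.VT false)}
    (m : Returner X Δ Γ) (k : Exp X (Y.returner none) Γ) (l : Exp Y (fam none) Γ)
    (n : Exp X (fam none) Γ), (∀ {Γ' : List (S.VT false)} (σ : Subst S false Γ Γ') (x : X.obj Γ'),
      n.app σ x = bind (k.app σ x) ((Y.exp (fam none)).act σ l)) → bind (m.bind k) l = bind m n

/-- The computations and stacks of a first-order type. -/
@[reducible]
def CPsh.cmp (C : S.CT false) : CPsh S where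
  fam Δ := Psh.cmp Δ C
  -- By construction a returner knows how to be sequenced into every first-order result type.
  bind m k := m.app C Subst.id k
  act_bind σ m k := by rw [m.nat, Returner.act_app_id]; rfl
  pure_bind x k := congrArg (k.app _) (Psh.act_id _ _)
  bind_bind m k l n e := congrArg (m.app C _) (Exp.ext_app fun σ x => (e σ x).symm)

/-- The terminal computation object. -/
@[reducible]
def CPsh.top : CPsh S where
  fam _ := Psh.unit
  bind _ _ := PUnit.unit
  act_bind _ _ _ := rfl
  pure_bind _ _ := rfl
  bind_bind _ _ _ _ _ := rfl

/-- Postcomposition with the first projection. -/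
def Exp.fst {X Y Z : Psh S} {Γ : List (S.VT false)} (k : Exp X (Y.prod Z) Γ) : Exp X Y Γ where
  app σ x := (k.app σ x).1
  nat σ τ x := congrArg Prod.fst (k.nat σ τ x)

/-- Postcomposition with the second projection. -/
def Exp.snd {X Y Z : Psh S} {Γ : List (S.VT false)} (k : Exp X (Y.prod Z) Γ) : Exp X Z Γ where
  app σ x := (k.app σ x).2
  nat σ τ x := congrArg Prod.snd (k.nat σ τ x)

/-- Products of computation objects. -/
@[reducible]
def CPsh.prod (P Q : CPsh S) : CPsh S where
  fam Δ := (P.fam Δ).prod (Q.fam Δ)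
  bind m k := (P.bind m k.fst, Q.bind m k.snd)
  act_bind σ m k := Prod.ext (P.act_bind σ m _) (Q.act_bind σ m _)
  pure_bind x k := Prod.ext (P.pure_bind x _) (Q.pure_bind x _)
  bind_bind m k l n e := Prod.ext
    (P.bind_bind m k _ _ fun σ x => congrArg Prod.fst (e σ x))
    (Q.bind_bind m k _ _ fun σ x => congrArg Prod.snd (e σ x))

/-- Application of a family of functions to an argument. -/
def Exp.flip {X Y Z : Psh S} {Γ : List (S.VT false)} (k : Exp X (Y.exp Z) Γ) (y : Y.obj Γ) :
    Exp X Z Γ where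
  app σ x := (k.app σ x).app Subst.id (Y.act σ y)
  nat σ τ x := by
    rw [Exp.nat, ← k.nat, Psh.act_act, Exp.act_app_id]; rfl

/-- Powers of computation objects. -/
@[reducible]
def CPsh.pow (Y : Psh S) (P : CPsh S) : CPsh S where
  fam Δ := Y.exp (P.fam Δ)
  -- Sequencing into a function is pointwise in the argument. The argument is restricted together
  -- with the continuation, so the strength that this requires is already part of `Exp`.
  bind {X _ _} m k :=
    { app := fun σ y => P.bind ((X.returner _).act σ m)
        (Exp.flip ((X.exp (Y.exp (P.fam none))).act σ k) y)
      nat := fun σ τ y => by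
        rw [P.act_bind, Psh.act_act]
        refine congrArg (P.bind _) (Exp.ext_app fun υ x => ?_)
        change (k.app _ x).app _ _ = (k.app _ x).app _ _
        rw [Psh.act_act, Subst.comp_assoc] }
  act_bind {X _ _ _} σ m k := by
    refine Exp.ext_app fun τ y => ?_
    refine congrArg₂ P.bind (Psh.act_act (X.returner _) _ _ _).symm ?_
    exact congrArg (fun f => Exp.flip f y) (Psh.act_act (X.exp (Y.exp (P.fam none))) _ _ _).symm
  pure_bind x k := by
    refine Exp.ext_app fun τ y => ?_
    refine (congrArg (fun m => P.bind m _) (Returner.act_pure τ x)).trans ?_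
    rw [P.pure_bind]
    refine (congrArg (Exp.app _ Subst.id) (Y.act_id y)).trans ?_
    refine (congrArg (fun f => Exp.app f Subst.id y) (Exp.act_app_id _ _ _)).trans ?_
    refine (congrArg (fun f => Exp.app f Subst.id y) (k.nat Subst.id τ x).symm).trans ?_
    exact Exp.act_app_id _ _ _
  bind_bind {X Z _ _} m k l n e := by
    refine Exp.ext_app fun τ y => ?_
    refine (congrArg (fun q => P.bind q _) (Returner.act_bind τ m k)).trans ?_
    refine P.bind_bind ((X.returner _).act τ m) ((X.exp (Z.returner none)).act τ k) _ _
      fun σ x => ?_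
    change (n.app _ x).app _ _ = _
    rw [e]
    refine congrArg₂ P.bind (Psh.act_id _ _) (Exp.ext_app fun υ z => ?_)
    change (l.app _ z).app _ _ = (l.app _ z).app _ _
    rw [Psh.act_act, Subst.comp_assoc]
    rfl

/-- The free computation object on a presheaf. -/
@[reducible]
def CPsh.free (Y : Psh S) : CPsh S where
  fam Δ := Y.returner Δ
  bind m k := m.bind k
  act_bind σ m k := Returner.act_bind σ m k
  pure_bind {X _} x k := by
    refine Returner.ext_app fun E τ l => ?_
    change (k.app (Subst.comp τ Subst.id) (X.act τ x)).app _ _ _ = _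
    rw [Subst.comp_id]
    refine (congrArg (fun f => Returner.app f E Subst.id _) (k.nat Subst.id τ x).symm).trans ?_
    exact Returner.act_app_id _ _ _ _
  bind_bind m k l n e := by
    refine Returner.ext_app fun E τ p => ?_
    refine congrArg (m.app E _) (Exp.ext_app fun υ x => ?_)
    change (k.app _ x).app _ _ _ = (n.app _ x).app _ _ _
    rw [e]
    refine congrArg ((k.app _ x).app E _) (Exp.ext_app fun ξ y => ?_)
    change (l.app _ y).app _ _ _ = (l.app _ y).app _ _ _
    rw [Psh.act_act, Subst.comp_assoc]
    rfl

/-- The right unit law of the returner monad. Together with `Cmp.sem_bind` it yields the η-law of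
`F` in the model. -/
theorem Returner.bind_pure {X : Psh S} {Δ : Option (S.CT false)} {Γ : List (S.VT false)}
    (m : Returner X Δ Γ) (k : Exp X (X.returner none) Γ)
    (e : ∀ {Γ' : List (S.VT false)} (σ : Subst S false Γ Γ') (x : X.obj Γ'),
      k.app σ x = Returner.pure x) : m.bind k = m := by
  refine Returner.ext_app fun E τ l => ?_
  refine congrArg (m.app E _) (Exp.ext_app fun υ x => ?_)
  change (k.app _ x).app _ _ _ = _
  rw [e]
  change l.app _ (X.act _ x) = _
  rw [X.act_id, Subst.comp_id]

end Presheaves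

/-! ### Representable presheaves -/

section Representable

variable {S : Signature.{u}}

/-- By the η-law, a stack out of `F A` is determined by what it does to `return x`. On that argument
the left-hand stack β-reduces to `K` applied to `N`. -/
theorem CEq.plug_to {h : Bool} {Γ : List (S.VT h)} {A : S.VT h} {B C : S.CT h}
    (K : Cmp S h Γ (some B) C) (N : Cmp S h (A :: Γ) none B) :
    CEq (K.plug (.to .hole N)) (.to .hole ((K.ren Ren.wk).plug N)) := by
  have e := CEq.to_eta (K.plug (.to .hole N)) .hole
  rw [show (K.plug (.to .hole N)).plug .hole = K.plug (.to .hole N) from Cmp.fill_id _] at e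
  refine e.trans (.to (.refl _) ?_)
  -- The β-redex substitutes the last variable for itself in the weakened `N`, so the resulting
  -- substitution is the identity.
  rw [Cmp.plug_ren, Cmp.plug_plug]
  refine CEq.plug (.refl _) ((CEq.to_beta _ _).trans (.of_eq ?_))
  rw [Cmp.ren_sub]
  refine Eq.trans (congrArg N.sub ?_) (Cmp.sub_id N)
  funext D x
  cases x <;> rfl

/-- The pair of two classes of values. -/
def Psh.vpair {Γ : List (S.VT false)} {A B : S.VT false} (x : (Psh.val A).obj Γ)
    (y : (Psh.val B).obj Γ) : (Psh.val (.prod A B)).obj Γ :=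
  Quotient.map₂ Val.pair (fun _ _ e _ _ e' => VEq.pair e e') x y

/-- The first projection on classes of values. -/
def Psh.vfst {Γ : List (S.VT false)} {A B : S.VT false} (x : (Psh.val (.prod A B)).obj Γ) :
    (Psh.val A).obj Γ := Quotient.map Val.fst (fun _ _ e => VEq.fst e) x

/-- The second projection on classes of values. -/
def Psh.vsnd {Γ : List (S.VT false)} {A B : S.VT false} (x : (Psh.val (.prod A B)).obj Γ) :
    (Psh.val B).obj Γ := Quotient.map Val.snd (fun _ _ e => VEq.snd e) x

/-- Thunks on classes of computations. -/
def Psh.thunk {Γ : List (S.VT false)} {B : S.CT false} (m : (Psh.cmp none B).obj Γ) :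
    (Psh.val (.U B)).obj Γ := Quotient.map Val.thunk (fun _ _ e => VEq.thunk e) m

/-- Forcing classes of values. -/
def Psh.force {Γ : List (S.VT false)} {B : S.CT false} (x : (Psh.val (.U B)).obj Γ) :
    (Psh.cmp none B).obj Γ := Quotient.map Cmp.force (fun _ _ e => CEq.force e) x

/-- Returning classes of values. -/
def Psh.ret {Γ : List (S.VT false)} {A : S.VT false} (x : (Psh.val A).obj Γ) :
    (Psh.cmp none (.F A)).obj Γ := Quotient.map Cmp.ret (fun _ _ e => CEq.ret e) x

/-- The stack of a continuation. -/
def Psh.toStack {Γ : List (S.VT false)} {A : S.VT false} {B : S.CT false}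
    (n : (Psh.cmp none B).obj (A :: Γ)) : (Psh.cmp (some (.F A)) B).obj Γ :=
  Quotient.map (fun N => Cmp.to .hole N) (fun _ _ e => CEq.to (.refl _) e) n

/-- The pair of two classes of computations or stacks. -/
def Psh.cpair {Γ : List (S.VT false)} {Δ : Option (S.CT false)} {B C : S.CT false}
    (x : (Psh.cmp Δ B).obj Γ) (y : (Psh.cmp Δ C).obj Γ) : (Psh.cmp Δ (.prod B C)).obj Γ :=
  Quotient.map₂ Cmp.pair (fun _ _ e _ _ e' => CEq.pair e e') x y

/-- The first projection on classes of computations or stacks. -/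
def Psh.cfst {Γ : List (S.VT false)} {Δ : Option (S.CT false)} {B C : S.CT false}
    (x : (Psh.cmp Δ (.prod B C)).obj Γ) : (Psh.cmp Δ B).obj Γ :=
  Quotient.map Cmp.fst (fun _ _ e => CEq.fst e) x

/-- The second projection on classes of computations or stacks. -/
def Psh.csnd {Γ : List (S.VT false)} {Δ : Option (S.CT false)} {B C : S.CT false}
    (x : (Psh.cmp Δ (.prod B C)).obj Γ) : (Psh.cmp Δ C).obj Γ :=
  Quotient.map Cmp.snd (fun _ _ e => CEq.snd e) x

-- Presheaves represented by first-order types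

/-- A presheaf isomorphic to the presheaf of values of a first-order type. -/
structure VRep (A : S.VT false) (X : Psh S) where
  reify : ∀ {Γ : List (S.VT false)}, X.obj Γ → (Psh.val A).obj Γ
  reflect : ∀ {Γ : List (S.VT false)}, (Psh.val A).obj Γ → X.obj Γ
  reflect_reify : ∀ {Γ : List (S.VT false)} (x : X.obj Γ), reflect (reify x) = x
  reify_reflect : ∀ {Γ : List (S.VT false)} (x : (Psh.val A).obj Γ), reify (reflect x) = x
  act_reify : ∀ {Γ Γ' : List (S.VT false)} (σ : Subst S false Γ Γ') (x : X.obj Γ),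
    (Psh.val A).act σ (reify x) = reify (X.act σ x)

/-- The inverse of a natural bijection is natural, which is why only `reify` carries a naturality
field. -/
theorem VRep.act_reflect {A : S.VT false} {X : Psh S} (R : VRep A X) {Γ Γ' : List (S.VT false)}
    (σ : Subst S false Γ Γ') (x : (Psh.val A).obj Γ) :
    X.act σ (R.reflect x) = R.reflect ((Psh.val A).act σ x) := by
  rw [← R.reflect_reify (X.act σ (R.reflect x)), ← R.act_reify, R.reify_reflect]

/-- A computation object isomorphic to that of a first-order type, compatibly with sequencing. -/
structure CRep (B : S.CT false) (P : CPsh S) where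
  reify : ∀ {Γ : List (S.VT false)} {Δ : Option (S.CT false)},
    (P.fam Δ).obj Γ → (Psh.cmp Δ B).obj Γ
  reflect : ∀ {Γ : List (S.VT false)} {Δ : Option (S.CT false)},
    (Psh.cmp Δ B).obj Γ → (P.fam Δ).obj Γ
  reflect_reify : ∀ {Γ : List (S.VT false)} {Δ : Option (S.CT false)} (x : (P.fam Δ).obj Γ),
    reflect (reify x) = x
  reify_reflect : ∀ {Γ : List (S.VT false)} {Δ : Option (S.CT false)} (x : (Psh.cmp Δ B).obj Γ),
    reify (reflect x) = x
  act_reify : ∀ {Γ Γ' : List (S.VT false)} {Δ : Option (S.CT false)} (σ : Subst S false Γ Γ')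
    (x : (P.fam Δ).obj Γ), (Psh.cmp Δ B).act σ (reify x) = reify ((P.fam Δ).act σ x)
  -- The isomorphism must also respect the algebra structure: sequencing in `P` corresponds to
  -- running the returner at result type `B`. As in `bind_bind`, the transported continuation is
  -- specified only by its values.
  reify_bind : ∀ {X : Psh S} {Γ : List (S.VT false)} {Δ : Option (S.CT false)} (m : Returner X Δ Γ)
    (k : Exp X (P.fam none) Γ) (l : Exp X (Psh.cmp none B) Γ),
    (∀ {Γ' : List (S.VT false)} (σ : Subst S false Γ Γ') (x : X.obj Γ'),
      l.app σ x = reify (k.app σ x)) → reify (P.bind m k) = m.app B Subst.id l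

theorem CRep.act_reflect {B : S.CT false} {P : CPsh S} (R : CRep B P) {Γ Γ' : List (S.VT false)}
    {Δ : Option (S.CT false)} (σ : Subst S false Γ Γ') (x : (Psh.cmp Δ B).obj Γ) :
    (P.fam Δ).act σ (R.reflect x) = R.reflect ((Psh.cmp Δ B).act σ x) := by
  rw [← R.reflect_reify ((P.fam Δ).act σ (R.reflect x)), ← R.act_reify, R.reify_reflect]

/-- The values of a first-order type represent it. -/
def VRep.refl (A : S.VT false) : VRep A (Psh.val A) where
  reify x := x
  reflect x := x
  reflect_reify _ := rfl
  reify_reflect _ := rfl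
  act_reify _ _ := rfl

/-- The terminal presheaf represents the unit type. -/
def VRep.unit : VRep (S := S) .unit Psh.unit where
  reify _ := Val.cls .unit
  reflect _ := PUnit.unit
  reflect_reify _ := rfl
  reify_reflect x := by
    induction x using Val.cls_ind with | e V
    exact Val.cls_eq (VEq.unit_eta V).symm
  act_reify _ _ := rfl

theorem Psh.vpair_fst {Γ : List (S.VT false)} {A B : S.VT false} (x : (Psh.val A).obj Γ)
    (y : (Psh.val B).obj Γ) : Psh.vfst (Psh.vpair x y) = x := by
  induction x using Val.cls_ind
  induction y using Val.cls_ind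
  exact Val.cls_eq (.fst_beta _ _)

theorem Psh.vpair_snd {Γ : List (S.VT false)} {A B : S.VT false} (x : (Psh.val A).obj Γ)
    (y : (Psh.val B).obj Γ) : Psh.vsnd (Psh.vpair x y) = y := by
  induction x using Val.cls_ind
  induction y using Val.cls_ind
  exact Val.cls_eq (.snd_beta _ _)

theorem Psh.force_thunk {Γ : List (S.VT false)} {B : S.CT false} (m : (Psh.cmp none B).obj Γ) :
    Psh.force (Psh.thunk m) = m := by
  induction m using Cmp.cls_ind
  exact Cmp.cls_eq (.force_beta _)

/-- Products of presheaves represent product types. -/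
def VRep.prod {A B : S.VT false} {X Y : Psh S} (R : VRep A X) (T : VRep B Y) :
    VRep (.prod A B) (X.prod Y) where
  reify x := Psh.vpair (R.reify x.1) (T.reify x.2)
  reflect x := (R.reflect (Psh.vfst x), T.reflect (Psh.vsnd x))
  reflect_reify x := by
    rw [Psh.vpair_fst, Psh.vpair_snd, R.reflect_reify, T.reflect_reify]
  reify_reflect x := by
    rw [R.reify_reflect, T.reify_reflect]
    induction x using Val.cls_ind with | e V
    exact Val.cls_eq (VEq.pair_eta V).symm
  act_reify σ x := by
    change _ = Psh.vpair (R.reify (X.act σ x.1)) (T.reify (Y.act σ x.2))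
    rw [← R.act_reify, ← T.act_reify]
    generalize R.reify x.1 = v
    generalize T.reify x.2 = w
    induction v using Val.cls_ind
    induction w using Val.cls_ind
    rfl

/-- Computations represent thunk types. -/
def VRep.U {B : S.CT false} {P : CPsh S} (R : CRep B P) : VRep (.U B) (P.fam none) where
  reify x := Psh.thunk (R.reify x)
  reflect x := R.reflect (Psh.force x)
  reflect_reify x := by
    rw [Psh.force_thunk, R.reflect_reify]
  reify_reflect x := by
    rw [R.reify_reflect]
    induction x using Val.cls_ind with | e V
    exact Val.cls_eq (VEq.thunk_eta V).symm
  act_reify σ x := by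
    rw [← R.act_reify]
    generalize R.reify x = v
    induction v using Cmp.cls_ind
    rfl

/-- The computations of a first-order type represent it. -/
def CRep.refl (B : S.CT false) : CRep B (CPsh.cmp B) where
  reify x := x
  reflect x := x
  reflect_reify _ := rfl
  reify_reflect _ := rfl
  act_reify _ _ := rfl
  reify_bind m k l e := congrArg (m.app B _) (Exp.ext_app fun σ x => (e σ x).symm)

theorem Psh.eq_top {Γ : List (S.VT false)} {Δ : Option (S.CT false)}
    (x : (Psh.cmp Δ .top).obj Γ) : x = Cmp.cls .top := by
  induction x using Cmp.cls_ind with | e M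
  exact Cmp.cls_eq (.top_eta M)

/-- The terminal computation object represents the computation type `top`. -/
def CRep.top : CRep (S := S) .top CPsh.top where
  reify _ := Cmp.cls .top
  reflect _ := PUnit.unit
  reflect_reify _ := rfl
  reify_reflect x := (Psh.eq_top x).symm
  act_reify _ _ := rfl
  reify_bind m k l e := (Psh.eq_top _).symm

theorem Psh.cpair_fst {Γ : List (S.VT false)} {Δ : Option (S.CT false)} {B C : S.CT false}
    (x : (Psh.cmp Δ B).obj Γ) (y : (Psh.cmp Δ C).obj Γ) : Psh.cfst (Psh.cpair x y) = x := by
  induction x using Cmp.cls_ind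
  induction y using Cmp.cls_ind
  exact Cmp.cls_eq (.fst_beta _ _)

theorem Psh.cpair_snd {Γ : List (S.VT false)} {Δ : Option (S.CT false)} {B C : S.CT false}
    (x : (Psh.cmp Δ B).obj Γ) (y : (Psh.cmp Δ C).obj Γ) : Psh.csnd (Psh.cpair x y) = y := by
  induction x using Cmp.cls_ind
  induction y using Cmp.cls_ind
  exact Cmp.cls_eq (.snd_beta _ _)

theorem Psh.cpair_eta {Γ : List (S.VT false)} {Δ : Option (S.CT false)} {B C : S.CT false}
    (x : (Psh.cmp Δ (.prod B C)).obj Γ) : Psh.cpair (Psh.cfst x) (Psh.csnd x) = x := by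
  induction x using Cmp.cls_ind with | e M
  exact Cmp.cls_eq (CEq.pair_eta M).symm

/-- Writing a projection as plugging into a stack makes `Returner.plug` applicable to it. -/
theorem Psh.plug_fst {Γ : List (S.VT false)} {Δ : Option (S.CT false)} {B C : S.CT false}
    (x : (Psh.cmp Δ (.prod B C)).obj Γ) : Psh.plug (Cmp.cls (.fst .hole)) x = Psh.cfst x := by
  induction x using Cmp.cls_ind
  rfl

theorem Psh.plug_snd {Γ : List (S.VT false)} {Δ : Option (S.CT false)} {B C : S.CT false}
    (x : (Psh.cmp Δ (.prod B C)).obj Γ) : Psh.plug (Cmp.cls (.snd .hole)) x = Psh.csnd x := by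
  induction x using Cmp.cls_ind
  rfl

/-- Products of computation objects represent product types. -/
def CRep.prod {B C : S.CT false} {P Q : CPsh S} (R : CRep B P) (T : CRep C Q) :
    CRep (.prod B C) (P.prod Q) where
  reify x := Psh.cpair (R.reify x.1) (T.reify x.2)
  reflect x := (R.reflect (Psh.cfst x), T.reflect (Psh.csnd x))
  reflect_reify x := by
    rw [Psh.cpair_fst, Psh.cpair_snd, R.reflect_reify, T.reflect_reify]
  reify_reflect x := by
    rw [R.reify_reflect, T.reify_reflect, Psh.cpair_eta]
  act_reify σ x := by
    change _ = Psh.cpair (R.reify ((P.fam _).act σ x.1)) (T.reify ((Q.fam _).act σ x.2))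
    rw [← R.act_reify, ← T.act_reify]
    generalize R.reify x.1 = v
    generalize T.reify x.2 = w
    induction v using Cmp.cls_ind
    induction w using Cmp.cls_ind
    rfl
  reify_bind m k l e := by
    -- The result is determined by its two projections. Each is a stack, so naturality of `m` moves
    -- it into the continuation, where the two factors can be treated separately.
    rw [← Psh.cpair_eta (m.app _ _ l), ← Psh.plug_fst, ← Psh.plug_snd, m.plug, m.plug]
    refine congrArg₂ Psh.cpair (R.reify_bind m k.fst _ fun σ x => ?_)
      (T.reify_bind m k.snd _ fun σ x => ?_)
    · exact (congrArg (Psh.plug _) (e σ x)).trans ((Psh.plug_fst _).trans (Psh.cpair_fst _ _))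
    · exact (congrArg (Psh.plug _) (e σ x)).trans ((Psh.plug_snd _).trans (Psh.cpair_snd _ _))

-- Yoneda for continuations and the representation of `F`

/-- The weakening substitution. -/
def Subst.wk {h : Bool} {Γ : List (S.VT h)} {A : S.VT h} : Subst S h Γ (A :: Γ) :=
  fun _ x => .var (.succ x)

/-- The class of the last variable. -/
def Psh.last {Γ : List (S.VT false)} {A : S.VT false} : (Psh.val A).obj (A :: Γ) :=
  Val.cls (.var .zero)

theorem Subst.wk_lift {h : Bool} {Γ Γ' : List (S.VT h)} {A : S.VT h} (σ : Subst S h Γ Γ') :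
    Subst.comp (Subst.wk (A := A)) (Subst.lift σ) = Subst.comp σ Subst.wk := by
  funext B x
  exact Val.ren_eq_sub _ _

theorem Psh.act_toStack {Γ Γ' : List (S.VT false)} {A : S.VT false} {B : S.CT false}
    (σ : Subst S false Γ Γ') (n : (Psh.cmp none B).obj (A :: Γ)) :
    (Psh.cmp _ B).act σ (Psh.toStack n) = Psh.toStack ((Psh.cmp none B).act (Subst.lift σ) n) := by
  induction n using Cmp.cls_ind
  rfl

theorem Psh.plug_plug {Γ : List (S.VT false)} {A B C : S.CT false} {Δ : Option (S.CT false)}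
    (K : (Psh.cmp (some B) C).obj Γ) (L : (Psh.cmp (some A) B).obj Γ) (m : (Psh.cmp Δ A).obj Γ) :
    Psh.plug K (Psh.plug L m) = Psh.plug (Psh.plug K L) m := by
  induction K using Cmp.cls_ind
  induction L using Cmp.cls_ind
  induction m using Cmp.cls_ind
  exact congrArg Cmp.cls (Cmp.plug_plug _ _ _).symm

/-- The form of `CEq.plug_to` on equivalence classes; it makes the passage from continuations to
stacks natural in the result type. -/
theorem Psh.plug_toStack {Γ : List (S.VT false)} {A : S.VT false} {B C : S.CT false}
    (K : (Psh.cmp (some B) C).obj Γ) (n : (Psh.cmp none B).obj (A :: Γ)) :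
    Psh.plug K (Psh.toStack n) =
      Psh.toStack (Psh.plug ((Psh.cmp (some B) C).act Subst.wk K) n) := by
  induction K using Cmp.cls_ind with | e K
  induction n using Cmp.cls_ind with | e N
  refine (Cmp.cls_eq (CEq.plug_to K N)).trans ?_
  rw [Cmp.ren_eq_sub]
  rfl

theorem Psh.toStack_ret {Γ : List (S.VT false)} {A : S.VT false} {B : S.CT false}
    (n : (Psh.cmp none B).obj (A :: Γ)) (V : Val S false Γ A) :
    Psh.plug (Psh.toStack n) (Psh.ret V.cls) =
      (Psh.cmp none B).act (Subst.cons V Subst.id) n := by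
  induction n using Cmp.cls_ind with | e N
  exact Cmp.cls_eq (.to_beta _ _)

/-- The continuation that returns its argument gives the identity stack; this is the η-law of `F` at
the empty stack. -/
theorem Psh.toStack_last {Γ : List (S.VT false)} {A : S.VT false} {Δ : Option (S.CT false)}
    (m : (Psh.cmp Δ (.F A)).obj Γ) : Psh.plug (Psh.toStack (Psh.ret Psh.last)) m = m := by
  induction m using Cmp.cls_ind with | e M
  exact (Cmp.cls_eq (CEq.to_eta .hole M)).symm

theorem Psh.act_ret {Γ Γ' : List (S.VT false)} {A : S.VT false}
    (σ : Subst S false Γ Γ') (x : (Psh.val A).obj Γ) :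
    (Psh.cmp none _).act σ (Psh.ret x) = Psh.ret ((Psh.val A).act σ x) := by
  induction x using Val.cls_ind
  rfl

/-- Returning the value represented by an element. -/
def VRep.ret {A : S.VT false} {X : Psh S} (R : VRep A X) (Γ : List (S.VT false)) :
    Exp X (Psh.cmp none (.F A)) Γ where
  app _ x := Psh.ret (R.reify x)
  nat σ τ x := by rw [Psh.act_ret, R.act_reify]

/-- The stack of a continuation given as a family. -/
def VRep.stack {A : S.VT false} {X : Psh S} (R : VRep A X) {Γ : List (S.VT false)}
    {E : S.CT false} (k : Exp X (Psh.cmp none E) Γ) : (Psh.cmp (some (.F A)) E).obj Γ :=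
  Psh.toStack (k.app Subst.wk (R.reflect Psh.last))

theorem VRep.act_stack {A : S.VT false} {X : Psh S} (R : VRep A X) {Γ Γ' : List (S.VT false)}
    {E : S.CT false} (σ : Subst S false Γ Γ') (k : Exp X (Psh.cmp none E) Γ) :
    (Psh.cmp (some (.F A)) E).act σ (R.stack k) =
      R.stack ((X.exp (Psh.cmp none E)).act σ k) := by
  refine (Psh.act_toStack _ _).trans (congrArg Psh.toStack ?_)
  rw [k.nat, R.act_reflect, Subst.wk_lift]
  rfl

theorem VRep.plug_stack {A : S.VT false} {X : Psh S} (R : VRep A X) {Γ : List (S.VT false)}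
    {E E' : S.CT false} (K : (Psh.cmp (some E) E').obj Γ) (k : Exp X (Psh.cmp none E) Γ) :
    Psh.plug K (R.stack k) = R.stack (k.plug K) := Psh.plug_toStack _ _

/-- The Yoneda argument for continuations: the value of `k` at the generic element, the last
variable, determines its value at every element. -/
theorem VRep.stack_ret {A : S.VT false} {X : Psh S} (R : VRep A X) {Γ : List (S.VT false)}
    {E : S.CT false} (k : Exp X (Psh.cmp none E) Γ) (x : X.obj Γ) :
    Psh.plug (R.stack k) (Psh.ret (R.reify x)) = k.app Subst.id x := by
  obtain ⟨V, e⟩ : ∃ V, R.reify x = Val.cls V := by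
    generalize R.reify x = v
    induction v using Val.cls_ind with | e V
    exact ⟨V, rfl⟩
  rw [e]
  refine (Psh.toStack_ret _ V).trans ?_
  -- Weakening followed by the substitution of `V` for the new variable is the identity, and it
  -- sends the generic element to the one represented by `V`.
  rw [k.nat, R.act_reflect]
  change k.app Subst.id (R.reflect (Val.cls V)) = _
  rw [← e, R.reflect_reify]

/-- The free computation object on a presheaf represented by `A` represents `F A`. -/
def CRep.F {A : S.VT false} {X : Psh S} (R : VRep A X) : CRep (.F A) (CPsh.free X) where
  -- The returner is run on the universal continuation, the one that returns its argument.
  -- Conversely, a term of type `F A` runs a continuation by being plugged into the stack of that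
  -- continuation.
  reify {Γ _} m := m.app (.F A) Subst.id (R.ret Γ)
  reflect {Γ _} x :=
    { app := fun E σ k => Psh.plug (R.stack k) ((Psh.cmp _ (.F A)).act σ x)
      nat := fun E σ τ k => by rw [Psh.act_plug, R.act_stack, Psh.act_act]
      plug := fun σ K k => by rw [Psh.plug_plug, R.plug_stack] }
  reflect_reify {Γ _} m := by
    refine Returner.ext_app fun E σ k => ?_
    change Psh.plug (R.stack k) (Psh.act _ _ (m.app _ _ _)) = _
    -- Naturality along stacks absorbs the stack of `k` into the universal continuation. What
    -- remains is that `return` followed by this stack is `k`, which is `VRep.stack_ret`.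
    rw [m.nat, m.plug]
    refine congrArg (m.app E σ) (Exp.ext_app fun τ x => ?_)
    change Psh.plug (Psh.act _ _ (R.stack k)) (Psh.ret (R.reify x)) = _
    rw [R.act_stack, R.stack_ret, Exp.act_app_id]
  reify_reflect {Γ _} x := by
    change Psh.plug (Psh.toStack (Psh.ret (R.reify (R.reflect Psh.last)))) (Psh.act _ _ x) = _
    rw [R.reify_reflect, Psh.act_id, Psh.toStack_last]
  act_reify σ m := by
    rw [m.nat, Returner.act_app_id]
    rfl
  reify_bind m k l e := by
    refine congrArg (m.app _ _) (Exp.ext_app fun σ x => ?_)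
    exact (e σ x).symm

end Representable

/-! ### The presheaf interpretation -/

section Interpretation

variable {S : Signature.{u}} {h : Bool}

mutual
/-- The interpretation of value types. -/
def VTy.sem (S : Signature.{u}) {h : Bool} : S.VT h → Psh S
  | .base b => Psh.val (.base b)
  | .unit => Psh.unit
  | .prod A B => (VTy.sem S A).prod (VTy.sem S B)
  | .U B => (CTy.sem S B).fam none

/-- The interpretation of computation types. -/
def CTy.sem (S : Signature.{u}) {h : Bool} : S.CT h → CPsh S
  | .base b => CPsh.cmp (.base b)
  | .F A => CPsh.free (VTy.sem S A)
  | .top => CPsh.top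
  | .prod B C => (CTy.sem S B).prod (CTy.sem S C)
  | .arr _ A B => CPsh.pow (VTy.sem S A) (CTy.sem S B)
end

mutual
/-- First-order value types represent their interpretation. -/
def VTy.rep (S : Signature.{u}) (h : Bool) : (A : S.VT false) → VRep A (VTy.sem S (A.ofFO h))
  | .base b => VRep.refl _
  | .unit => VRep.unit
  | .prod A B => VRep.prod (VTy.rep S h A) (VTy.rep S h B)
  | .U B => VRep.U (CTy.rep S h B)

/-- First-order computation types represent their interpretation. -/
def CTy.rep (S : Signature.{u}) (h : Bool) : (B : S.CT false) → CRep B (CTy.sem S (B.ofFO h))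
  | .base b => CRep.refl _
  | .F A => CRep.F (VTy.rep S h A)
  | .top => CRep.top
  | .prod B C => CRep.prod (CTy.rep S h B) (CTy.rep S h C)
  | .arr hh _ _ => nomatch hh
end

/-- The representation of a type equal to a first-order type. -/
def VTy.repOf {A : S.VT h} {A₀ : S.VT false} (e : A = A₀.ofFO h) : VRep A₀ (VTy.sem S A) :=
  e ▸ VTy.rep S h A₀

/-- The representation of a type equal to a first-order type. -/
def CTy.repOf {B : S.CT h} {B₀ : S.CT false} (e : B = B₀.ofFO h) : CRep B₀ (CTy.sem S B) :=
  e ▸ CTy.rep S h B₀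

mutual
-- The types of operations are read through `ofFO h`, even when `h` is `false`. There the reading is
-- the identity, but this needs an induction on types.
theorem VTy.ofFO_false : ∀ A : S.VT false, A.ofFO false = A
  | .base b => rfl
  | .unit => rfl
  | .prod A B => congrArg₂ VTy.prod (VTy.ofFO_false A) (VTy.ofFO_false B)
  | .U B => congrArg VTy.U (CTy.ofFO_false B)

theorem CTy.ofFO_false : ∀ B : S.CT false, B.ofFO false = B
  | .base b => rfl
  | .F A => congrArg CTy.F (VTy.ofFO_false A)
  | .top => rfl
  | .prod B C => congrArg₂ CTy.prod (CTy.ofFO_false B) (CTy.ofFO_false C)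
  | .arr hh _ _ => nomatch hh
end

/-- Value operations on classes of values. -/
def Psh.vop {Γ : List (S.VT false)} (o : S.VOp) (x : (Psh.val (S.vdom o)).obj Γ) :
    (Psh.val (S.vcod o)).obj Γ :=
  Quotient.map (Val.op o (VTy.ofFO_false _).symm (VTy.ofFO_false _).symm)
    (fun _ _ e => VEq.op o _ _ e) x

/-- Computation operations on classes of values. -/
def Psh.cop {Γ : List (S.VT false)} (o : S.COp) (x : (Psh.val (S.cdom o)).obj Γ) :
    (Psh.cmp none (S.ccod o)).obj Γ :=
  Quotient.map (Cmp.cop o (VTy.ofFO_false _).symm (CTy.ofFO_false _).symm)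
    (fun _ _ e => CEq.cop o _ _ e) x

/-- Stack operations on equivalence classes. -/
def Psh.kop {Γ : List (S.VT false)} {Δ : Option (S.CT false)} (o : S.KOp)
    (x : (Psh.val (S.kdom o)).obj Γ) (m : (Psh.cmp Δ (S.khole o)).obj Γ) :
    (Psh.cmp Δ (S.kcod o)).obj Γ :=
  Quotient.map₂
    (Cmp.kop o (VTy.ofFO_false _).symm (CTy.ofFO_false _).symm (CTy.ofFO_false _).symm)
    (fun _ _ e _ _ e' => CEq.kop o _ _ _ e e') x m

theorem Psh.act_vop {Γ Γ' : List (S.VT false)} (σ : Subst S false Γ Γ') (o : S.VOp)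
    (x : (Psh.val (S.vdom o)).obj Γ) :
    (Psh.val _).act σ (Psh.vop o x) = Psh.vop o ((Psh.val _).act σ x) := by
  induction x using Val.cls_ind
  rfl

theorem Psh.act_cop {Γ Γ' : List (S.VT false)} (σ : Subst S false Γ Γ') (o : S.COp)
    (x : (Psh.val (S.cdom o)).obj Γ) :
    (Psh.cmp _ _).act σ (Psh.cop o x) = Psh.cop o ((Psh.val _).act σ x) := by
  induction x using Val.cls_ind
  rfl

theorem Psh.act_kop {Γ Γ' : List (S.VT false)} {Δ : Option (S.CT false)}
    (σ : Subst S false Γ Γ') (o : S.KOp) (x : (Psh.val (S.kdom o)).obj Γ)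
    (m : (Psh.cmp Δ (S.khole o)).obj Γ) :
    (Psh.cmp _ _).act σ (Psh.kop o x m) =
      Psh.kop o ((Psh.val _).act σ x) ((Psh.cmp _ _).act σ m) := by
  induction x using Val.cls_ind
  induction m using Cmp.cls_ind
  rfl

/-- A stack operation is plugging into a stack of its own, so it can be moved past a returner by
`Returner.plug`. -/
theorem Psh.kop_plug {Γ : List (S.VT false)} {Δ : Option (S.CT false)} (o : S.KOp)
    (x : (Psh.val (S.kdom o)).obj Γ) (m : (Psh.cmp Δ (S.khole o)).obj Γ) :
    Psh.kop o x m = Psh.plug (Psh.kop o x (Cmp.cls .hole)) m := by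
  induction x using Val.cls_ind
  induction m using Cmp.cls_ind
  rfl

/-- The interpretation of contexts. -/
@[reducible]
def Env (S : Signature.{u}) {h : Bool} (Γ : List (S.VT h)) : Psh S where
  obj G := ∀ ⦃A : S.VT h⦄, Var Γ A → (VTy.sem S A).obj G
  act σ ρ := fun A x => (VTy.sem S A).act σ (ρ x)
  act_id ρ := by funext A x; exact Psh.act_id _ _
  act_act σ τ ρ := by funext A x; exact Psh.act_act _ _ _ _

/-- An environment extended by an element. -/
def Env.cons {Γ : List (S.VT h)} {A : S.VT h} {G : List (S.VT false)} (a : (VTy.sem S A).obj G)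
    (ρ : (Env S Γ).obj G) : (Env S (A :: Γ)).obj G
  | _, .zero => a
  | _, .succ x => ρ x

theorem Env.act_cons {Γ : List (S.VT h)} {A : S.VT h} {G G' : List (S.VT false)}
    (σ : Subst S false G G') (a : (VTy.sem S A).obj G) (ρ : (Env S Γ).obj G) :
    (Env S (A :: Γ)).act σ (Env.cons a ρ) =
      Env.cons ((VTy.sem S A).act σ a) ((Env S Γ).act σ ρ) := by
  funext B x
  cases x <;> rfl

/-- The interpretation of holes: what may be put, over the first-order hole type `D`, in the hole
of a computation or stack. -/
@[reducible]
def Hole (S : Signature.{u}) {h : Bool} : Option (S.CT h) → Option (S.CT false) → Psh S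
  | none, none => Psh.unit
  -- A computation has no hole, so it has no component over a hole type `D`; the empty presheaf
  -- makes that component vacuous. A stack from `B`, in contrast, acts on computations of type `B`
  -- and, by composition, on stacks into `B` out of every first-order `D`.
  | none, some _ => Psh.empty
  | some B, D => (CTy.sem S B).fam D

/-- Natural maps from environments. -/
structure VHom (Γ : List (S.VT h)) (X : Psh S) where
  app : ∀ {G : List (S.VT false)}, (Env S Γ).obj G → X.obj G
  nat : ∀ {G G' : List (S.VT false)} (σ : Subst S false G G') (ρ : (Env S Γ).obj G),
    X.act σ (app ρ) = app ((Env S Γ).act σ ρ)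

/-- Natural maps from environments and a presheaf `H`. -/
structure CHom (Γ : List (S.VT h)) (H X : Psh S) where
  app : ∀ {G : List (S.VT false)}, (Env S Γ).obj G → H.obj G → X.obj G
  nat : ∀ {G G' : List (S.VT false)} (σ : Subst S false G G') (ρ : (Env S Γ).obj G) (x : H.obj G),
    X.act σ (app ρ x) = app ((Env S Γ).act σ ρ) (H.act σ x)

/-- Computations without hole. -/
def VHom.toCHom {Γ : List (S.VT h)} {P : CPsh S} (f : VHom Γ (P.fam none)) :
    ∀ D : Option (S.CT false), CHom Γ (Hole S (none : Option (S.CT h)) D) (P.fam D)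
  | none => ⟨fun ρ _ => f.app ρ, fun σ ρ _ => f.nat σ ρ⟩
  | some _ => ⟨fun _ x => x.elim, fun _ _ x => x.elim⟩

/-- Abstraction. -/
def CHom.lam {Γ : List (S.VT h)} {A : S.VT h} {H Y : Psh S} (f : CHom (A :: Γ) H Y) :
    CHom Γ H ((VTy.sem S A).exp Y) where
  app ρ x :=
    { app := fun σ a => f.app (Env.cons a ((Env S Γ).act σ ρ)) (H.act σ x)
      nat := fun σ τ a => by
        rw [f.nat, Env.act_cons, Psh.act_act, Psh.act_act] }
  nat σ ρ x := by
    refine Exp.ext_app fun τ a => ?_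
    change f.app _ (H.act _ x) = f.app _ _
    rw [Psh.act_act, Psh.act_act]

/-- Application. -/
def CHom.ap {Γ : List (S.VT h)} {H X Y : Psh S} (f : CHom Γ H (X.exp Y)) (v : VHom Γ X) :
    CHom Γ H Y where
  app ρ x := (f.app ρ x).app Subst.id (v.app ρ)
  nat σ ρ x := by
    rw [Exp.nat, v.nat, ← f.nat, Exp.act_app_id]
    rfl

/-- Sequencing. -/
def CHom.seq {Γ : List (S.VT h)} {A : S.VT h} {H : Psh S} {P : CPsh S}
    {D : Option (S.CT false)} (m : CHom Γ H ((VTy.sem S A).returner D))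
    (n : CHom (A :: Γ) Psh.unit (P.fam none)) : CHom Γ H (P.fam D) where
  -- Abstracting the bound variable turns the body into a continuation. The body is a computation,
  -- so its hole argument is the trivial one.
  app ρ x := P.bind (m.app ρ x) (n.lam.app ρ PUnit.unit)
  nat σ ρ x := by
    rw [P.act_bind, m.nat, n.lam.nat]

mutual
/-- The interpretation of values. -/
def Val.sem : {Γ : List (S.VT h)} → {A : S.VT h} → Val S h Γ A → VHom Γ (VTy.sem S A)
  | _, _, .var x => ⟨fun ρ => ρ x, fun _ _ => rfl⟩
  | _, _, .unit => ⟨fun _ => PUnit.unit, fun _ _ => rfl⟩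
  | _, _, .pair V W => ⟨fun ρ => (V.sem.app ρ, W.sem.app ρ), fun σ ρ =>
      Prod.ext (V.sem.nat σ ρ) (W.sem.nat σ ρ)⟩
  | _, _, .fst V => ⟨fun ρ => (V.sem.app ρ).1, fun σ ρ => congrArg Prod.fst (V.sem.nat σ ρ)⟩
  | _, _, .snd V => ⟨fun ρ => (V.sem.app ρ).2, fun σ ρ => congrArg Prod.snd (V.sem.nat σ ρ)⟩
  | _, _, .thunk M => ⟨fun ρ => (M.sem none).app ρ PUnit.unit, fun σ ρ => (M.sem none).nat σ ρ _⟩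
  -- Operations are interpreted by themselves: their types are first-order, so the argument can be
  -- reified to a term, the syntactic operation applied to it, and the result reflected back.
  | _, _, .op o hA hB V =>
      ⟨fun ρ => (VTy.repOf hB).reflect (Psh.vop o ((VTy.repOf hA).reify (V.sem.app ρ))),
        fun σ ρ => by
          rw [VRep.act_reflect, Psh.act_vop, VRep.act_reify, V.sem.nat]⟩

/-- The interpretation of computations and stacks. -/
def Cmp.sem : {Γ : List (S.VT h)} → {Δ : Option (S.CT h)} → {C : S.CT h} → Cmp S h Γ Δ C →
    ∀ D : Option (S.CT false), CHom Γ (Hole S Δ D) ((CTy.sem S C).fam D)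
  | _, _, _, .hole, D => ⟨fun _ x => x, fun _ _ _ => rfl⟩
  | _, _, _, .force V, D => VHom.toCHom ⟨fun ρ => V.sem.app ρ, fun σ ρ => V.sem.nat σ ρ⟩ D
  | _, _, _, .ret (A := A) V, D =>
      VHom.toCHom (P := CPsh.free (VTy.sem S A)) ⟨fun ρ => Returner.pure (V.sem.app ρ),
        fun σ ρ => by rw [Returner.act_pure, V.sem.nat]⟩ D
  | _, _, _, .to M N, D => CHom.seq (M.sem D) (N.sem none)
  | _, _, _, .top, D => ⟨fun _ _ => PUnit.unit, fun _ _ _ => rfl⟩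
  | _, _, _, .pair M N, D => ⟨fun ρ x => ((M.sem D).app ρ x, (N.sem D).app ρ x),
      fun σ ρ x => Prod.ext ((M.sem D).nat σ ρ x) ((N.sem D).nat σ ρ x)⟩
  | _, _, _, .fst M, D => ⟨fun ρ x => ((M.sem D).app ρ x).1,
      fun σ ρ x => congrArg Prod.fst ((M.sem D).nat σ ρ x)⟩
  | _, _, _, .snd M, D => ⟨fun ρ x => ((M.sem D).app ρ x).2,
      fun σ ρ x => congrArg Prod.snd ((M.sem D).nat σ ρ x)⟩
  | _, _, _, .lam hh M, D => CHom.lam (M.sem D)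
  | _, _, _, .app (A := A) (B := B) hh M V, D =>
      CHom.ap (X := VTy.sem S A) (Y := (CTy.sem S B).fam D) (M.sem D) V.sem
  | _, _, _, .cop o hA hB V, D =>
      VHom.toCHom
        ⟨fun ρ => (CTy.repOf hB).reflect (Psh.cop o ((VTy.repOf hA).reify (V.sem.app ρ))),
        fun σ ρ => by
          rw [CRep.act_reflect, Psh.act_cop, VRep.act_reify, V.sem.nat]⟩ D
  | _, _, _, .kop o hA hB hC V M, D =>
      ⟨fun ρ x => (CTy.repOf hC).reflect (Psh.kop o ((VTy.repOf hA).reify (V.sem.app ρ))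
          ((CTy.repOf hB).reify ((M.sem D).app ρ x))),
        fun σ ρ x => by
          rw [CRep.act_reflect, Psh.act_kop, VRep.act_reify, V.sem.nat, CRep.act_reify,
            (M.sem D).nat]⟩
end

end Interpretation

-- Soundness of the presheaf interpretation

section Soundness

variable {S : Signature.{u}} {h : Bool}

theorem VHom.toCHom_congr {Γ Γ' : List (S.VT h)} {P : CPsh S} {f : VHom Γ (P.fam none)}
    {g : VHom Γ' (P.fam none)} {G : List (S.VT false)} {ρ : (Env S Γ).obj G}
    {ρ' : (Env S Γ').obj G} (e : f.app ρ = g.app ρ') :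
    ∀ (D : Option (S.CT false)) (x : (Hole S (none : Option (S.CT h)) D).obj G),
      (f.toCHom D).app ρ x = (g.toCHom D).app ρ' x
  | none, _ => e
  | some _, x => x.elim

mutual
-- The environments are related by a pointwise equation instead of one being computed from the
-- other. Under a binder the equation then only has to be checked for the new variable and for the
-- old ones.
theorem Val.sem_ren : ∀ {Γ Γ' : List (S.VT h)} {A : S.VT h} (V : Val S h Γ A) (r : Ren Γ Γ')
    {G : List (S.VT false)} {ρ : (Env S Γ').obj G} {ρ' : (Env S Γ).obj G},
    (∀ ⦃B : S.VT h⦄ (x : Var Γ B), ρ (r x) = ρ' x) → (V.ren r).sem.app ρ = V.sem.app ρ'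
  | _, _, _, .var x, r, _, _, _, e => e x
  | _, _, _, .unit, r, _, _, _, e => rfl
  | _, _, _, .pair V W, r, _, _, _, e => congrArg₂ Prod.mk (V.sem_ren r e) (W.sem_ren r e)
  | _, _, _, .fst V, r, _, _, _, e => congrArg Prod.fst (V.sem_ren r e)
  | _, _, _, .snd V, r, _, _, _, e => congrArg Prod.snd (V.sem_ren r e)
  | _, _, _, .thunk M, r, _, _, _, e => M.sem_ren r e none _
  | _, _, _, .op o hA hB V, r, _, _, _, e =>
      congrArg (fun v => (VTy.repOf hB).reflect (Psh.vop o ((VTy.repOf hA).reify v)))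
        (V.sem_ren r e)

theorem Cmp.sem_ren : ∀ {Γ Γ' : List (S.VT h)} {Δ : Option (S.CT h)} {C : S.CT h}
    (M : Cmp S h Γ Δ C) (r : Ren Γ Γ') {G : List (S.VT false)} {ρ : (Env S Γ').obj G}
    {ρ' : (Env S Γ).obj G}, (∀ ⦃B : S.VT h⦄ (x : Var Γ B), ρ (r x) = ρ' x) →
    ∀ (D : Option (S.CT false)) (x : (Hole S Δ D).obj G),
      ((M.ren r).sem D).app ρ x = (M.sem D).app ρ' x
  | _, _, _, _, .hole, r, _, _, _, e, D, x => rfl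
  | _, _, _, _, .force V, r, _, _, _, e, D, x => VHom.toCHom_congr (V.sem_ren r e) D x
  | _, _, _, _, .ret (A := A) V, r, _, _, _, e, D, x =>
      VHom.toCHom_congr (P := CPsh.free (VTy.sem S A)) (congrArg Returner.pure (V.sem_ren r e)) D x
  | _, _, _, _, .to (B := B) M N, r, _, _, _, e, D, x =>
      congrArg₂ (CTy.sem S B).bind (M.sem_ren r e D x) (Exp.ext_app fun σ a =>
        N.sem_ren r.lift (fun _ y => by
          cases y with
          | zero => rfl
          | succ y => exact congrArg (Psh.act _ σ) (e y)) none _)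
  | _, _, _, _, .top, r, _, _, _, e, D, x => rfl
  | _, _, _, _, .pair M N, r, _, _, _, e, D, x =>
      congrArg₂ Prod.mk (M.sem_ren r e D x) (N.sem_ren r e D x)
  | _, _, _, _, .fst M, r, _, _, _, e, D, x => congrArg Prod.fst (M.sem_ren r e D x)
  | _, _, _, _, .snd M, r, _, _, _, e, D, x => congrArg Prod.snd (M.sem_ren r e D x)
  | _, _, _, _, .lam hh M, r, _, _, _, e, D, x =>
      Exp.ext_app fun σ a => M.sem_ren r.lift (fun _ y => by
          cases y with
          | zero => rfl
          | succ y => exact congrArg (Psh.act _ σ) (e y)) D _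
  | _, _, _, _, .app (A := A) (B := B) hh M V, r, _, _, _, e, D, x =>
      congrArg₂ (fun (f : Exp (VTy.sem S A) ((CTy.sem S B).fam D) _) v => f.app Subst.id v)
        (M.sem_ren r e D x) (V.sem_ren r e)
  | _, _, _, _, .cop o hA hB V, r, _, _, _, e, D, x =>
      VHom.toCHom_congr
        (congrArg (fun v => (CTy.repOf hB).reflect (Psh.cop o ((VTy.repOf hA).reify v)))
          (V.sem_ren r e)) D x
  | _, _, _, _, .kop o hA hB hC V M, r, _, _, _, e, D, x =>
      congrArg₂ (fun v m => (CTy.repOf hC).reflect (Psh.kop o ((VTy.repOf hA).reify v)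
        ((CTy.repOf hB).reify m))) (V.sem_ren r e) (M.sem_ren r e D x)
end

/-- The step under a binder for the substitution lemma. A lifted substitution weakens its values, so
the renaming lemma is needed first; the move to a later context is naturality of the interpretation.
-/
theorem Subst.sem_lift {Γ Γ' : List (S.VT h)} {A : S.VT h} {s : Subst S h Γ Γ'}
    {G G' : List (S.VT false)} {ρ : (Env S Γ').obj G} {ρ' : (Env S Γ).obj G}
    (e : ∀ ⦃B : S.VT h⦄ (x : Var Γ B), (s x).sem.app ρ = ρ' x) (σ : Subst S false G G')
    (a : (VTy.sem S A).obj G') ⦃B : S.VT h⦄ (x : Var (A :: Γ) B) :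
    (Subst.lift s x).sem.app (Env.cons a ((Env S Γ').act σ ρ)) =
      Env.cons a ((Env S Γ).act σ ρ') x := by
  cases x with
  | zero => rfl
  | succ x =>
    refine ((s x).sem_ren Ren.wk (fun _ _ => rfl)).trans ?_
    exact ((s x).sem.nat σ ρ).symm.trans (congrArg (Psh.act _ σ) (e x))

mutual
-- Substitution is interpreted by composition. This is what turns the β-laws of `to` and of
-- functions into equations of the model.
theorem Val.sem_sub : ∀ {Γ Γ' : List (S.VT h)} {A : S.VT h} (V : Val S h Γ A)
    (s : Subst S h Γ Γ') {G : List (S.VT false)} {ρ : (Env S Γ').obj G} {ρ' : (Env S Γ).obj G},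
    (∀ ⦃B : S.VT h⦄ (x : Var Γ B), (s x).sem.app ρ = ρ' x) → (V.sub s).sem.app ρ = V.sem.app ρ'
  | _, _, _, .var x, s, _, _, _, e => e x
  | _, _, _, .unit, s, _, _, _, e => rfl
  | _, _, _, .pair V W, s, _, _, _, e => congrArg₂ Prod.mk (V.sem_sub s e) (W.sem_sub s e)
  | _, _, _, .fst V, s, _, _, _, e => congrArg Prod.fst (V.sem_sub s e)
  | _, _, _, .snd V, s, _, _, _, e => congrArg Prod.snd (V.sem_sub s e)
  | _, _, _, .thunk M, s, _, _, _, e => M.sem_sub s e none _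
  | _, _, _, .op o hA hB V, s, _, _, _, e =>
      congrArg (fun v => (VTy.repOf hB).reflect (Psh.vop o ((VTy.repOf hA).reify v)))
        (V.sem_sub s e)

theorem Cmp.sem_sub : ∀ {Γ Γ' : List (S.VT h)} {Δ : Option (S.CT h)} {C : S.CT h}
    (M : Cmp S h Γ Δ C) (s : Subst S h Γ Γ') {G : List (S.VT false)} {ρ : (Env S Γ').obj G}
    {ρ' : (Env S Γ).obj G}, (∀ ⦃B : S.VT h⦄ (x : Var Γ B), (s x).sem.app ρ = ρ' x) →
    ∀ (D : Option (S.CT false)) (x : (Hole S Δ D).obj G),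
      ((M.sub s).sem D).app ρ x = (M.sem D).app ρ' x
  | _, _, _, _, .hole, s, _, _, _, e, D, x => rfl
  | _, _, _, _, .force V, s, _, _, _, e, D, x => VHom.toCHom_congr (V.sem_sub s e) D x
  | _, _, _, _, .ret (A := A) V, s, _, _, _, e, D, x =>
      VHom.toCHom_congr (P := CPsh.free (VTy.sem S A)) (congrArg Returner.pure (V.sem_sub s e)) D x
  | _, _, _, _, .to (B := B) M N, s, _, _, _, e, D, x =>
      congrArg₂ (CTy.sem S B).bind (M.sem_sub s e D x) (Exp.ext_app fun σ a =>
        N.sem_sub (Subst.lift s) (Subst.sem_lift e σ a) none _)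
  | _, _, _, _, .top, s, _, _, _, e, D, x => rfl
  | _, _, _, _, .pair M N, s, _, _, _, e, D, x =>
      congrArg₂ Prod.mk (M.sem_sub s e D x) (N.sem_sub s e D x)
  | _, _, _, _, .fst M, s, _, _, _, e, D, x => congrArg Prod.fst (M.sem_sub s e D x)
  | _, _, _, _, .snd M, s, _, _, _, e, D, x => congrArg Prod.snd (M.sem_sub s e D x)
  | _, _, _, _, .lam hh M, s, _, _, _, e, D, x =>
      Exp.ext_app fun σ a => M.sem_sub (Subst.lift s) (Subst.sem_lift e σ a) D _
  | _, _, _, _, .app (A := A) (B := B) hh M V, s, _, _, _, e, D, x =>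
      congrArg₂ (fun (f : Exp (VTy.sem S A) ((CTy.sem S B).fam D) _) v => f.app Subst.id v)
        (M.sem_sub s e D x) (V.sem_sub s e)
  | _, _, _, _, .cop o hA hB V, s, _, _, _, e, D, x =>
      VHom.toCHom_congr
        (congrArg (fun v => (CTy.repOf hB).reflect (Psh.cop o ((VTy.repOf hA).reify v)))
          (V.sem_sub s e)) D x
  | _, _, _, _, .kop o hA hB hC V M, s, _, _, _, e, D, x =>
      congrArg₂ (fun v m => (CTy.repOf hC).reflect (Psh.kop o ((VTy.repOf hA).reify v)
        ((CTy.repOf hB).reify m))) (V.sem_sub s e) (M.sem_sub s e D x)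
end

theorem Cmp.sem_cons {Γ : List (S.VT h)} {Δ : Option (S.CT h)} {A : S.VT h} {C : S.CT h}
    (M : Cmp S h (A :: Γ) Δ C) (V : Val S h Γ A) {G : List (S.VT false)} (ρ : (Env S Γ).obj G)
    (D : Option (S.CT false)) (x : (Hole S Δ D).obj G) :
    ((M.sub (Subst.cons V Subst.id)).sem D).app ρ x =
      (M.sem D).app (Env.cons (V.sem.app ρ) ρ) x :=
  M.sem_sub _ (fun _ y => by cases y <;> rfl) D x

/-- The interpretation of fillings. -/
def Fill.sem {Γ : List (S.VT h)} {Θ Δ : Option (S.CT h)} (f : Fill S h Γ Θ Δ)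
    (D : Option (S.CT false)) {G : List (S.VT false)} (ρ : (Env S Γ).obj G)
    (x : (Hole S Δ D).obj G) : (Hole S Θ D).obj G :=
  match f with
  | .nil => x
  | .put M => (M.sem D).app ρ x

theorem Fill.sem_wk {Γ : List (S.VT h)} {A : S.VT h} {Θ Δ : Option (S.CT h)}
    (f : Fill S h Γ Θ Δ) (D : Option (S.CT false)) {G G' : List (S.VT false)}
    (ρ : (Env S Γ).obj G) (x : (Hole S Δ D).obj G) (σ : Subst S false G G')
    (a : (VTy.sem S A).obj G') :
    (f.ren Ren.wk).sem D (Env.cons a ((Env S Γ).act σ ρ)) ((Hole S Δ D).act σ x) =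
      (Hole S Θ D).act σ (f.sem D ρ x) := by
  cases f with
  | nil => rfl
  | put M => exact (M.sem_ren _ (fun _ _ => rfl) D _).trans ((M.sem D).nat σ ρ x).symm

/-- Plugging is interpreted by composition in the hole argument. A hole-free term has only the
trivial filling, which changes nothing. -/
theorem Cmp.sem_fill : ∀ {Γ : List (S.VT h)} {Θ Δ : Option (S.CT h)} {C : S.CT h}
    (K : Cmp S h Γ Θ C) (f : Fill S h Γ Θ Δ) (D : Option (S.CT false)) {G : List (S.VT false)}
    (ρ : (Env S Γ).obj G) (x : (Hole S Δ D).obj G),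
    ((K.fill f).sem D).app ρ x = (K.sem D).app ρ (f.sem D ρ x)
  | _, _, _, _, .hole, .put M, D, _, ρ, x => rfl
  | _, _, _, _, .force V, .nil, D, _, ρ, x => rfl
  | _, _, _, _, .ret V, .nil, D, _, ρ, x => rfl
  | _, _, _, _, .to (B := B) M N, f, D, _, ρ, x => by
      simp only [Cmp.fill]
      exact congrArg (fun m => (CTy.sem S B).bind m _) (M.sem_fill f D ρ x)
  | _, _, _, _, .top, f, D, _, ρ, x => by
      simp only [Cmp.fill]
      rfl
  | _, _, _, _, .pair M N, f, D, _, ρ, x => by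
      simp only [Cmp.fill]
      exact congrArg₂ Prod.mk (M.sem_fill f D ρ x) (N.sem_fill f D ρ x)
  | _, _, _, _, .fst M, f, D, _, ρ, x => by
      simp only [Cmp.fill]
      exact congrArg Prod.fst (M.sem_fill f D ρ x)
  | _, _, _, _, .snd M, f, D, _, ρ, x => by
      simp only [Cmp.fill]
      exact congrArg Prod.snd (M.sem_fill f D ρ x)
  | _, _, _, _, .lam hh M, f, D, _, ρ, x => by
      simp only [Cmp.fill]
      refine Exp.ext_app fun σ a => ?_
      exact (M.sem_fill _ D _ _).trans (congrArg ((M.sem D).app _) (f.sem_wk D ρ x σ a))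
  | _, _, _, _, .app (A := A) (B := B) hh M V, f, D, _, ρ, x => by
      simp only [Cmp.fill]
      exact congrArg (fun (f : Exp (VTy.sem S A) ((CTy.sem S B).fam D) _) => f.app Subst.id _)
        (M.sem_fill f D ρ x)
  | _, _, _, _, .cop o hA hB V, .nil, D, _, ρ, x => rfl
  | _, _, _, _, .kop o hA hB hC V M, f, D, _, ρ, x => by
      simp only [Cmp.fill]
      exact congrArg (fun m => (CTy.repOf hC).reflect (Psh.kop o _ ((CTy.repOf hB).reify m)))
        (M.sem_fill f D ρ x)

/-- A natural map applied after a family. -/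
def CHom.after {Γ : List (S.VT h)} {H X Y : Psh S} (f : CHom Γ H Y) {G : List (S.VT false)}
    (ρ : (Env S Γ).obj G) (k : Exp X H G) : Exp X Y G where
  app σ x := f.app ((Env S Γ).act σ ρ) (k.app σ x)
  nat σ τ x := by rw [f.nat, k.nat, Psh.act_act]

/-- The family of terms represented by a family of elements. -/
def CRep.reifyExp {B : S.CT false} {P : CPsh S} (R : CRep B P) {X : Psh S}
    {G : List (S.VT false)} (k : Exp X (P.fam none) G) : Exp X (Psh.cmp none B) G where
  app σ x := R.reify (k.app σ x)
  nat σ τ x := by rw [R.act_reify, k.nat]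

/-- Stacks commute with sequencing. -/
theorem Cmp.sem_bind : ∀ {Γ : List (S.VT h)} {B C : S.CT h} (K : Cmp S h Γ (some B) C)
    (D : Option (S.CT false)) {G : List (S.VT false)} (ρ : (Env S Γ).obj G) {X : Psh S}
    (m : Returner X D G) (k : Exp X ((CTy.sem S B).fam none) G),
    (K.sem D).app ρ ((CTy.sem S B).bind m k) =
      (CTy.sem S C).bind m ((K.sem none).after ρ k)
  | _, _, _, .hole, D, _, ρ, _, m, k => rfl
  | _, _, _, .to (B := B) M N, D, _, ρ, _, m, k => by
      -- By induction `M` commutes with sequencing, which in the interpretation of `F` is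
      -- `Returner.bind`. What is left is associativity.
      refine (congrArg (fun q => (CTy.sem S B).bind q _) (M.sem_bind D ρ m k)).trans ?_
      refine (CTy.sem S B).bind_bind m _ _ _ fun σ x => ?_
      exact congrArg ((CTy.sem S B).bind _) ((N.sem none).lam.nat σ ρ _).symm
  | _, _, _, .top, D, _, ρ, _, m, k => rfl
  | _, _, _, .pair M N, D, _, ρ, _, m, k =>
      congrArg₂ Prod.mk (M.sem_bind D ρ m k) (N.sem_bind D ρ m k)
  | _, _, _, .fst M, D, _, ρ, _, m, k => congrArg Prod.fst (M.sem_bind D ρ m k)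
  | _, _, _, .snd M, D, _, ρ, _, m, k => congrArg Prod.snd (M.sem_bind D ρ m k)
  | _, B, _, .lam (B := C) hh M, D, _, ρ, _, m, k => by
      refine Exp.ext_app fun σ a => ?_
      -- The body receives the hole argument restricted along `σ`. Restriction commutes with
      -- sequencing, so the induction hypothesis applies in the later context.
      refine (congrArg ((M.sem D).app _) ((CTy.sem S B).act_bind σ m k)).trans ?_
      refine (M.sem_bind D _ _ _).trans ?_
      refine congrArg ((CTy.sem S C).bind _) (Exp.ext_app fun τ x => ?_)
      refine congrArg₂ (M.sem none).app ?_ (Psh.act_id _ _).symm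
      rw [Env.act_cons, Psh.act_act, Psh.act_id]
  | _, _, _, .app (A := A) (B := C) hh M V, D, _, ρ, _, m, k => by
      refine (congrArg (fun (f : Exp (VTy.sem S A) ((CTy.sem S C).fam D) _) => f.app Subst.id _)
        (M.sem_bind D ρ m k)).trans ?_
      refine congrArg ((CTy.sem S C).bind m) (Exp.ext_app fun σ x => ?_)
      exact congrArg (Exp.app (X := VTy.sem S A) (Y := (CTy.sem S C).fam none) _ Subst.id)
        (V.sem.nat σ ρ)
  | _, _, _, .kop o hA hB hC V M, D, _, ρ, _, m, k => by
      refine (congrArg (fun q => (CTy.repOf hC).reflect (Psh.kop o _ ((CTy.repOf hB).reify q)))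
        (M.sem_bind D ρ m k)).trans ?_
      rw [← (CTy.repOf hC).reflect_reify ((CTy.sem S _).bind m _)]
      refine congrArg (CTy.repOf hC).reflect ?_
      -- At both first-order types sequencing becomes running `m`. The operation is then a stack
      -- applied after `m`, which `m.plug` moves into the continuation.
      rw [CRep.reify_bind _ m _ (CRep.reifyExp _ _) (fun _ _ => rfl),
        CRep.reify_bind _ m _ (CRep.reifyExp _ _) (fun _ _ => rfl), Psh.kop_plug, m.plug]
      refine congrArg (m.app _ _) (Exp.ext_app fun σ x => ?_)
      refine Eq.trans ?_ (CRep.reify_reflect _ _).symm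
      change Psh.plug (Psh.act _ _ _) _ = Psh.kop o _ _
      rw [Psh.act_kop, VRep.act_reify, V.sem.nat]
      exact (Psh.kop_plug o _ _).symm

/-- The returned argument, as a family. -/
def Exp.pure (X : Psh S) (G : List (S.VT false)) : Exp X (X.returner none) G where
  app _ x := Returner.pure x
  nat _ τ x := Returner.act_pure τ x

/-- Hole-free terms only have to be compared at `D = none`; over a hole type there is nothing to
plug in. -/
theorem VHom.toCHom_ext {Γ : List (S.VT h)} {P : CPsh S} {f : VHom Γ (P.fam none)}
    {k : ∀ D, CHom Γ (Hole S (none : Option (S.CT h)) D) (P.fam D)} {G : List (S.VT false)}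
    {ρ : (Env S Γ).obj G} (e : f.app ρ = (k none).app ρ PUnit.unit) :
    ∀ (D : Option (S.CT false)) (x : (Hole S (none : Option (S.CT h)) D).obj G),
      (f.toCHom D).app ρ x = (k D).app ρ x
  | none, _ => e
  | some _, x => x.elim

mutual
/-- Provably equal values have the same interpretation. -/
theorem VEq.sem : ∀ {Γ : List (S.VT h)} {A : S.VT h} {V W : Val S h Γ A}, VEq V W →
    ∀ {G : List (S.VT false)} (ρ : (Env S Γ).obj G), V.sem.app ρ = W.sem.app ρ
  | _, _, _, _, .refl V, _, ρ => rfl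
  | _, _, _, _, .symm p, _, ρ => (p.sem ρ).symm
  | _, _, _, _, .trans p q, _, ρ => (p.sem ρ).trans (q.sem ρ)
  | _, _, _, _, .pair p q, _, ρ => congrArg₂ Prod.mk (p.sem ρ) (q.sem ρ)
  | _, _, _, _, .fst p, _, ρ => congrArg Prod.fst (p.sem ρ)
  | _, _, _, _, .snd p, _, ρ => congrArg Prod.snd (p.sem ρ)
  | _, _, _, _, .thunk p, _, ρ => p.sem none ρ _
  | _, _, _, _, .op o hA hB p, _, ρ =>
      congrArg (fun v => (VTy.repOf hB).reflect (Psh.vop o ((VTy.repOf hA).reify v))) (p.sem ρ)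
  | _, _, _, _, .unit_eta V, _, ρ => rfl
  | _, _, _, _, .fst_beta V W, _, ρ => rfl
  | _, _, _, _, .snd_beta V W, _, ρ => rfl
  | _, _, _, _, .pair_eta V, _, ρ => rfl
  | _, _, _, _, .thunk_eta V, _, ρ => rfl

/-- Provably equal computations and stacks have the same interpretation. -/
theorem CEq.sem : ∀ {Γ : List (S.VT h)} {Δ : Option (S.CT h)} {C : S.CT h}
    {M N : Cmp S h Γ Δ C}, CEq M N → ∀ (D : Option (S.CT false)) {G : List (S.VT false)}
    (ρ : (Env S Γ).obj G) (x : (Hole S Δ D).obj G), (M.sem D).app ρ x = (N.sem D).app ρ x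
  | _, _, _, _, _, .refl V, D, _, ρ, x => rfl
  | _, _, _, _, _, .symm p, D, _, ρ, x => (p.sem D ρ x).symm
  | _, _, _, _, _, .trans p q, D, _, ρ, x => (p.sem D ρ x).trans (q.sem D ρ x)
  | _, _, _, _, _, .force p, D, _, ρ, x => VHom.toCHom_congr (p.sem ρ) D x
  | _, _, _, _, _, .ret (A := A) p, D, _, ρ, x =>
      VHom.toCHom_congr (P := CPsh.free (VTy.sem S A)) (congrArg Returner.pure (p.sem ρ)) D x
  | _, _, _, _, _, .to (B := B) p q, D, _, ρ, x =>
      congrArg₂ (CTy.sem S B).bind (p.sem D ρ x) (Exp.ext_app fun σ a => q.sem none _ _)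
  | _, _, _, _, _, .pair p q, D, _, ρ, x => congrArg₂ Prod.mk (p.sem D ρ x) (q.sem D ρ x)
  | _, _, _, _, _, .fst p, D, _, ρ, x => congrArg Prod.fst (p.sem D ρ x)
  | _, _, _, _, _, .snd p, D, _, ρ, x => congrArg Prod.snd (p.sem D ρ x)
  | _, _, _, _, _, .lam hh p, D, _, ρ, x => Exp.ext_app fun σ a => p.sem D _ _
  | _, _, _, _, _, .app (A := A) (B := B) hh p q, D, _, ρ, x =>
      congrArg₂ (fun (f : Exp (VTy.sem S A) ((CTy.sem S B).fam D) _) v => f.app Subst.id v)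
        (p.sem D ρ x) (q.sem ρ)
  | _, _, _, _, _, .cop o hA hB p, D, _, ρ, x =>
      VHom.toCHom_congr
        (congrArg (fun v => (CTy.repOf hB).reflect (Psh.cop o ((VTy.repOf hA).reify v)))
          (p.sem ρ)) D x
  | _, _, _, _, _, .kop o hA hB hC p q, D, _, ρ, x =>
      congrArg₂ (fun v m => (CTy.repOf hC).reflect (Psh.kop o ((VTy.repOf hA).reify v)
        ((CTy.repOf hB).reify m))) (p.sem ρ) (q.sem D ρ x)
  | _, _, _, _, _, .force_beta M, D, _, ρ, x => VHom.toCHom_ext (k := M.sem) rfl D x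
  | _, _, _, _, _, .to_beta (A := A) (B := B) V N, D, _, ρ, x => by
      cases D with
      | some _ => exact x.elim
      | none =>
        refine ((CTy.sem S B).pure_bind _ _).trans (Eq.trans ?_ (N.sem_cons V ρ none x).symm)
        exact congrArg (fun ξ => (N.sem none).app (Env.cons _ ξ) _) (Psh.act_id _ ρ)
  | _, _, _, _, _, .to_eta (A := A) (B := B) K M, D, G, ρ, x => by
      refine (K.sem_fill _ D ρ x).trans ?_
      -- The interpretation of `M` is rewritten as itself followed by `return`. Since the stack `K`
      -- commutes with sequencing, it moves past `M` and acts on the returned variable, which is the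
      -- right-hand side of the η-law.
      refine (congrArg ((K.sem D).app ρ) (Returner.bind_pure (X := VTy.sem S A) ((M.sem D).app ρ x)
        (Exp.pure _ _) (fun _ _ => rfl)).symm).trans ?_
      refine (K.sem_bind D ρ ((M.sem D).app ρ x) (Exp.pure (VTy.sem S A) G)).trans ?_
      refine congrArg ((CTy.sem S B).bind _) (Exp.ext_app fun σ a => ?_)
      refine Eq.trans ?_ ((K.ren Ren.wk).sem_fill _ none _ _).symm
      exact (K.sem_ren Ren.wk (ρ := Env.cons a ((Env S _).act σ ρ)) (fun _ _ => rfl) none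
        (Returner.pure a)).symm
  | _, _, _, _, _, .top_eta M, D, _, ρ, x => rfl
  | _, _, _, _, _, .fst_beta M N, D, _, ρ, x => rfl
  | _, _, _, _, _, .snd_beta M N, D, _, ρ, x => rfl
  | _, _, _, _, _, .pair_eta M, D, _, ρ, x => rfl
  | _, _, _, _, _, .app_beta hh M V, D, _, ρ, x => by
      refine Eq.trans ?_ (M.sem_cons V ρ D x).symm
      exact congrArg₂ (fun ξ y => (M.sem D).app (Env.cons _ ξ) y) (Psh.act_id _ ρ) (Psh.act_id _ x)
  | _, _, _, _, _, .lam_eta (A := A) (B := B) hh M, D, _, ρ, x => by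
      refine Exp.ext_app (X := VTy.sem S A) (Y := (CTy.sem S B).fam D) fun σ a => ?_
      refine Eq.trans ?_ (congrArg (fun (f : Exp (VTy.sem S A) ((CTy.sem S B).fam D) _) =>
        f.app Subst.id a) (((M.sem D).nat σ ρ x).trans
          (M.sem_ren Ren.wk (ρ := Env.cons a ((Env S _).act σ ρ)) (fun _ _ => rfl) D _).symm))
      exact (Exp.act_app_id _ _ _).symm
end

end Soundness

/-! ### Conservativity -/

section Conservativity

variable {S : Signature.{u}}

/-- The embedding of the first-order language. -/
theorem foEmb : false = true → true = true := fun _ => rfl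

/-- The environment `ρ` is represented by the substitution `σ`. -/
def EnvRep {Γ G : List (S.VT false)} (ρ : (Env S (Γ.map (VTy.map foEmb))).obj G)
    (σ : Subst S false Γ G) : Prop :=
  ∀ ⦃A : S.VT false⦄ (x : Var Γ A), (VTy.rep S true A).reify (ρ (x.map (VTy.map foEmb))) =
    (σ x).cls

/-- The bound variable is sent to the generic element, the reflection of the last variable, so that
representation by a substitution survives going under a binder. -/
theorem EnvRep.lift {Γ G : List (S.VT false)} {A : S.VT false}
    {ρ : (Env S (Γ.map (VTy.map foEmb))).obj G} {σ : Subst S false Γ G} (r : EnvRep ρ σ) :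
    EnvRep (Γ := A :: Γ) (G := A :: G)
      (Env.cons ((VTy.rep S true A).reflect Psh.last) ((Env S _).act Subst.wk ρ))
      (Subst.lift σ) := by
  intro B x
  cases x with
  | zero => exact VRep.reify_reflect _ _
  | succ x =>
    refine ((VTy.rep S true B).act_reify Subst.wk _).symm.trans ?_
    refine (congrArg (Psh.act _ Subst.wk) (r x)).trans ?_
    exact congrArg Val.cls (Val.ren_eq_sub _ _).symm

/-- The generic environment: every variable of the context stands for itself. It is built by
repeated lifting, since the lift of the identity is the identity. -/
theorem EnvRep.exists_id : ∀ Γ : List (S.VT false),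
    ∃ ρ : (Env S (Γ.map (VTy.map foEmb))).obj Γ, EnvRep ρ (Subst.id (Γ := Γ))
  | [] => ⟨fun _ x => (nomatch x), fun _ x => (nomatch x)⟩
  | A :: Γ => by
      obtain ⟨ρ, r⟩ := EnvRep.exists_id Γ
      have r' := r.lift (A := A)
      rw [Subst.lift_id] at r'
      exact ⟨_, r'⟩

/-- What is put in the hole is represented by a filling. -/
def FillRep {G : List (S.VT false)} {Δ D : Option (S.CT false)}
    (x : (Hole S (Δ.map (CTy.map foEmb)) D).obj G) (f : Fill S false G Δ D) : Prop :=
  match Δ, f, x with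
  | _, .nil, _ => True
  | _, .put (B := B) M, x => (CTy.rep S true B).reify x = M.cls

/-- The isomorphism for `F` read at a general continuation: a represented returner acts as its
reified term plugged into the stack of that continuation. This computes the interpretation of `to`.
-/
theorem CRep.app_F {A : S.VT false} {X : Psh S} (R : VRep A X) {G : List (S.VT false)}
    {D : Option (S.CT false)} {E : S.CT false} (m : Returner X D G)
    (k : Exp X (Psh.cmp none E) G) :
    m.app E Subst.id k = Psh.plug (R.stack k) ((CRep.F R).reify m) := by
  have e := congrArg (fun q : Returner X D G => q.app E Subst.id k)
    ((CRep.F R).reflect_reify m).symm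
  refine e.trans ?_
  exact congrArg (Psh.plug _) (Psh.act_id _ _)

mutual
/-- The interpretation of a first-order value is represented by that value. -/
theorem Val.reify_sem : ∀ {Γ : List (S.VT false)} {A : S.VT false} (V : Val S false Γ A)
    {G : List (S.VT false)} {ρ : (Env S (Γ.map (VTy.map foEmb))).obj G} {σ : Subst S false Γ G},
    EnvRep ρ σ → (VTy.rep S true A).reify ((V.map foEmb).sem.app ρ) = (V.sub σ).cls
  | _, _, .var x, _, _, _, r => r x
  | _, _, .unit, _, _, _, r => rfl
  | _, _, .pair V W, _, _, _, r => congrArg₂ Psh.vpair (V.reify_sem r) (W.reify_sem r)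
  | _, _, .fst V, _, _, _, r => (Psh.vpair_fst _ _).symm.trans (congrArg Psh.vfst (V.reify_sem r))
  | _, _, .snd V, _, _, _, r => (Psh.vpair_snd _ _).symm.trans (congrArg Psh.vsnd (V.reify_sem r))
  | _, _, .thunk M, _, _, σ, r =>
      -- A thunked computation has no hole, so it is taken at the trivial filling, which
      -- `Cmp.fill_id` removes.
      congrArg Psh.thunk ((M.reify_sem r none PUnit.unit .nil trivial).trans
        (congrArg Cmp.cls (Cmp.fill_id (M.sub σ))))
  | _, _, .op o hA hB V, _, _, _, r => by
      have e := V.reify_sem r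
      obtain rfl := hA.trans (VTy.ofFO_false _)
      obtain rfl := hB.trans (VTy.ofFO_false _)
      exact (VRep.reify_reflect _ _).trans (congrArg (Psh.vop o) e)

/-- The interpretation of a first-order computation or stack is represented by that computation
or stack. -/
theorem Cmp.reify_sem : ∀ {Γ : List (S.VT false)} {Δ : Option (S.CT false)} {C : S.CT false}
    (M : Cmp S false Γ Δ C) {G : List (S.VT false)}
    {ρ : (Env S (Γ.map (VTy.map foEmb))).obj G} {σ : Subst S false Γ G}, EnvRep ρ σ →
    ∀ (D : Option (S.CT false)) (x : (Hole S (Δ.map (CTy.map foEmb)) D).obj G)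
      (f : Fill S false G Δ D), FillRep x f →
      (CTy.rep S true C).reify (((M.map foEmb).sem D).app ρ x) = ((M.sub σ).fill f).cls
  | _, _, _, .hole, _, _, _, r, D, x, .put M, e => e
  | _, _, _, .force V, _, _, _, r, none, x, .nil, e =>
      (Psh.force_thunk _).symm.trans (congrArg Psh.force (V.reify_sem r))
  | _, _, _, .ret V, _, _, _, r, none, x, .nil, e => by
      refine Eq.trans ?_ (congrArg Psh.ret (V.reify_sem r))
      exact congrArg (fun q => Psh.ret ((VTy.rep S true _).reify q)) (Psh.act_id _ _)
  | _, _, _, .to (A := A) (B := B) M N, G, ρ, σ, r, D, x, f, e => by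
      -- Reified sequencing runs the returner of `M` at result type `B`, and `CRep.app_F` turns that
      -- into plugging the term of `M` into the stack of the continuation.
      refine ((CTy.rep S true B).reify_bind _ _ (CRep.reifyExp _ _) (fun _ _ => rfl)).trans ?_
      refine (CRep.app_F (VTy.rep S true A) _ _).trans ?_
      refine (congrArg (Psh.plug _) (M.reify_sem r D x f e)).trans ?_
      -- The stack of the continuation is read off at the generic element, that is, in the lifted
      -- environment, where the induction hypothesis gives `N` under the lifted substitution.
      have e' := (N.reify_sem (r.lift (A := A)) none PUnit.unit .nil trivial).trans
        (congrArg Cmp.cls (Cmp.fill_id _))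
      refine (congrArg (fun n => Psh.plug (Psh.toStack n) _) e').trans ?_
      simp only [Cmp.sub, Cmp.fill]
      rfl
  | _, _, _, .top, _, _, _, r, D, x, f, e => (Psh.eq_top _).symm
  | _, _, _, .pair M N, _, _, _, r, D, x, f, e => by
      simp only [Cmp.sub, Cmp.fill]
      exact congrArg₂ Psh.cpair (M.reify_sem r D x f e) (N.reify_sem r D x f e)
  | _, _, _, .fst (B := B) (C := C) M, _, _, _, r, D, x, f, e => by
      simp only [Cmp.sub, Cmp.fill]
      refine Eq.trans ?_ (congrArg Psh.cfst (M.reify_sem r D x f e))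
      exact (Psh.cpair_fst _ _).symm
  | _, _, _, .snd (B := B) (C := C) M, _, _, _, r, D, x, f, e => by
      simp only [Cmp.sub, Cmp.fill]
      refine Eq.trans ?_ (congrArg Psh.csnd (M.reify_sem r D x f e))
      exact (Psh.cpair_snd _ _).symm
  | _, _, _, .lam hh M, _, _, _, r, D, x, f, e => nomatch hh
  | _, _, _, .app hh M V, _, _, _, r, D, x, f, e => nomatch hh
  | _, _, _, .cop o hA hB V, _, _, _, r, none, x, .nil, e => by
      have e := V.reify_sem r
      obtain rfl := hA.trans (VTy.ofFO_false _)
      obtain rfl := hB.trans (CTy.ofFO_false _)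
      exact (CRep.reify_reflect _ _).trans (congrArg (Psh.cop o) e)
  | _, _, _, .kop o hA hB hC V M, _, _, _, r, D, x, f, e => by
      have e₁ := V.reify_sem r
      have e₂ := M.reify_sem r D x f e
      obtain rfl := hA.trans (VTy.ofFO_false _)
      obtain rfl := hB.trans (CTy.ofFO_false _)
      obtain rfl := hC.trans (CTy.ofFO_false _)
      simp only [Cmp.sub, Cmp.fill]
      exact (CRep.reify_reflect _ _).trans (congrArg₂ (Psh.kop o) e₁ e₂)
end

/-- First-order values that are equal in the language with function types are equal in the
first-order language. -/
theorem VEq.of_map {Γ : List (S.VT false)} {A : S.VT false} {V W : Val S false Γ A}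
    (e : VEq (V.map foEmb) (W.map foEmb)) : VEq V W := by
  obtain ⟨ρ, r⟩ := EnvRep.exists_id Γ
  -- In the generic environment the interpretations reify to the two terms under the identity
  -- substitution, while soundness makes the interpretations equal.
  have e' := (V.reify_sem r).symm.trans ((congrArg _ (e.sem ρ)).trans (W.reify_sem r))
  rw [Val.sub_id, Val.sub_id] at e'
  exact Quotient.exact e'

/-- The generic hole argument: a stack from `B` is interpreted over the hole type `B` itself, at the
reflection of the empty stack, so that reification returns the stack unchanged. -/
theorem FillRep.exists_id (G : List (S.VT false)) : ∀ Δ : Option (S.CT false),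
    ∃ x : (Hole S (Δ.map (CTy.map foEmb)) Δ).obj G, FillRep x (Fill.id Δ)
  | none => ⟨PUnit.unit, trivial⟩
  | some B => ⟨(CTy.rep S true B).reflect (Cmp.cls .hole), CRep.reify_reflect _ _⟩

/-- First-order computations and stacks that are equal in the language with function types are
equal in the first-order language. -/
theorem CEq.of_map {Γ : List (S.VT false)} {Δ : Option (S.CT false)} {C : S.CT false}
    {M N : Cmp S false Γ Δ C} (e : CEq (M.map foEmb) (N.map foEmb)) : CEq M N := by
  obtain ⟨ρ, r⟩ := EnvRep.exists_id Γ
  obtain ⟨x, p⟩ := FillRep.exists_id Γ Δ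
  have e' := (M.reify_sem r Δ x _ p).symm.trans
    ((congrArg _ (e.sem Δ ρ x)).trans (N.reify_sem r Δ x _ p))
  rw [Cmp.sub_id, Cmp.sub_id, Cmp.fill_id, Cmp.fill_id] at e'
  exact Quotient.exact e'

end Conservativity

/-! ### Definability -/

section Definability

variable {S : Signature.{u}}

theorem VEq.of_eq {h : Bool} {Γ : List (S.VT h)} {A : S.VT h} {V W : Val S h Γ A}
    (e : V = W) : VEq V W := e ▸ .refl _

theorem VEq.ren {h : Bool} {Γ Γ' : List (S.VT h)} {A : S.VT h} {V W : Val S h Γ A} (e : VEq V W)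
    (r : Ren Γ Γ') : VEq (V.ren r) (W.ren r) := by
  rw [Val.ren_eq_sub, Val.ren_eq_sub]; exact e.sub _

theorem Cmp.ren_id {h : Bool} {Γ : List (S.VT h)} {Δ : Option (S.CT h)} {C : S.CT h}
    (M : Cmp S h Γ Δ C) : M.ren (fun _ x => x) = M := by
  rw [Cmp.ren_eq_sub]; exact M.sub_id

/-- Stacks commute with sequencing, provably. -/
theorem CEq.plug_to_comm {h : Bool} {Γ : List (S.VT h)} {Δ : Option (S.CT h)} {A : S.VT h}
    {B C : S.CT h} (K : Cmp S h Γ (some B) C) (M : Cmp S h Γ Δ (.F A))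
    (N : Cmp S h (A :: Γ) none B) :
    CEq (K.plug (.to M N)) (.to M ((K.ren Ren.wk).plug N)) := by
  have e := (CEq.plug_to K N).fill (.put M)
  rw [Cmp.fill_fill] at e
  exact e

/-- The embedding of first-order contexts. -/
abbrev Ctx (G : List (S.VT false)) : List (S.VT true) := G.map (VTy.map foEmb)

/-- The embedding of first-order hole types. -/
abbrev HoleTy (D : Option (S.CT false)) : Option (S.CT true) := D.map (CTy.map foEmb)

/-- A value is definable if it is provably equal to a first-order value. -/
def VDef {G : List (S.VT false)} {A : S.VT false} (V : Val S true (Ctx G) (A.map foEmb)) : Prop :=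
  ∃ W : Val S false G A, VEq V (W.map foEmb)

/-- A computation or stack is definable if it is provably equal to a first-order one. -/
def CDef {G : List (S.VT false)} {D : Option (S.CT false)} {C : S.CT false}
    (M : Cmp S true (Ctx G) (HoleTy D) (C.map foEmb)) : Prop :=
  ∃ N : Cmp S false G D C, CEq M (N.map foEmb)

/-- The renamings that come from the first-order language. -/
def FORen {G G' : List (S.VT false)} (r : Ren (Ctx G) (Ctx G')) : Prop :=
  ∃ r₀ : Ren G G', Ren.Maps foEmb r₀ r

theorem FORen.id (G : List (S.VT false)) : FORen (G := G) (G' := G) (fun _ x => x) :=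
  ⟨fun _ x => x, fun _ _ => rfl⟩

theorem FORen.comp {G G' G'' : List (S.VT false)} {r : Ren (Ctx G) (Ctx G')}
    {s : Ren (Ctx G') (Ctx G'')} (hr : FORen r) (hs : FORen s) :
    FORen (G := G) (G' := G'') (fun _ x => s (r x)) := by
  obtain ⟨r₀, hr⟩ := hr
  obtain ⟨s₀, hs⟩ := hs
  exact ⟨fun _ x => s₀ (r₀ x), fun _ x => (congrArg (fun y => s y) (hr x)).trans (hs _)⟩

theorem FORen.wk (G : List (S.VT false)) (A : S.VT false) :
    FORen (G := G) (G' := A :: G) Ren.wk := ⟨Ren.wk, Ren.Maps.wk foEmb⟩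

theorem VDef.congr {G : List (S.VT false)} {A : S.VT false}
    {V W : Val S true (Ctx G) (A.map foEmb)} (e : VEq V W) : VDef V → VDef W :=
  fun ⟨X, p⟩ => ⟨X, e.symm.trans p⟩

theorem CDef.congr {G : List (S.VT false)} {D : Option (S.CT false)} {C : S.CT false}
    {M N : Cmp S true (Ctx G) (HoleTy D) (C.map foEmb)} (e : CEq M N) : CDef M → CDef N :=
  fun ⟨P, p⟩ => ⟨P, e.symm.trans p⟩

theorem VDef.ren {G G' : List (S.VT false)} {A : S.VT false}
    {V : Val S true (Ctx G) (A.map foEmb)} {r : Ren (Ctx G) (Ctx G')} (hr : FORen r) :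
    VDef V → VDef (G := G') (V.ren r) := by
  rintro ⟨X, p⟩
  obtain ⟨r₀, hr⟩ := hr
  exact ⟨X.ren r₀, (p.ren r).trans (.of_eq (X.map_ren foEmb hr).symm)⟩

theorem CDef.ren {G G' : List (S.VT false)} {D : Option (S.CT false)} {C : S.CT false}
    {M : Cmp S true (Ctx G) (HoleTy D) (C.map foEmb)} {r : Ren (Ctx G) (Ctx G')} (hr : FORen r) :
    CDef M → CDef (G := G') (M.ren r) := by
  rintro ⟨X, p⟩
  obtain ⟨r₀, hr⟩ := hr
  exact ⟨X.ren r₀, (p.ren r).trans (.of_eq (X.map_ren foEmb hr).symm)⟩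

-- The logical predicate for definability

/-- The substitution of a value for the last variable and a renaming for the others. -/
abbrev Subst.consRen {Γ Γ' : List (S.VT true)} {A : S.VT true} (V : Val S true Γ' A)
    (r : Ren Γ Γ') : Subst S true (A :: Γ) Γ' := Subst.cons V (fun _ x => .var (r x))

mutual
/-- The logical predicate on values in first-order contexts. -/
def VTy.Red : (A : S.VT true) → (G : List (S.VT false)) → Val S true (Ctx G) A → Prop
  | .base b, _, V => VDef (A := .base b) V
  | .unit, _, _ => True
  | .prod A B, G, V => VTy.Red A G (.fst V) ∧ VTy.Red B G (.snd V)
  | .U B, G, V => CTy.Red B G none (.force V)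

/-- The logical predicate on computations and stacks in first-order contexts. -/
def CTy.Red : (B : S.CT true) → (G : List (S.VT false)) → (D : Option (S.CT false)) →
    Cmp S true (Ctx G) (HoleTy D) B → Prop
  | .base b, _, _, M => CDef (C := .base b) M
  -- The type `A` need not be first-order, so the predicate cannot ask for a definable returner. It
  -- tests `M` against continuations of the full language that send arguments satisfying the
  -- predicate, in any later context, to definable computations of a first-order type.
  | .F A, G, D, M => ∀ (G' : List (S.VT false)) (r : Ren (Ctx G) (Ctx G')), FORen r →
      ∀ (C : S.CT false) (N : Cmp S true (A :: Ctx G') none (C.map foEmb)),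
        (∀ (G'' : List (S.VT false)) (s : Ren (Ctx G') (Ctx G'')), FORen s →
          ∀ V : Val S true (Ctx G'') A, VTy.Red A G'' V →
            CDef (D := none) (N.sub (Subst.consRen V s))) →
        CDef (.to (M.ren r) N)
  | .top, _, _, _ => True
  | .prod B C, G, D, M => CTy.Red B G D (.fst M) ∧ CTy.Red C G D (.snd M)
  | .arr hh A B, G, D, M => ∀ (G' : List (S.VT false)) (r : Ren (Ctx G) (Ctx G')), FORen r →
      ∀ V : Val S true (Ctx G') A, VTy.Red A G' V → CTy.Red B G' D (.app hh (M.ren r) V)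
end

mutual
-- Invariance under provable equality allows β- and η-steps to be used freely in the fundamental
-- lemma.
theorem VTy.Red.congr : ∀ (A : S.VT true) {G : List (S.VT false)} {V W : Val S true (Ctx G) A},
    VEq V W → VTy.Red A G V → VTy.Red A G W
  | .base b, _, _, _, e, p => VDef.congr e p
  | .unit, _, _, _, e, p => trivial
  | .prod A B, _, _, _, e, p =>
      ⟨VTy.Red.congr A (.fst e) p.1, VTy.Red.congr B (.snd e) p.2⟩
  | .U B, _, _, _, e, p => CTy.Red.congr B (.force e) p

theorem CTy.Red.congr : ∀ (B : S.CT true) {G : List (S.VT false)} {D : Option (S.CT false)}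
    {M N : Cmp S true (Ctx G) (HoleTy D) B}, CEq M N → CTy.Red B G D M → CTy.Red B G D N
  | .base b, _, _, _, _, e, p => CDef.congr e p
  | .F A, _, _, _, _, e, p => fun G' r hr C N q =>
      (p G' r hr C N q).congr (.to (e.ren r) (.refl _))
  | .top, _, _, _, _, e, p => trivial
  | .prod B C, _, _, _, _, e, p =>
      ⟨CTy.Red.congr B (.fst e) p.1, CTy.Red.congr C (.snd e) p.2⟩
  | .arr hh A B, _, _, _, _, e, p => fun G' r hr V q =>
      CTy.Red.congr B (.app hh (e.ren r) (.refl _)) (p G' r hr V q)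
end

mutual
-- Kripke monotonicity. At `F` and at function types it holds because these clauses quantify over
-- all later contexts and first-order renamings compose.
theorem VTy.Red.ren : ∀ (A : S.VT true) {G G' : List (S.VT false)} {V : Val S true (Ctx G) A}
    {r : Ren (Ctx G) (Ctx G')}, FORen r → VTy.Red A G V → VTy.Red A G' (V.ren r)
  | .base b, _, _, _, _, hr, p => VDef.ren hr p
  | .unit, _, _, _, _, hr, p => trivial
  | .prod A B, _, _, _, _, hr, p => ⟨VTy.Red.ren A hr p.1, VTy.Red.ren B hr p.2⟩
  | .U B, _, _, _, _, hr, p => CTy.Red.ren B hr p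

theorem CTy.Red.ren : ∀ (B : S.CT true) {G G' : List (S.VT false)} {D : Option (S.CT false)}
    {M : Cmp S true (Ctx G) (HoleTy D) B} {r : Ren (Ctx G) (Ctx G')}, FORen r →
    CTy.Red B G D M → CTy.Red B G' D (M.ren r)
  | .base b, _, _, _, _, _, hr, p => CDef.ren hr p
  | .F A, _, _, _, M, r, hr, p => fun G' s hs C N q => by
      rw [Cmp.ren_ren]
      exact p G' _ (hr.comp hs) C N q
  | .top, _, _, _, _, _, hr, p => trivial
  | .prod B C, _, _, _, _, _, hr, p => ⟨CTy.Red.ren B hr p.1, CTy.Red.ren C hr p.2⟩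
  | .arr hh A B, _, _, _, M, r, hr, p => fun G' s hs V q => by
      rw [Cmp.ren_ren]
      exact p G' _ (hr.comp hs) V q
end

theorem Cmp.ren_consRen {Γ Γ' Γ'' : List (S.VT true)} {A : S.VT true} {Δ : Option (S.CT true)}
    {C : S.CT true} (N : Cmp S true (A :: Γ) Δ C) (r : Ren Γ Γ') (s : Ren Γ' Γ'')
    (V : Val S true Γ'' A) : (N.ren r.lift).sub (Subst.consRen V s) =
      N.sub (Subst.consRen V (fun _ x => s (r x))) := by
  rw [Cmp.ren_sub]
  congr 1
  funext B x
  cases x <;> rfl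

theorem Val.wk_consRen {Γ Γ' : List (S.VT true)} {A B : S.VT true} (W : Val S true Γ B)
    (V : Val S true Γ' A) (s : Ren Γ Γ') : (W.ren Ren.wk).sub (Subst.consRen V s) = W.ren s := by
  rw [Val.ren_sub, Val.ren_eq_sub]
  rfl

/-- The logical predicate is closed under sequencing. -/
theorem CTy.Red.to : ∀ (B : S.CT true) {G : List (S.VT false)} {D : Option (S.CT false)}
    {A : S.VT true} {M : Cmp S true (Ctx G) (HoleTy D) (.F A)}
    {N : Cmp S true (A :: Ctx G) none B}, CTy.Red (.F A) G D M →
    (∀ (G' : List (S.VT false)) (s : Ren (Ctx G) (Ctx G')), FORen s →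
      ∀ V : Val S true (Ctx G') A, VTy.Red A G' V →
        CTy.Red B G' none (N.sub (Subst.consRen V s))) →
    CTy.Red B G D (.to M N)
  | .base b, G, _, _, M, N, p, q => by
      -- A base type is first-order and its predicate is definability, so `N` itself is an
      -- admissible test for `M`.
      have e := p G _ (FORen.id G) (.base b) N q
      rw [Cmp.ren_id] at e
      exact e
  | .F A', G, D, A, M, N, p, q => fun G' r hr C P l => by
      -- Sequencing is reassociated: testing `M to N` against `P` amounts to testing `M` against the
      -- continuation `N to P`.
      refine (p G' r hr C (.to (N.ren r.lift) (P.ren Ren.wk.lift)) fun G'' s hs V v => ?_).congr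
        (CEq.plug_to_comm (.to .hole P) (M.ren r) (N.ren r.lift)).symm
      -- For each admissible argument `V`, the instance of `N` at `V` satisfies the predicate at
      -- `F`, hence passes the test against the suitably renamed `P`.
      have q' := q G'' _ (hr.comp hs) V v G'' _ (FORen.id G'') C
        (P.sub (Subst.lift fun _ x => .var (s x))) fun G₃ t ht W w => by
          have l' := l G₃ _ (hs.comp ht) W w
          rw [Cmp.sub_sub]
          convert l' using 2
          funext B x
          cases x <;> rfl
      rw [Cmp.ren_id] at q'
      change CDef (D := none) (Cmp.to ((N.ren r.lift).sub _) ((P.ren _).sub _))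
      rw [Cmp.ren_consRen, Cmp.ren_sub]
      convert q' using 3
      funext B x
      cases x <;> rfl
  | .top, _, _, _, _, _, _, _ => trivial
  | .prod B C, _, _, _, M, N, p, q =>
      -- A projection is a stack and commutes with `to`, so it moves into the continuation and the
      -- claim reduces to the component types.
      ⟨CTy.Red.congr B (CEq.plug_to_comm (.fst .hole) M N).symm
          (CTy.Red.to B p fun G' s hs V v => (q G' s hs V v).1),
        CTy.Red.congr C (CEq.plug_to_comm (.snd .hole) M N).symm
          (CTy.Red.to C p fun G' s hs V v => (q G' s hs V v).2)⟩
  | .arr hh A' B, _, _, _, M, N, p, q => fun G' r hr W w => by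
      -- Application to `W` is also a stack. Moved into the continuation, it turns the hypothesis on
      -- `N` at a function type into one at `B`, with `W` weakened along the later renaming.
      refine CTy.Red.congr B (CEq.plug_to_comm (.app hh .hole W) (M.ren r) (N.ren r.lift)).symm
        (CTy.Red.to B (CTy.Red.ren _ hr p) fun G'' s hs V v => ?_)
      have q' := q G'' _ (hr.comp hs) V v G'' _ (FORen.id G'') (W.ren s) (VTy.Red.ren A' hs w)
      rw [Cmp.ren_id] at q'
      change CTy.Red B G'' none (Cmp.app hh ((N.ren r.lift).sub _) ((W.ren _).sub _))
      rw [Cmp.ren_consRen, Val.wk_consRen]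
      exact q'

theorem Subst.consRen_wk {Γ : List (S.VT true)} {A : S.VT true} :
    Subst.consRen (.var .zero) (Ren.wk (Γ := Γ) (B := A)) = Subst.id := by
  funext B x
  cases x <;> rfl

mutual
/-- At first-order types the logical predicate is definability. -/
theorem VTy.red_iff : ∀ (A : S.VT false) {G : List (S.VT false)}
    {V : Val S true (Ctx G) (A.map foEmb)}, VTy.Red (A.map foEmb) G V ↔ VDef V
  | .base b, _, _ => Iff.rfl
  | .unit, _, V => ⟨fun _ => ⟨.unit, .unit_eta V⟩, fun _ => trivial⟩
  | .prod A B, _, V => by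
      refine (and_congr (VTy.red_iff A) (VTy.red_iff B)).trans ⟨?_, ?_⟩
      · rintro ⟨⟨X, p⟩, ⟨Y, q⟩⟩
        exact ⟨.pair X Y, (VEq.pair_eta V).trans (.pair p q)⟩
      · rintro ⟨X, p⟩
        exact ⟨⟨.fst X, .fst p⟩, ⟨.snd X, .snd p⟩⟩
  | .U B, _, V => by
      refine (CTy.red_iff B).trans ⟨?_, ?_⟩
      · rintro ⟨X, p⟩
        exact ⟨.thunk X, (VEq.thunk_eta V).trans (.thunk p)⟩
      · rintro ⟨X, p⟩
        exact ⟨.force X, .force p⟩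

/-- At first-order types the logical predicate is definability. -/
theorem CTy.red_iff : ∀ (B : S.CT false) {G : List (S.VT false)} {D : Option (S.CT false)}
    {M : Cmp S true (Ctx G) (HoleTy D) (B.map foEmb)}, CTy.Red (B.map foEmb) G D M ↔ CDef M
  | .base b, _, _, _ => Iff.rfl
  | .F A, G, D, M => by
      constructor
      · intro p
        -- The test with `return x` at result type `F A`: its results are definable because
        -- admissible values of type `A` are, and by the η-law it recovers `M`.
        have e := p G _ (FORen.id G) (.F A) (.ret (.var .zero)) fun G' s hs V v => by
          obtain ⟨X, q⟩ := (VTy.red_iff A).1 v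
          exact ⟨.ret X, .ret q⟩
        exact e.congr (.trans (.to (.of_eq (Cmp.ren_id M)) (.refl _)) (CEq.to_eta .hole M).symm)
      · rintro ⟨X, p⟩ G' r ⟨r₀, hr⟩ C N q
        -- The last variable over the extended first-order context is definable, hence an admissible
        -- argument. The test at this generic argument gives a first-order body for the whole
        -- continuation.
        have q' := q (A :: G') Ren.wk (FORen.wk G' A) (.var .zero)
          ((VTy.red_iff A).2 ⟨.var .zero, .refl _⟩)
        rw [Subst.consRen_wk, Cmp.sub_id] at q'
        obtain ⟨Y, q'⟩ := q'
        exact ⟨.to (X.ren r₀) Y,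
          .to ((p.ren r).trans (.of_eq (X.map_ren foEmb hr).symm)) q'⟩
  | .top, _, _, M => ⟨fun _ => ⟨.top, .top_eta M⟩, fun _ => trivial⟩
  | .prod B C, _, _, M => by
      refine (and_congr (CTy.red_iff B) (CTy.red_iff C)).trans ⟨?_, ?_⟩
      · rintro ⟨⟨X, p⟩, ⟨Y, q⟩⟩
        exact ⟨.pair X Y, (CEq.pair_eta M).trans (.pair p q)⟩
      · rintro ⟨X, p⟩
        exact ⟨⟨.fst X, .fst p⟩, ⟨.snd X, .snd p⟩⟩
  | .arr hh _ _, _, _, _ => nomatch hh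
end

/-- The logical predicate on fillings. -/
inductive FillRed (G : List (S.VT false)) : {Δ : Option (S.CT true)} → (D : Option (S.CT false)) →
    Fill S true (Ctx G) Δ (HoleTy D) → Prop
  | nil : FillRed G none (Δ := none) .nil
  | put {D : Option (S.CT false)} {B : S.CT true} {M : Cmp S true (Ctx G) (HoleTy D) B} :
      CTy.Red B G D M → FillRed G D (.put M)

theorem FillRed.ren {G G' : List (S.VT false)} {Δ : Option (S.CT true)} {D : Option (S.CT false)}
    {f : Fill S true (Ctx G) Δ (HoleTy D)} {r : Ren (Ctx G) (Ctx G')} (hr : FORen r) :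
    FillRed G D f → FillRed G' D (f.ren r)
  | .nil => .nil
  | .put p => .put (CTy.Red.ren _ hr p)

/-- The logical predicate on substitutions. -/
def SubstRed {Γ : List (S.VT true)} (G : List (S.VT false)) (σ : Subst S true Γ (Ctx G)) : Prop :=
  ∀ ⦃A : S.VT true⦄ (x : Var Γ A), VTy.Red A G (σ x)

theorem SubstRed.cons {Γ : List (S.VT true)} {A : S.VT true} {G G' : List (S.VT false)}
    {σ : Subst S true Γ (Ctx G)} (p : SubstRed G σ) {s : Ren (Ctx G) (Ctx G')} (hs : FORen s)
    {V : Val S true (Ctx G') A} (v : VTy.Red A G' V) :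
    SubstRed (Γ := A :: Γ) G' (Subst.cons V (fun _ x => (σ x).ren s)) := by
  intro B x
  cases x with
  | zero => exact v
  | succ x => exact VTy.Red.ren B hs (p x)

theorem Cmp.lift_consRen {Γ Γ' Γ'' : List (S.VT true)} {A : S.VT true} {Δ : Option (S.CT true)}
    {C : S.CT true} (N : Cmp S true (A :: Γ) Δ C) (σ : Subst S true Γ Γ') (s : Ren Γ' Γ'')
    (V : Val S true Γ'' A) : (N.sub (Subst.lift σ)).sub (Subst.consRen V s) =
      N.sub (Subst.cons V (fun _ x => (σ x).ren s)) := by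
  rw [Cmp.sub_sub]
  congr 1
  funext B x
  cases x with
  | zero => rfl
  | succ x => exact Val.wk_consRen (σ x) V s

theorem Fill.wk_consRen {Γ Γ' : List (S.VT true)} {A : S.VT true} {Θ Δ : Option (S.CT true)}
    (f : Fill S true Γ Θ Δ) (V : Val S true Γ' A) (s : Ren Γ Γ') :
    (f.ren Ren.wk).sub (Subst.consRen V s) = f.ren s := by
  cases f with
  | nil => rfl
  | put M => exact congrArg Fill.put ((M.ren_sub _ _).trans (M.ren_eq_sub s).symm)

theorem Cmp.app_lam {Γ Γ' : List (S.VT true)} {Δ : Option (S.CT true)} (hh : true = true)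
    {A : S.VT true} {B : S.CT true} (M : Cmp S true (A :: Γ) Δ B) (r : Ren Γ Γ')
    (V : Val S true Γ' A) :
    CEq (.app hh ((Cmp.lam hh M).ren r) V) (M.sub (Subst.consRen V r)) := by
  refine (CEq.app_beta hh _ _).trans (.of_eq ?_)
  exact M.ren_consRen r (fun _ x => x) V

mutual
/-- Every value satisfies the logical predicate. -/
theorem Val.red : ∀ {Γ : List (S.VT true)} {A : S.VT true} (V : Val S true Γ A)
    {G : List (S.VT false)} {σ : Subst S true Γ (Ctx G)}, SubstRed G σ → VTy.Red A G (V.sub σ)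
  | _, _, .var x, _, _, p => p x
  | _, _, .unit, _, _, p => trivial
  | _, _, .pair V W, _, _, p =>
      ⟨VTy.Red.congr _ (VEq.fst_beta _ _).symm (V.red p),
        VTy.Red.congr _ (VEq.snd_beta _ _).symm (W.red p)⟩
  | _, _, .fst V, _, _, p => (V.red p).1
  | _, _, .snd V, _, _, p => (V.red p).2
  | _, _, .thunk M, _, σ, p => by
      have e := M.red p none .nil .nil
      rw [show (M.sub σ).fill .nil = M.sub σ from Cmp.fill_id _] at e
      exact CTy.Red.congr _ (CEq.force_beta _).symm e
  | _, _, .op o hA hB V, _, _, p => by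
      have e := V.red p
      subst hA
      subst hB
      -- The types of an operation are first-order, so its argument is definable, and the same
      -- operation exists in the first-order language.
      obtain ⟨X, e⟩ := (VTy.red_iff _).1 e
      exact (VTy.red_iff _).2
        ⟨.op o (VTy.ofFO_false _).symm (VTy.ofFO_false _).symm X, .op o _ _ e⟩

/-- Every computation or stack satisfies the logical predicate. -/
theorem Cmp.red : ∀ {Γ : List (S.VT true)} {Δ : Option (S.CT true)} {C : S.CT true}
    (M : Cmp S true Γ Δ C) {G : List (S.VT false)} {σ : Subst S true Γ (Ctx G)}, SubstRed G σ →
    ∀ (D : Option (S.CT false)) (f : Fill S true (Ctx G) Δ (HoleTy D)), FillRed G D f →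
      CTy.Red C G D ((M.sub σ).fill f)
  | _, _, _, .hole, _, _, p, D, _, .put q => q
  | _, _, _, .force V, _, _, p, _, _, .nil => V.red p
  | _, _, _, .ret V, _, _, p, _, _, .nil => fun G' r hr C N l => by
      -- The returned value satisfies the predicate, so it may be fed to the test continuation; β
      -- identifies the outcome with `return V` sequenced into it.
      refine (l G' _ (FORen.id G') (Val.ren _ r) (VTy.Red.ren _ hr (V.red p))).congr ?_
      exact (CEq.to_beta _ _).symm
  | _, _, _, .to M N, _, σ, p, D, f, q => by
      simp only [Cmp.sub, Cmp.fill]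
      -- The filling goes only into `M`, the part in evaluation position. The body `N` is handled by
      -- induction under the substitution extended with `V` in the later context.
      refine CTy.Red.to _ (M.red p D f q) fun G' s hs V v => ?_
      rw [Cmp.lift_consRen]
      have e := N.red (p.cons hs v) none .nil .nil
      rw [show Cmp.fill _ .nil = _ from Cmp.fill_id _] at e
      exact e
  | _, _, _, .top, _, _, p, D, f, q => trivial
  | _, _, _, .pair M N, _, _, p, D, f, q => by
      simp only [Cmp.sub, Cmp.fill]
      exact ⟨CTy.Red.congr _ (CEq.fst_beta _ _).symm (M.red p D f q),
        CTy.Red.congr _ (CEq.snd_beta _ _).symm (N.red p D f q)⟩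
  | _, _, _, .fst M, _, _, p, D, f, q => by
      simp only [Cmp.sub, Cmp.fill]
      exact (M.red p D f q).1
  | _, _, _, .snd M, _, _, p, D, f, q => by
      simp only [Cmp.sub, Cmp.fill]
      exact (M.red p D f q).2
  | _, _, _, .lam hh M, _, _, p, D, f, q => fun G' r hr V v => by
      simp only [Cmp.sub, Cmp.fill]
      refine CTy.Red.congr _ (Cmp.app_lam hh _ r V).symm ?_
      -- After the β-step, the argument and the renaming combine with the given substitution into an
      -- extended one, and the filling, weakened under the binder, is just renamed.
      rw [Cmp.fill_sub, Cmp.lift_consRen, Fill.wk_consRen]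
      exact M.red (p.cons hr v) D _ (q.ren hr)
  | _, _, _, .app hh M V, G, _, p, D, f, q => by
      simp only [Cmp.sub, Cmp.fill]
      have e := M.red p D f q G _ (FORen.id G) _ (V.red p)
      rw [Cmp.ren_id] at e
      exact e
  | _, _, _, .cop o hA hB V, _, _, p, _, _, .nil => by
      have e := V.red p
      subst hA
      subst hB
      obtain ⟨X, e⟩ := (VTy.red_iff _).1 e
      exact (CTy.red_iff _).2
        ⟨.cop o (VTy.ofFO_false _).symm (CTy.ofFO_false _).symm X, .cop o _ _ e⟩
  | _, _, _, .kop o hA hB hC V M, _, _, p, D, f, q => by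
      have e₁ := V.red p
      have e₂ := M.red p D f q
      simp only [Cmp.sub, Cmp.fill]
      subst hA
      subst hB
      subst hC
      obtain ⟨X, e₁⟩ := (VTy.red_iff _).1 e₁
      obtain ⟨Y, e₂⟩ := (CTy.red_iff _).1 e₂
      exact (CTy.red_iff _).2
        ⟨.kop o (VTy.ofFO_false _).symm (CTy.ofFO_false _).symm (CTy.ofFO_false _).symm X Y,
          .kop o _ _ _ e₁ e₂⟩
end

/-- Variables of a first-order context are definable, and at first-order types this suffices for the
predicate. -/
theorem SubstRed.id : ∀ G : List (S.VT false), SubstRed G (Subst.id (Γ := Ctx G))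
  | [] => fun _ x => nomatch x
  | A :: G => fun B x => by
      cases x with
      | zero => exact (VTy.red_iff A).2 ⟨.var .zero, .refl _⟩
      | succ x => exact VTy.Red.ren B (FORen.wk G A) (SubstRed.id G x)

/-- The empty stack out of a first-order type is definable; this starts the argument for stacks as
the identity substitution does for values. -/
theorem FillRed.id (G : List (S.VT false)) : ∀ D : Option (S.CT false),
    FillRed G D (Fill.id (HoleTy D))
  | none => .nil
  | some B => .put ((CTy.red_iff B).2 ⟨.hole, .refl _⟩)

/-- Every value of first-order type in a first-order context is definable. -/
theorem Val.definable {G : List (S.VT false)} {A : S.VT false}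
    (V : Val S true (Ctx G) (A.map foEmb)) : VDef V := by
  have e := V.red (SubstRed.id G)
  rw [Val.sub_id] at e
  exact (VTy.red_iff A).1 e

/-- Every computation or stack of first-order type in a first-order context is definable. -/
theorem Cmp.definable {G : List (S.VT false)} {D : Option (S.CT false)} {C : S.CT false}
    (M : Cmp S true (Ctx G) (HoleTy D) (C.map foEmb)) : CDef M := by
  have e := M.red (SubstRed.id G) D _ (FillRed.id G D)
  rw [Cmp.sub_id, Cmp.fill_id] at e
  exact (CTy.red_iff C).1 e

end Definability

end CBPV

-- Full faithfulness and conservativity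

/-- For every signature `S`, the canonical strict map from the first-order syntactic model to the
syntactic model is fully faithful as a locally indexed functor. In particular function types are
conservative: first-order values, computations (`Δ = none`) and stacks (`Δ = some B`) are provably
equal in the language with function types exactly when they are provably equal in the first-order
language. -/
theorem mainTheorem3 (S : CBPV.Signature.{u}) :
    (CBPV.inclusion S).toLIMap.FullyFaithful ∧
    (∀ (Γ : List (S.VT false)) (A : S.VT false) (V W : CBPV.Val S false Γ A),
      CBPV.VEq (V.map (h' := true) (fun _ => rfl)) (W.map (h' := true) (fun _ => rfl)) ↔
        CBPV.VEq V W) ∧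
    (∀ (Γ : List (S.VT false)) (Δ : Option (S.CT false)) (C : S.CT false)
      (M N : CBPV.Cmp S false Γ Δ C),
      CBPV.CEq (M.map (h' := true) (fun _ => rfl)) (N.map (h' := true) (fun _ => rfl)) ↔
        CBPV.CEq M N) := by
  refine ⟨⟨⟨fun {A B} f => ?_⟩, ⟨fun {A B} f g e => ?_⟩, fun c => ⟨fun {A B} f => ?_⟩,
    fun c => ⟨fun {A B} f g e => ?_⟩⟩, fun Γ A V W => ⟨CBPV.VEq.of_map, CBPV.VEq.map _⟩,
    fun Γ Δ C M N => ⟨CBPV.CEq.of_map, CBPV.CEq.map _⟩⟩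
  · induction f using CBPV.Val.hom_ind with | e V
    -- A map between embedded value types is a value in the context of one embedded variable;
    -- definability supplies its preimage.
    obtain ⟨W, p⟩ := CBPV.Val.definable (G := [A.ty]) (A := B.ty) V
    exact ⟨W.hom, (CBPV.Val.hom_eq p).symm⟩
  · induction f using CBPV.Val.hom_ind with | e V
    induction g using CBPV.Val.hom_ind with | e W
    exact CBPV.Val.hom_eq (CBPV.VEq.of_map (Quotient.exact e))
  · induction f using CBPV.Cmp.hom_ind with | e K
    -- Taking the hole type `D` to be the source of the stack makes definability of terms with a
    -- hole into fullness on stacks.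
    obtain ⟨L, p⟩ := CBPV.Cmp.definable (G := [c.ty]) (D := some A) (C := B) K
    exact ⟨L.hom, (CBPV.Cmp.hom_eq p).symm⟩
  · induction f using CBPV.Cmp.hom_ind with | e K
    induction g using CBPV.Cmp.hom_ind with | e L
    exact CBPV.Cmp.hom_eq (CBPV.CEq.of_map (Quotient.exact e))
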